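/- Let $m\ge 1$ be an integer and, for $a=(a_1,\dots,a_m)\in\mathbb C^m$, let $P_m(x,a)=x^m+a_1x^{m-1}+\dots+a_m$. Points $x$ of the universal covering of $\mathbb C^*$ with base point $1$ are identified with $t=\ln x\in\mathbb C$ (so $\arg x=\operatorname{Im} t$), and $x^\alpha=\exp(\alpha\ln x)$, with $\ln x$ real for $\arg x=0$. Let $b_{m/2-k}(a)\in\mathbb C[a]$ be the coefficients of the expansion at infinity $$\frac{\sqrt{P_m(x,a)}}{x}=x^{\frac m2-1}+\sum_{k\ge 1}b_{\frac m2-k}(a)\,x^{\frac m2-k-1},$$ and put $$S(x,a)=\frac2m x^{\frac m2}+\sum_{1\le k<m/2}\frac{b_{\frac m2-k}(a)}{\frac m2-k}\,x^{\frac m2-k},\qquad r(a)=\begin{cases}\frac12-\frac m4,& m\text{ odd},\\ \frac12-\frac m4-b_0(a),& m\text{ even.}\end{cases}$$ Put $q=2$ if $m$ is odd and $q=1$ if $m$ is even. Let $\Sigma_0=\{|x|>0,\ |\arg x|<3\pi/m\}$, a sector of the universal covering. A strict sub-sector of $\Sigma_0$ is a set $\{\alpha\le\arg x\le\beta\}$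 with $-3\pi/m<\alpha\le\beta<3\pi/m$. For $\rho\in\mathbb C[a]$ and a formal series $u=\sum_{n\ge0}u_n(a)x^{-n/q}\in\mathbb C[a][[x^{-1/q}]]$, we write $f(x,a)\sim x^{\rho(a)}e^{-S(x,a)}u(x,a)$ if, for every compact $K\subset\mathbb C^m$, every strict sub-sector $\Sigma$ of $\Sigma_0$ and every $N\in\mathbb N$, there are constants $C,R$ such that for all $a\in K$ and all $x\in\Sigma$ with $|x|\ge R$ $$\Big|f(x,a)\,x^{-\rho(a)}e^{S(x,a)}-\sum_{n<N}u_n(a)x^{-n/q}\Big|\le C|x|^{-N/q}.$$ **Theorem 2.1.** The differential equation $\dfrac{d^2}{dx^2}\Phi(x)=\dfrac{P_m(x,a)}{x^2}\,\Phi(x)$ admits a unique solution $\Phi_0(x,a)$ satisfying the following condition 1: 1. For every $a\in\mathbb C^m$, $\Phi_0$ is analytic in $x$ in $\Sigma_0$, and there is a formal series $\phi_0\in\mathbb C[a][[x^{-1/q}]]$ with constant term $1$ such that $\Phi_0(x,a)\sim x^{r(a)}e^{-S(x,a)}\phi_0(x,a)$ (that is, in every strict sub-sector of $\Sigma_0$,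 uniformly for $a$ in compact sets). (Uniqueness means that any two functions on $\Sigma_0\times\mathbb C^m$ that solve the equation for every $a$ and satisfy condition 1 are equal.) Moreover: 2. $\Phi_0$ extends analytically in $x$ to the universal covering of $\mathbb C^*$, and is an entire function of $a$: the extension is holomorphic in $(\ln x,a)\in\mathbb C\times\mathbb C^m$, and it still solves the equation. 3. The expansion can be differentiated: $\dfrac{d}{dx}\Phi_0(x,a)\sim\dfrac{d}{dx}\big(x^{r(a)}e^{-S(x,a)}\phi_0(x,a)\big)$, where the right-hand side is computed formally and is of the form $x^{r(a)+\frac m2-1}e^{-S(x,a)}\psi(x,a)$ with $\psi\in\mathbb C[a][[x^{-1/q}]]$ of constant term $-1$. In particular $\dfrac{d}{dx}\Phi_0(x,a)=x^{r(a)+\frac m2-1}e^{-S(x,a)}(-1+o(1))$ when $x$ tends to infinity in any strict sub-sector of $\Sigma_0$, uniformly for $a$ in compact sets. -/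

import Mathlib

open scoped BigOperators

namespace IrregularSchrodinger

noncomputable section

/-! The universal covering of `ℂ* = ℂ \ {0}` with base point `1` is identified with `ℂ` through the
projection `t ↦ x = exp t`.  Thus `t = ln x`, `t.im = arg x`, `‖exp t‖ = |x|`, and a function of `x`
on (a part of) the covering is a function of `t`. -/

/-- The power `x ^ α = exp (α ln x)` at the point of the covering with coordinate `t = ln x`. -/
def xpow (t α : ℂ) : ℂ := Complex.exp (α * t)

/-- The derivation `d/dx` on functions on the covering, in the coordinate `t = ln x`:
`d/dx = x⁻¹ d/dt`. -/
def dx (f : ℂ → ℂ) (t : ℂ) : ℂ := Complex.exp (-t) * deriv f t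

/-- `P_m(x, a) = x ^ m + a_1 x ^ (m - 1) + ⋯ + a_m`; the entry `a i`, `i : Fin m`, is `a_{i+1}`. -/
def P (m : ℕ) (x : ℂ) (a : Fin m → ℂ) : ℂ := x ^ m + ∑ i : Fin m, a i * x ^ (m - (i.val + 1))

/-- `f` satisfies `d²f/dx² = (P_m(x, a) / x²) f` at every point of the set `U` of the covering. -/
def SolvesOn (m : ℕ) (a : Fin m → ℂ) (f : ℂ → ℂ) (U : Set ℂ) : Prop :=
  ∀ t ∈ U, dx (dx f) t = P m (Complex.exp t) a / Complex.exp t ^ 2 * f t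

/-- The sector `|arg x| < 3π/m` of the covering. -/
def sector (m : ℕ) : Set ℂ := {t | |t.im| < 3 * Real.pi / m}

/-- The coefficient of `u ^ k` in `u ^ m P_m(1/u, a) = 1 + a_1 u + ⋯ + a_m u ^ m`,
as a polynomial in `a`. -/
def revCoeff (m : ℕ) : ℕ → MvPolynomial (Fin m) ℂ
  | 0 => 1
  | k + 1 => if h : k < m then MvPolynomial.X ⟨k, h⟩ else 0

/-- The coefficients `b_{m/2-k}(a)` of the expansion at infinity
`√P_m(x, a) / x = x ^ (m/2-1) (1 + ∑_{k ≥ 1} b_{m/2-k}(a) x ^ (-k))`, as polynomials in `a`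
(`sqrtCoeff m k` is `b_{m/2-k}`).  They are the coefficients of the square root with constant
term `1` of `1 + a_1 u + ⋯ + a_m u ^ m` as a power series in `u = 1/x`; see `sqrtCoeff_spec`. -/
def sqrtCoeff (m : ℕ) : ℕ → MvPolynomial (Fin m) ℂ
  | 0 => 1
  | k + 1 => MvPolynomial.C (1 / 2) *
      (revCoeff m (k + 1) - ∑ i : Fin k, sqrtCoeff m (i.val + 1) * sqrtCoeff m (k - i.val))

theorem sqrtCoeff_spec (m : ℕ) :
    (PowerSeries.mk (sqrtCoeff m)) ^ 2 = PowerSeries.mk (revCoeff m) := by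
  ext1 k
  rw [sq, PowerSeries.coeff_mul, PowerSeries.coeff_mk,
    Finset.Nat.sum_antidiagonal_eq_sum_range_succ_mk]
  simp only [PowerSeries.coeff_mk]
  cases k with
  | zero => simp [sqrtCoeff, revCoeff]
  | succ k =>
    rw [Finset.sum_range_succ', Finset.sum_range_succ]
    have h1 : ∑ i ∈ Finset.range k, sqrtCoeff m (i + 1) * sqrtCoeff m (k + 1 - (i + 1))
        = ∑ i : Fin k, sqrtCoeff m (i.val + 1) * sqrtCoeff m (k - i.val) := by
      rw [Finset.sum_range]
      simp
    have h2 : (MvPolynomial.C (1 / 2) : MvPolynomial (Fin m) ℂ) * 2 = 1 := by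
      rw [show (2 : MvPolynomial (Fin m) ℂ) = MvPolynomial.C 2 from (map_ofNat _ 2).symm,
        ← MvPolynomial.C_mul]
      norm_num
    have h3 : sqrtCoeff m (k + 1) = MvPolynomial.C (1 / 2) * (revCoeff m (k + 1) -
        ∑ i : Fin k, sqrtCoeff m (i.val + 1) * sqrtCoeff m (k - i.val)) := by
      rw [sqrtCoeff]
    have h0 : sqrtCoeff m 0 = 1 := by rw [sqrtCoeff]
    rw [h1, Nat.sub_self, Nat.sub_zero, h0, h3]
    linear_combination (revCoeff m (k + 1) -
      ∑ i : Fin k, sqrtCoeff m (i.val + 1) * sqrtCoeff m (k - i.val)) * h2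

/-- `S(x, a) = (2/m) x ^ (m/2) + ∑_{1 ≤ k < m/2} b_{m/2-k}(a) / (m/2-k) x ^ (m/2-k)`.  The largest
integer `k < m/2` is `(m-1)/2` for odd `m` and `m/2 - 1` for even `m`: in both cases it is
the integer part of `(m-1)/2`. -/
def S (m : ℕ) (t : ℂ) (a : Fin m → ℂ) : ℂ :=
  2 / (m : ℂ) * xpow t ((m : ℂ) / 2) +
    ∑ k ∈ Finset.Icc 1 ((m - 1) / 2),
      MvPolynomial.eval a (sqrtCoeff m k) / ((m : ℂ) / 2 - (k : ℂ)) *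
        xpow t ((m : ℂ) / 2 - (k : ℂ))

/-- `r(a) = 1/2 - m/4` for odd `m`, and `r(a) = 1/2 - m/4 - b_0(a)` for even `m`. -/
def r (m : ℕ) : MvPolynomial (Fin m) ℂ :=
  MvPolynomial.C (1 / 2 - (m : ℂ) / 4) - if Even m then sqrtCoeff m (m / 2) else 0

/-- Formal series are series in `x ^ (-1/q)` with `q = 2` for odd `m` and `q = 1` for even `m`. -/
def q (m : ℕ) : ℕ := if Even m then 1 else 2

/-- `f(x, a)` has the asymptotic expansion `x ^ (ρ a) e ^ (-S(x, a)) ∑ u_n(a) x ^ (-n/q)` at infinity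
in every strict sub-sector `α ≤ arg x ≤ β`, `-3π/m < α`, `β < 3π/m`, uniformly for `a` in compact
subsets of `ℂ ^ m`.  The formal series `∑ u_n(a) x ^ (-n/q)` is the power series `u` in the
variable `x ^ (-1/q)`. -/
def HasExpansion (m : ℕ) (f : ℂ → (Fin m → ℂ) → ℂ) (ρ : MvPolynomial (Fin m) ℂ)
    (u : PowerSeries (MvPolynomial (Fin m) ℂ)) : Prop :=
  ∀ K : Set (Fin m → ℂ), IsCompact K →
  ∀ α β : ℝ, -(3 * Real.pi / m) < α → β < 3 * Real.pi / m →
  ∀ N : ℕ, ∃ C R : ℝ, ∀ a ∈ K, ∀ t : ℂ, α ≤ t.im → t.im ≤ β → R ≤ ‖Complex.exp t‖ →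
    ‖f t a / (xpow t (MvPolynomial.eval a ρ) * Complex.exp (-S m t a)) -
      ∑ n ∈ Finset.range N, MvPolynomial.eval a (PowerSeries.coeff n u) *
        xpow t (-((n : ℂ) / (q m : ℂ)))‖
      ≤ C * ‖Complex.exp t‖ ^ (-((N : ℝ) / (q m : ℝ)))

/-- The formal derivative `d/dx`: for `φ = ∑ φ_n x ^ (-n/q)`, the series `formalDeriv m φ` is the `ψ`
with `d/dx (x ^ r e ^ (-S) φ) = x ^ (r + m/2 - 1) e ^ (-S) ψ`, namely
`ψ = x ^ (-(m/2-1)) (-S' φ + r x⁻¹ φ + φ')` where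
`x ^ (-(m/2-1)) S' = 1 + ∑_{1 ≤ k < m/2} b_{m/2-k} x ^ (-k)` and
`r x⁻¹ φ + φ' = x⁻¹ ∑ (r - n/q) φ_n x ^ (-n/q)`.
The variable of the power series is `x ^ (-1/q)`; see `dx_term` for the derivative of each term. -/
def formalDeriv (m : ℕ) (φ : PowerSeries (MvPolynomial (Fin m) ℂ)) :
    PowerSeries (MvPolynomial (Fin m) ℂ) :=
  -((1 + ∑ k ∈ Finset.Icc 1 ((m - 1) / 2),
      PowerSeries.C (sqrtCoeff m k) * PowerSeries.X ^ (q m * k)) * φ) +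
    PowerSeries.X ^ (q m * m / 2) *
      PowerSeries.mk fun n =>
        (r m - MvPolynomial.C ((n : ℂ) / (q m : ℂ))) * PowerSeries.coeff n φ

theorem formalDeriv_monomial (m n : ℕ) (p : MvPolynomial (Fin m) ℂ) :
    formalDeriv m (PowerSeries.monomial n p) =
      -(PowerSeries.monomial n p) -
      (∑ k ∈ Finset.Icc 1 ((m - 1) / 2),
        PowerSeries.monomial (q m * k + n) (sqrtCoeff m k * p)) +
      PowerSeries.monomial (q m * m / 2 + n)
        ((r m - MvPolynomial.C ((n : ℂ) / (q m : ℂ))) * p) := by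
  have h : (PowerSeries.mk fun j =>
        (r m - MvPolynomial.C ((j : ℂ) / (q m : ℂ))) *
          PowerSeries.coeff j (PowerSeries.monomial n p)) =
      PowerSeries.monomial n ((r m - MvPolynomial.C ((n : ℂ) / (q m : ℂ))) * p) := by
    ext1 j
    simp only [PowerSeries.coeff_mk, PowerSeries.coeff_monomial]
    split_ifs with hj
    · rw [hj]
    · simp
  have hC : ∀ (c w : MvPolynomial (Fin m) ℂ) (e : ℕ),
      PowerSeries.C c * PowerSeries.monomial e w = PowerSeries.monomial e (c * w) := by
    intro c w e
    ext1 j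
    simp only [PowerSeries.coeff_C_mul, PowerSeries.coeff_monomial]
    split_ifs <;> simp
  rw [formalDeriv, h]
  simp only [PowerSeries.X_pow_eq, PowerSeries.monomial_mul_monomial, one_mul, add_mul,
    Finset.sum_mul, mul_assoc, neg_add, ← sub_eq_add_neg, hC]

/-- `formalDeriv` is the derivative `d/dx` on each term `x ^ r e ^ (-S) p(a) x ^ (-n/q)`. -/
theorem dx_term (m : ℕ) (hm : 1 ≤ m) (n : ℕ) (p : MvPolynomial (Fin m) ℂ) (a : Fin m → ℂ)
    (t : ℂ) (M : ℕ) (hM : q m * m + n < M) :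
    dx (fun s => xpow s (MvPolynomial.eval a (r m)) * Complex.exp (-S m s a) *
        (MvPolynomial.eval a p * xpow s (-((n : ℂ) / (q m : ℂ))))) t =
      xpow t (MvPolynomial.eval a (r m) + (m : ℂ) / 2 - 1) * Complex.exp (-S m t a) *
        ∑ j ∈ Finset.range M,
          MvPolynomial.eval a (PowerSeries.coeff j (formalDeriv m (PowerSeries.monomial n p))) *
            xpow t (-((j : ℂ) / (q m : ℂ))) := by
  have hm0 : (m : ℂ) ≠ 0 := by exact_mod_cast (by omega : m ≠ 0)
  have hq : 1 ≤ q m := by unfold q; split_ifs <;> omega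
  have hq0 : (q m : ℂ) ≠ 0 := by exact_mod_cast (by omega : q m ≠ 0)
  have hk0 : ∀ k ∈ Finset.Icc 1 ((m - 1) / 2), (m : ℂ) / 2 - k ≠ 0 := by
    intro k hk h
    rw [Finset.mem_Icc] at hk
    have : (m : ℂ) = ((2 * k : ℕ) : ℂ) := by push_cast; linear_combination 2 * h
    have := Nat.cast_injective this
    omega
  have hev : (((q m * m / 2 : ℕ) : ℂ)) / (q m : ℂ) = (m : ℂ) / 2 := by
    have h2 : 2 ∣ q m * m := by
      unfold q
      split_ifs with h
      · simpa using h.two_dvd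
      · exact dvd_mul_right 2 m
    rw [Nat.cast_div h2 (by norm_num)]
    push_cast
    field_simp
  have hx : ∀ α : ℂ, HasDerivAt (fun s => xpow s α) (α * xpow t α) t := by
    intro α
    have := ((hasDerivAt_id t).const_mul α).cexp
    simpa [xpow, mul_comm] using this
  have hS : HasDerivAt (fun s => S m s a) (xpow t ((m : ℂ) / 2) +
      ∑ k ∈ Finset.Icc 1 ((m - 1) / 2),
        MvPolynomial.eval a (sqrtCoeff m k) * xpow t ((m : ℂ) / 2 - (k : ℂ))) t := by
    have h1 := (hx ((m : ℂ) / 2)).const_mul (2 / (m : ℂ))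
    have h2 := HasDerivAt.fun_sum (u := Finset.Icc 1 ((m - 1) / 2)) fun k _ =>
      (hx ((m : ℂ) / 2 - (k : ℂ))).const_mul
        (MvPolynomial.eval a (sqrtCoeff m k) / ((m : ℂ) / 2 - (k : ℂ)))
    refine (h1.add h2).congr_deriv ?_
    congr 1
    · field_simp
    · refine Finset.sum_congr rfl fun k hk => ?_
      have := hk0 k hk
      rw [← mul_assoc, div_mul_cancel₀ _ this]
  have hall := ((hx (MvPolynomial.eval a (r m))).mul hS.neg.cexp).mul
    ((hx (-((n : ℂ) / (q m : ℂ)))).const_mul (MvPolynomial.eval a p))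
  have hsum : ∀ (e : ℕ) (c : MvPolynomial (Fin m) ℂ), e < M →
      ∑ j ∈ Finset.range M, MvPolynomial.eval a (PowerSeries.coeff j (PowerSeries.monomial e c)) *
        xpow t (-((j : ℂ) / (q m : ℂ))) =
      MvPolynomial.eval a c * xpow t (-((e : ℂ) / (q m : ℂ))) := by
    intro e c he
    rw [Finset.sum_eq_single e]
    · simp
    · intro j _ hj
      simp [PowerSeries.coeff_monomial, hj]
    · intro h
      exact absurd (Finset.mem_range.2 he) h
  have hsumk : ∑ j ∈ Finset.range M, MvPolynomial.eval a (PowerSeries.coeff j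
        (∑ k ∈ Finset.Icc 1 ((m - 1) / 2),
          PowerSeries.monomial (q m * k + n) (sqrtCoeff m k * p))) *
        xpow t (-((j : ℂ) / (q m : ℂ))) =
      ∑ k ∈ Finset.Icc 1 ((m - 1) / 2), MvPolynomial.eval a (sqrtCoeff m k * p) *
        xpow t (-(((q m * k + n : ℕ) : ℂ) / (q m : ℂ))) := by
    simp only [map_sum, Finset.sum_mul]
    rw [Finset.sum_comm]
    refine Finset.sum_congr rfl fun k hk => hsum _ _ ?_
    rw [Finset.mem_Icc] at hk
    have : q m * k ≤ q m * m := Nat.mul_le_mul_left _ (by omega)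
    omega
  have hadd : ∀ α β : ℂ, xpow t (α + β) = xpow t α * xpow t β := by
    intro α β
    simp [xpow, add_mul, Complex.exp_add]
  rw [formalDeriv_monomial]
  simp only [map_add, map_sub, map_neg, add_mul, sub_mul, neg_mul, Finset.sum_add_distrib,
    Finset.sum_sub_distrib, Finset.sum_neg_distrib]
  rw [hsum n p (by omega), hsumk, hsum (q m * m / 2 + n) _ (by omega), hsum (q m * m / 2 + n) _ (by omega)]
  have e1 : ∀ k : ℕ, xpow t (-(((q m * k + n : ℕ) : ℂ) / (q m : ℂ))) =
      xpow t (-(k : ℂ)) * xpow t (-((n : ℂ) / (q m : ℂ))) := by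
    intro k
    rw [← hadd]
    congr 1
    push_cast
    field_simp
    ring
  have e2 : xpow t (-(((q m * m / 2 + n : ℕ) : ℂ) / (q m : ℂ))) =
      xpow t (-((m : ℂ) / 2)) * xpow t (-((n : ℂ) / (q m : ℂ))) := by
    rw [← hadd, Nat.cast_add, add_div, hev]
    congr 1
    ring
  have e3 : xpow t ((m : ℂ) / 2) * xpow t (-((m : ℂ) / 2)) = 1 := by
    rw [← hadd]
    simp [xpow]
  have e4 : ∀ k : ℕ, xpow t ((m : ℂ) / 2 - k) = xpow t ((m : ℂ) / 2) * xpow t (-(k : ℂ)) := by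
    intro k
    rw [← hadd, sub_eq_add_neg]
  have e5 : xpow t (MvPolynomial.eval a (r m) + (m : ℂ) / 2 - 1) =
      xpow t (MvPolynomial.eval a (r m)) * xpow t ((m : ℂ) / 2) * Complex.exp (-t) := by
    rw [sub_eq_add_neg, hadd, hadd]
    simp [xpow]
  have hd := hall.deriv
  rw [dx]
  erw [hd]
  simp only [e1, e2, e4, e5, Pi.mul_apply, map_mul, MvPolynomial.eval_C, Pi.neg_apply]
  have hpull : ∑ k ∈ Finset.Icc 1 ((m - 1) / 2), MvPolynomial.eval a (sqrtCoeff m k) *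
        (xpow t ((m : ℂ) / 2) * xpow t (-(k : ℂ))) =
      xpow t ((m : ℂ) / 2) * ∑ k ∈ Finset.Icc 1 ((m - 1) / 2),
        MvPolynomial.eval a (sqrtCoeff m k) * xpow t (-(k : ℂ)) := by
    rw [Finset.mul_sum]
    exact Finset.sum_congr rfl fun k _ => by ring
  have hpull2 : ∑ k ∈ Finset.Icc 1 ((m - 1) / 2), MvPolynomial.eval a (sqrtCoeff m k) *
        MvPolynomial.eval a p * (xpow t (-(k : ℂ)) * xpow t (-((n : ℂ) / (q m : ℂ)))) =
      (∑ k ∈ Finset.Icc 1 ((m - 1) / 2),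
        MvPolynomial.eval a (sqrtCoeff m k) * xpow t (-(k : ℂ))) *
          (MvPolynomial.eval a p * xpow t (-((n : ℂ) / (q m : ℂ)))) := by
    rw [Finset.sum_mul]
    exact Finset.sum_congr rfl fun k _ => by ring
  rw [hpull, hpull2]
  linear_combination (-(Complex.exp (-t) * xpow t (MvPolynomial.eval a (r m)) *
    Complex.exp (-S m t a) * (MvPolynomial.eval a (r m) - (n : ℂ) / (q m : ℂ)) *
    MvPolynomial.eval a p * xpow t (-((n : ℂ) / (q m : ℂ))))) * e3

/-- `Φ` solves the equation on the sector `|arg x| < 3π/m`, is analytic in `x` there, and has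
there the asymptotic expansion `x ^ r(a) e ^ (-S(x, a)) φ(x, a)`, where the constant term
of `φ` is `1`. -/
structure IsNormalizedSolution (m : ℕ) (Φ : ℂ → (Fin m → ℂ) → ℂ)
    (φ : PowerSeries (MvPolynomial (Fin m) ℂ)) : Prop where
  analytic : ∀ a, AnalyticOnNhd ℂ (fun t => Φ t a) (sector m)
  solves : ∀ a, SolvesOn m a (fun t => Φ t a) (sector m)
  constantCoeff : PowerSeries.constantCoeff φ = 1
  expansion : HasExpansion m Φ (r m) φ

end

end IrregularSchrodinger

namespace IrregularSchrodinger

noncomputable section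

/-! Put t = ln x, ξ = x^(-1/q), ζ = x^(m/2), and write a solution as f = x^r e^(-S) u. With
derivatives in t, the equation becomes u'' = `damping` · u' - `stiffness` · u. Here `damping` is 2ζ
to leading order, while `stiffness` is only O(ζξ): S removes all orders of P above x^(m/2), and the
value of r is exactly the one that removes the order x^(m/2) (`X_pow_dvd_potential`). All
coefficients are ζ times polynomials in ξ over ℂ[a], so the formal solution is found by a recursion
in ℂ[a][ξ]. Its truncation U after ξ^N solves the reduced equation up to ζ · O(ξ^(N+1)), uniformly
for a in compact sets.

The analysis rests on one weighted `energy` of the error, |u - U|^2 + |ξ|^(h-1) |u' - U'|^2 with h =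
`halfDeg m`. Along a direction in which Re ζ is positive and comparable to |ζ| after rotation, the
damping is strong and positive, so when moving outwards the energy V satisfies V' ≥ -A |ξ| V - A η^2
|ξ|^(2N-1) (`exists_energy_hasDerivAt`). Integrated backwards by `backward_gronwall`, smallness of
the error far out gives smallness nearer in. On the positive axis the loss is bounded because |ξ| is
integrable in t (`energy_along_ray`); on segments of bounded length it is bounded trivially
(`energy_along_segment`).

Existence: take the solutions with u = 1, u' = 0 at t = n. Their coefficients in the basis of
solutions fixed by initial values at t = 0 form a Cauchy sequence, locally uniformly in a, so the
limits are entire in a (`exists_recessive`). The basis is itself entire in (t, a), which gives the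
global holomorphy at once. Comparison with U on the axis, from infinity, gives the expansion there.

Sector: two successive segments carry the estimate from the axis to |arg ζ| < 3π/2, that is |arg x|
< 3π/m (`exists_path_to_axis`, `exists_path_to_right_half`). Since the energy also controls u', the
differentiated expansion comes with the same estimate.

Uniqueness: the difference of two reduced solutions tends to 0 in a strip about the axis, and so
does its derivative by Cauchy's estimate. The ray estimate with zero residual then forces it to
vanish on a half-line, hence on the sector by the identity theorem. -/

/-! ### Polynomials in x^(-1/q) and their derivation -/

/-- The coefficient ring `ℂ[a]`. -/
abbrev Coeff (m : ℕ) : Type := MvPolynomial (Fin m) ℂ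

/-- The exponent of `x ^ (m / 2)` in powers of `x ^ (1 / q)`. -/
def halfDeg (m : ℕ) : ℕ := q m * m / 2

theorem q_pos (m : ℕ) : 0 < q m := by unfold q; split_ifs <;> omega

theorem q_ne_zero (m : ℕ) : (q m : ℂ) ≠ 0 := by exact_mod_cast (q_pos m).ne'

/-- The choice of q makes qm even in both parities, so the natural-number division in `halfDeg` is
exact. -/
theorem two_mul_halfDeg (m : ℕ) : 2 * halfDeg m = q m * m := by
  unfold halfDeg q
  split_ifs with h
  · obtain ⟨l, rfl⟩ := h
    omega
  · omega

theorem halfDeg_pos {m : ℕ} (hm : 1 ≤ m) : 0 < halfDeg m := by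
  have := two_mul_halfDeg m
  have := Nat.mul_pos (q_pos m) hm
  omega

theorem halfDeg_div (m : ℕ) : (halfDeg m : ℂ) / q m = (m : ℂ) / 2 := by
  have h : (2 * halfDeg m : ℂ) = q m * m := by exact_mod_cast two_mul_halfDeg m
  have := q_ne_zero m
  field_simp
  linear_combination h

/-- The variable `x ^ (-1/q)`. -/
def xi (m : ℕ) (t : ℂ) : ℂ := Complex.exp (-(t / q m))

/-- The function `x ^ (m/2)`. -/
def zeta (m : ℕ) (t : ℂ) : ℂ := Complex.exp ((m : ℂ) / 2 * t)

theorem xi_pow (m : ℕ) (t : ℂ) (n : ℕ) : xi m t ^ n = xpow t (-((n : ℂ) / q m)) := by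
  rw [xi, xpow, ← Complex.exp_nat_mul]
  congr 1
  ring

/-- This relation between ζ and ξ is what the later identities between functions of t are reduced to
by `linear_combination`. -/
theorem zeta_mul_xi_pow (m : ℕ) (t : ℂ) : zeta m t * xi m t ^ halfDeg m = 1 := by
  rw [xi_pow, halfDeg_div, zeta, xpow, ← Complex.exp_add]
  simp

/-- Evaluation of a polynomial in `x ^ (-1/q)` with coefficients in `ℂ[a]`. -/
def ev (m : ℕ) (a : Fin m → ℂ) (t : ℂ) : Polynomial (Coeff m) →+* ℂ :=
  Polynomial.eval₂RingHom (MvPolynomial.eval a) (xi m t)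

@[simp] theorem ev_C (m : ℕ) (a : Fin m → ℂ) (t : ℂ) (c : Coeff m) :
    ev m a t (Polynomial.C c) = MvPolynomial.eval a c := by simp [ev]

@[simp] theorem ev_X (m : ℕ) (a : Fin m → ℂ) (t : ℂ) :
    ev m a t Polynomial.X = xi m t := by simp [ev]

/-- The derivation `x d/dx` on polynomials in `x ^ (-1/q)`. -/
def eulerD (m : ℕ) (p : Polynomial (Coeff m)) : Polynomial (Coeff m) :=
  Polynomial.C (MvPolynomial.C (-(1 / (q m : ℂ)))) * Polynomial.X * Polynomial.derivative p

theorem eulerD_add (m : ℕ) (p p' : Polynomial (Coeff m)) :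
    eulerD m (p + p') = eulerD m p + eulerD m p' := by
  simp [eulerD, mul_add]

theorem coeff_eulerD (m : ℕ) (p : Polynomial (Coeff m)) (n : ℕ) :
    (eulerD m p).coeff n = MvPolynomial.C (-((n : ℂ) / q m)) * p.coeff n := by
  rw [eulerD, mul_assoc, Polynomial.coeff_C_mul]
  cases n with
  | zero => simp
  | succ n =>
    rw [Polynomial.coeff_X_mul, Polynomial.coeff_derivative]
    have : ((n : Coeff m) + 1) = MvPolynomial.C ((n : ℂ) + 1) := by simp
    rw [this, mul_comm (p.coeff (n + 1)), ← mul_assoc, ← map_mul]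
    congr 2
    push_cast
    ring

theorem eulerD_C_mul_X_pow (m : ℕ) (c : Coeff m) (n : ℕ) :
    eulerD m (Polynomial.C c * Polynomial.X ^ n) =
      Polynomial.C (MvPolynomial.C (-((n : ℂ) / q m)) * c) * Polynomial.X ^ n := by
  ext1 k
  rw [coeff_eulerD, Polynomial.coeff_C_mul_X_pow, Polynomial.coeff_C_mul_X_pow]
  split_ifs with h
  · rw [h]
  · simp

theorem hasDerivAt_xi (m : ℕ) (t : ℂ) : HasDerivAt (xi m) (-(1 / (q m : ℂ)) * xi m t) t := by
  have := (((hasDerivAt_id t).div_const (q m : ℂ)).neg).cexp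
  refine this.congr_deriv ?_
  simp [xi]
  ring

theorem hasDerivAt_ev (m : ℕ) (a : Fin m → ℂ) (t : ℂ) (p : Polynomial (Coeff m)) :
    HasDerivAt (fun s => ev m a s p) (ev m a t (eulerD m p)) t := by
  have h := ((p.map (MvPolynomial.eval a)).hasDerivAt (xi m t)).comp t (hasDerivAt_xi m t)
  have e : (fun s => ev m a s p) = (fun x => (p.map (MvPolynomial.eval a)).eval x) ∘ xi m := by
    ext s
    simp [ev, Polynomial.eval_map]
  rw [e]
  refine h.congr_deriv ?_
  have e2 : ev m a t (Polynomial.derivative p) =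
      (Polynomial.derivative (p.map (MvPolynomial.eval a))).eval (xi m t) := by
    rw [Polynomial.derivative_map, Polynomial.eval_map]
    rfl
  rw [eulerD, map_mul, map_mul, ev_C, ev_X, MvPolynomial.eval_C, e2]
  ring

/-! ### S and P in terms of ζ and ξ -/

/-- The function `x ^ (-m/2) x dS/dx`, as a polynomial in `x ^ (-1/q)`. -/
def sigma (m : ℕ) : Polynomial (Coeff m) :=
  1 + ∑ k ∈ Finset.Icc 1 ((m - 1) / 2),
    Polynomial.C (sqrtCoeff m k) * Polynomial.X ^ (q m * k)

/-- The function `x ^ (-m) P_m(x, a)`, as a polynomial in `x ^ (-1/q)`. -/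
def revP (m : ℕ) : Polynomial (Coeff m) :=
  ∑ k ∈ Finset.range (m + 1), Polynomial.C (revCoeff m k) * Polynomial.X ^ (q m * k)

theorem zeta_mul_xi_pow_q (m : ℕ) (t : ℂ) (k : ℕ) :
    zeta m t * xi m t ^ (q m * k) = xpow t ((m : ℂ) / 2 - k) := by
  rw [xi_pow, zeta, xpow, xpow, ← Complex.exp_add]
  congr 1
  have := q_ne_zero m
  push_cast
  field_simp
  ring

theorem hasDerivAt_S {m : ℕ} (hm : 1 ≤ m) (a : Fin m → ℂ) (t : ℂ) :
    HasDerivAt (fun s => S m s a) (zeta m t * ev m a t (sigma m)) t := by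
  have hm0 : (m : ℂ) ≠ 0 := by exact_mod_cast (by omega : m ≠ 0)
  have hx : ∀ α : ℂ, HasDerivAt (fun s => xpow s α) (α * xpow t α) t := by
    intro α
    have := ((hasDerivAt_id t).const_mul α).cexp
    simpa [xpow, mul_comm] using this
  have hk0 : ∀ k ∈ Finset.Icc 1 ((m - 1) / 2), (m : ℂ) / 2 - k ≠ 0 := by
    intro k hk h
    rw [Finset.mem_Icc] at hk
    have : (m : ℂ) = ((2 * k : ℕ) : ℂ) := by push_cast; linear_combination 2 * h
    have := Nat.cast_injective this
    omega
  have h1 := (hx ((m : ℂ) / 2)).const_mul (2 / (m : ℂ))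
  have h2 := HasDerivAt.fun_sum (u := Finset.Icc 1 ((m - 1) / 2)) fun k _ =>
    (hx ((m : ℂ) / 2 - (k : ℂ))).const_mul
      (MvPolynomial.eval a (sqrtCoeff m k) / ((m : ℂ) / 2 - (k : ℂ)))
  refine (h1.add h2).congr_deriv ?_
  rw [sigma, map_add, map_one, map_sum, mul_add, mul_one, Finset.mul_sum]
  congr 1
  · rw [zeta, xpow]
    field_simp
  · refine Finset.sum_congr rfl fun k hk => ?_
    rw [map_mul, ev_C, map_pow, ev_X, mul_left_comm (zeta m t), zeta_mul_xi_pow_q, ← mul_assoc,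
      div_mul_cancel₀ _ (hk0 k hk)]

theorem P_eq (m : ℕ) (a : Fin m → ℂ) (t : ℂ) :
    P m (Complex.exp t) a = zeta m t ^ 2 * ev m a t (revP m) := by
  have key : ∀ k ≤ m, zeta m t ^ 2 * xi m t ^ (q m * k) = Complex.exp t ^ (m - k) := by
    intro k hk
    rw [xi_pow, zeta, xpow, ← Complex.exp_nat_mul, ← Complex.exp_nat_mul, ← Complex.exp_add]
    congr 1
    have := q_ne_zero m
    push_cast [hk]
    field_simp
    ring
  rw [P, revP, map_sum, Finset.sum_range_succ', Finset.sum_range, mul_add, Finset.mul_sum, add_comm]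
  congr 1
  · refine Finset.sum_congr rfl fun i _ => ?_
    rw [map_mul, ev_C, map_pow, ev_X, mul_left_comm, key _ (by omega)]
    simp [revCoeff]
  · rw [map_mul, ev_C, map_pow, ev_X, mul_left_comm, key 0 (by omega)]
    simp [revCoeff]

theorem hasDerivAt_zeta (m : ℕ) (t : ℂ) :
    HasDerivAt (zeta m) ((m : ℂ) / 2 * zeta m t) t := by
  have := ((hasDerivAt_id t).const_mul ((m : ℂ) / 2)).cexp
  refine this.congr_deriv ?_
  simp [zeta, mul_comm]

/-! ### Cancellation of the leading orders of the potential -/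

/-- The coefficient of `u` in the equation for `u = x ^ (-r) e ^ S f`, divided by `x ^ m`. -/
def potential (m : ℕ) : Polynomial (Coeff m) :=
  sigma m ^ 2 - revP m +
    Polynomial.X ^ halfDeg m *
      (sigma m * Polynomial.C (MvPolynomial.C (1 - (m : ℂ) / 2) - 2 * r m) - eulerD m (sigma m)) +
    Polynomial.X ^ (2 * halfDeg m) * Polynomial.C (r m ^ 2 - r m)

/-- The square root, truncated at the terms occurring in `S`, as a polynomial in `1/x`. -/
def sqrtTrunc (m : ℕ) : Polynomial (Coeff m) :=
  ∑ k ∈ Finset.range ((m - 1) / 2 + 1), Polynomial.monomial k (sqrtCoeff m k)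

theorem sigma_eq_expand (m : ℕ) : sigma m = Polynomial.expand _ (q m) (sqrtTrunc m) := by
  rw [sigma, sqrtTrunc, Finset.sum_range_succ', map_add, map_sum, add_comm]
  congr 1
  · have : Finset.Icc 1 ((m - 1) / 2) = Finset.Ico (0 + 1) ((m - 1) / 2 + 1) := by
      ext; simp
    rw [this, ← Finset.sum_Ico_add', Nat.Ico_zero_eq_range]
    refine Finset.sum_congr rfl fun k _ => ?_
    rw [Polynomial.expand_monomial, Polynomial.C_mul_X_pow_eq_monomial, mul_comm]
  · simp [sqrtCoeff]

theorem revP_eq_expand (m : ℕ) : revP m = Polynomial.expand _ (q m)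
    (∑ k ∈ Finset.range (m + 1), Polynomial.monomial k (revCoeff m k)) := by
  rw [revP, map_sum]
  refine Finset.sum_congr rfl fun k _ => ?_
  rw [Polynomial.expand_monomial, Polynomial.C_mul_X_pow_eq_monomial, mul_comm]

theorem coeff_sqrtTrunc (m k : ℕ) :
    (sqrtTrunc m).coeff k = if k ≤ (m - 1) / 2 then sqrtCoeff m k else 0 := by
  rw [sqrtTrunc, Polynomial.finsetSum_coeff]
  simp [Polynomial.coeff_monomial]

/-- For 2k < m no factor of the Cauchy product is truncated. At 2k = m only the two end products, of
the missing coefficient with the constant term 1, are lost. -/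
theorem coeff_sqrtTrunc_sq {m k : ℕ} (hm : 1 ≤ m) (hk : 2 * k ≤ m) :
    (sqrtTrunc m ^ 2).coeff k =
      revCoeff m k - if 2 * k = m then 2 * sqrtCoeff m k else 0 := by
  have hs := congrArg (PowerSeries.coeff k) (sqrtCoeff_spec m)
  rw [sq, PowerSeries.coeff_mul, PowerSeries.coeff_mk,
    Finset.Nat.sum_antidiagonal_eq_sum_range_succ_mk] at hs
  simp only [PowerSeries.coeff_mk] at hs
  rw [sq, Polynomial.coeff_mul, ← hs, Finset.Nat.sum_antidiagonal_eq_sum_range_succ_mk]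
  simp only [coeff_sqrtTrunc]
  split_ifs with h
  · obtain ⟨l, rfl⟩ : ∃ l, k = l + 1 := ⟨k - 1, by omega⟩
    rw [Finset.sum_range_succ', Finset.sum_range_succ, Finset.sum_range_succ',
      Finset.sum_range_succ]
    have hin : ∀ i ∈ Finset.range l,
        ((if i + 1 ≤ (m - 1) / 2 then sqrtCoeff m (i + 1) else 0) *
          (if l + 1 - (i + 1) ≤ (m - 1) / 2 then sqrtCoeff m (l + 1 - (i + 1)) else 0)) =
        sqrtCoeff m (i + 1) * sqrtCoeff m (l + 1 - (i + 1)) := by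
      intro i hi
      rw [Finset.mem_range] at hi
      rw [if_pos (by omega), if_pos (by omega)]
    rw [Finset.sum_congr rfl hin]
    have hl : ¬ (l + 1 ≤ (m - 1) / 2) := by omega
    have h0 : sqrtCoeff m 0 = 1 := by rw [sqrtCoeff]
    simp only [Nat.sub_self, Nat.sub_zero, h0, if_neg hl]
    ring
  · rw [sub_zero]
    refine Finset.sum_congr rfl fun i hi => ?_
    rw [Finset.mem_range] at hi
    rw [if_pos (by omega), if_pos (by omega)]

/-- Both polynomials are polynomials in 1/x expanded by X ↦ X^q. For odd m the exponent `halfDeg m`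
= m is not divisible by q = 2, so nothing survives there; for even m the lost products give the term
in b_0. -/
theorem coeff_sigma_sq_sub_revP {m j : ℕ} (hm : 1 ≤ m) (hj : j ≤ halfDeg m) :
    (sigma m ^ 2 - revP m).coeff j =
      if j = halfDeg m ∧ Even m then -(2 * sqrtCoeff m (m / 2)) else 0 := by
  have hh := two_mul_halfDeg m
  rw [sigma_eq_expand, revP_eq_expand, ← map_pow, ← map_sub, Polynomial.coeff_expand (q_pos m)]
  by_cases hd : q m ∣ j
  · obtain ⟨k, rfl⟩ := hd
    have hk : 2 * k ≤ m := by
      have : q m * (2 * k) ≤ q m * m := by rw [← hh]; linarith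
      exact Nat.le_of_mul_le_mul_left this (q_pos m)
    rw [if_pos (dvd_mul_right _ _), Nat.mul_div_cancel_left _ (q_pos m), Polynomial.coeff_sub,
      coeff_sqrtTrunc_sq hm hk]
    have h1 : (∑ k ∈ Finset.range (m + 1), Polynomial.monomial k (revCoeff m k)).coeff k =
        revCoeff m k := by
      rw [Polynomial.finsetSum_coeff]
      simp [Polynomial.coeff_monomial]
      omega
    rw [h1]
    by_cases h2 : 2 * k = m
    · have : q m * k = halfDeg m := by
        have : q m * (2 * k) = q m * m := by rw [h2]
        linarith
      rw [if_pos h2, if_pos ⟨this, ⟨k, by omega⟩⟩, show m / 2 = k by omega]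
      ring
    · have : ¬ (q m * k = halfDeg m ∧ Even m) := by
        rintro ⟨h3, -⟩
        apply h2
        have : q m * (2 * k) = q m * m := by rw [← hh, ← h3]; ring
        exact Nat.eq_of_mul_eq_mul_left (q_pos m) this
      rw [if_neg h2, if_neg this]
      ring
  · rw [if_neg hd, if_neg]
    rintro ⟨rfl, h⟩
    apply hd
    have : q m = 1 := by simp [q, h]
    simp [this]

theorem sigma_coeff_zero (m : ℕ) : (sigma m).coeff 0 = 1 := by
  rw [sigma_eq_expand, Polynomial.coeff_expand (q_pos m)]
  simp [coeff_sqrtTrunc, sqrtCoeff]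

/-- This is where r is determined. At order `halfDeg m` the coefficient is 1 - m/2 - 2r, minus 2b_0
when m is even; the `eulerD` term has no constant coefficient, and the term with r^2 - r begins at
twice that order. -/
theorem X_pow_dvd_potential {m : ℕ} (hm : 1 ≤ m) :
    Polynomial.X ^ (halfDeg m + 1) ∣ potential m := by
  have hp := halfDeg_pos hm
  rw [Polynomial.X_pow_dvd_iff]
  intro d hd
  rw [potential, Polynomial.coeff_add, Polynomial.coeff_add,
    coeff_sigma_sq_sub_revP hm (by omega), Polynomial.coeff_X_pow_mul', Polynomial.coeff_X_pow_mul',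
    if_neg (show ¬ 2 * halfDeg m ≤ d by omega)]
  by_cases h : d = halfDeg m
  · subst h
    rw [if_pos le_rfl, Nat.sub_self, Polynomial.coeff_sub, Polynomial.mul_coeff_zero,
      sigma_coeff_zero, coeff_eulerD, Polynomial.coeff_C_zero, r]
    have e : (MvPolynomial.C (1 - (m : ℂ) / 2) : Coeff m) =
        2 * MvPolynomial.C (1 / 2 - (m : ℂ) / 4) := by
      rw [show (2 : Coeff m) = MvPolynomial.C 2 from (map_ofNat _ 2).symm, ← map_mul]
      congr 1
      ring
    rw [e]
    by_cases h : Even m <;> simp [h]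
    ring
  · rw [if_neg (by tauto), if_neg (by omega)]
    simp

/-- The potential divided by `x ^ (-m/2 - 1/q)`. -/
def reducedPotential (m : ℕ) : Polynomial (Coeff m) :=
  potential m /ₘ Polynomial.X ^ (halfDeg m + 1)

theorem potential_eq {m : ℕ} (hm : 1 ≤ m) :
    potential m = Polynomial.X ^ (halfDeg m + 1) * reducedPotential m := by
  have h := Polynomial.modByMonic_add_div (potential m) (Polynomial.X ^ (halfDeg m + 1))
  rw [(Polynomial.modByMonic_eq_zero_iff_dvd (Polynomial.monic_X_pow _)).2
    (X_pow_dvd_potential hm), zero_add] at h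
  exact h.symm

/-- One factor ζ is spent on ξ^`halfDeg m`; the spare factor ξ is the gain over the damping that
makes the energy estimate integrable. -/
theorem ev_potential {m : ℕ} (hm : 1 ≤ m) (a : Fin m → ℂ) (t : ℂ) :
    zeta m t ^ 2 * ev m a t (potential m) =
      zeta m t * ev m a t (Polynomial.X * reducedPotential m) := by
  have h := zeta_mul_xi_pow m t
  rw [potential_eq hm]
  simp only [map_mul, map_pow, ev_X, pow_succ (xi m t)]
  linear_combination zeta m t * xi m t * ev m a t (reducedPotential m) * h

/-! ### The formal solution -/

/-- The operator which, after division by `x ^ (m/2)`, is the differential equation for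
`x ^ (-r) e ^ S f` on polynomials in `x ^ (-1/q)`. -/
def residual (m : ℕ) (U : Polynomial (Coeff m)) : Polynomial (Coeff m) :=
  Polynomial.X ^ halfDeg m *
      (eulerD m (eulerD m U) + Polynomial.C (2 * r m - 1) * eulerD m U) -
    2 * sigma m * eulerD m U + Polynomial.X * reducedPotential m * U

theorem residual_add (m : ℕ) (U V : Polynomial (Coeff m)) :
    residual m (U + V) = residual m U + residual m V := by
  simp only [residual, eulerD_add]
  ring

theorem X_dvd_sigma_sub_one (m : ℕ) : Polynomial.X ∣ sigma m - 1 := by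
  rw [Polynomial.X_dvd_iff, Polynomial.coeff_sub, sigma_coeff_zero]
  simp

/-- Only the product of the constant term of `sigma` with -2 `eulerD` keeps the order n; every other
term raises it. The resulting factor 2n/q is invertible for n ≥ 1, which makes the recursion
solvable over ℂ[a]. -/
theorem residual_C_mul_X_pow {m : ℕ} (hm : 1 ≤ m) (c : Coeff m) (n : ℕ) :
    Polynomial.X ^ (n + 1) ∣ residual m (Polynomial.C c * Polynomial.X ^ n) -
      Polynomial.C (MvPolynomial.C (2 * (n : ℂ) / q m) * c) * Polynomial.X ^ n := by
  obtain ⟨w, hw⟩ := X_dvd_sigma_sub_one m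
  obtain ⟨l, hl⟩ : ∃ l, halfDeg m = l + 1 := ⟨halfDeg m - 1, by have := halfDeg_pos hm; omega⟩
  have hs : sigma m = 1 + Polynomial.X * w := by rw [← hw]; ring
  simp only [residual, eulerD_C_mul_X_pow, hs, hl]
  have e : MvPolynomial.C (2 * (n : ℂ) / q m) * c =
      -(2 * (MvPolynomial.C (-((n : ℂ) / q m)) * c)) := by
    rw [show (2 : Coeff m) = MvPolynomial.C 2 from (map_ofNat _ 2).symm, ← mul_assoc, ← map_mul,
      ← neg_mul, ← map_neg]
    congr 2
    ring
  rw [e]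
  generalize MvPolynomial.C (-((n : ℂ) / q m)) * c = d
  generalize MvPolynomial.C (-((n : ℂ) / q m)) * d = d'
  have e2 : (Polynomial.C (-(2 * d)) : Polynomial (Coeff m)) = -(2 * Polynomial.C d) := by
    rw [map_neg, map_mul, map_ofNat]
  rw [e2]
  refine ⟨Polynomial.X ^ l * (Polynomial.C d' + Polynomial.C (2 * r m - 1) * Polynomial.C d) -
    2 * w * Polynomial.C d + reducedPotential m * Polynomial.C c, ?_⟩
  ring

/-- The partial sums of the formal solution of the equation for `x ^ (-r) e ^ S f`. -/
def formalSum (m : ℕ) : ℕ → Polynomial (Coeff m)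
  | 0 => 1
  | n + 1 => formalSum m n + Polynomial.C (MvPolynomial.C (-((q m : ℂ) / (2 * ((n : ℂ) + 1)))) *
      (residual m (formalSum m n)).coeff (n + 1)) * Polynomial.X ^ (n + 1)

theorem eulerD_one (m : ℕ) : eulerD m 1 = 0 := by simp [eulerD]

/-- The constant -q/(2(n+1)) in the recursion is minus the inverse of the factor 2(n+1)/q, so the
new term cancels the lowest remaining coefficient of the residual and disturbs only higher ones. -/
theorem X_pow_dvd_residual_formalSum {m : ℕ} (hm : 1 ≤ m) (n : ℕ) :
    Polynomial.X ^ (n + 1) ∣ residual m (formalSum m n) := by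
  induction n with
  | zero =>
    have h0 : eulerD m (0 : Polynomial (Coeff m)) = 0 := by simp [eulerD]
    simp only [formalSum, residual, eulerD_one, h0]
    exact ⟨reducedPotential m, by ring⟩
  | succ n ih =>
    rw [formalSum, residual_add]
    set c := MvPolynomial.C (-((q m : ℂ) / (2 * ((n : ℂ) + 1)))) *
      (residual m (formalSum m n)).coeff (n + 1) with hc
    obtain ⟨w, hw⟩ := residual_C_mul_X_pow hm c (n + 1)
    have hc2 : MvPolynomial.C (2 * ((n + 1 : ℕ) : ℂ) / q m) * c =
        -(residual m (formalSum m n)).coeff (n + 1) := by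
      rw [hc, ← mul_assoc, ← map_mul]
      have : 2 * ((n + 1 : ℕ) : ℂ) / q m * -((q m : ℂ) / (2 * ((n : ℂ) + 1))) = -1 := by
        have h1 := q_ne_zero m
        have h2 : (n : ℂ) + 1 ≠ 0 := by exact_mod_cast n.succ_ne_zero
        push_cast
        field_simp
      rw [this]
      simp
    rw [sub_eq_iff_eq_add, hc2] at hw
    rw [hw]
    rw [Polynomial.X_pow_dvd_iff] at ih ⊢
    intro d hd
    rw [Polynomial.coeff_add, Polynomial.coeff_add, Polynomial.coeff_X_pow_mul',
      if_neg (by omega), Polynomial.coeff_C_mul_X_pow]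
    by_cases h : d = n + 1
    · simp [h]
    · rw [ih d (by omega), if_neg h]
      simp

/-- The formal solution of the equation for `x ^ (-r) e ^ S f`. -/
def formalSolution (m : ℕ) : PowerSeries (Coeff m) :=
  PowerSeries.mk fun n => (formalSum m n).coeff n

theorem coeff_formalSum (m n k : ℕ) :
    (formalSum m n).coeff k = if k ≤ n then (formalSum m k).coeff k else 0 := by
  induction n with
  | zero =>
    by_cases h : k = 0
    · simp [h]
    · rw [if_neg (by omega)]
      simp [formalSum, Polynomial.coeff_one, h]
  | succ n ih =>
    by_cases h : k = n + 1
    · subst h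
      simp
    · rw [formalSum, Polynomial.coeff_add, Polynomial.coeff_C_mul_X_pow, if_neg h, add_zero, ih]
      simp only [show k ≤ n + 1 ↔ k ≤ n by omega]

theorem coeff_formalSolution {m n k : ℕ} (h : k ≤ n) :
    PowerSeries.coeff k (formalSolution m) = (formalSum m n).coeff k := by
  rw [coeff_formalSum, if_pos h, formalSolution, PowerSeries.coeff_mk]

theorem constantCoeff_formalSolution (m : ℕ) :
    PowerSeries.constantCoeff (formalSolution m) = 1 := by
  rw [← PowerSeries.coeff_zero_eq_constantCoeff_apply, coeff_formalSolution le_rfl]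
  simp [formalSum]

/-- The factor `-S' φ + r x⁻¹ φ + φ'` in the derivative of `x ^ r e ^ (-S) φ`, divided by
`x ^ (m/2 - 1)`. -/
def derivFactor (m : ℕ) (U : Polynomial (Coeff m)) : Polynomial (Coeff m) :=
  -(sigma m * U) + Polynomial.X ^ halfDeg m * (Polynomial.C (r m) * U + eulerD m U)

/-- A coefficient of order k of the formal derivative involves only coefficients of order at most k
of the series, so truncation at n ≥ k is invisible. -/
theorem coeff_derivFactor_formalSum {m n k : ℕ} (h : k ≤ n) :
    (derivFactor m (formalSum m n)).coeff k =
      PowerSeries.coeff k (formalDeriv m (formalSolution m)) := by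
  have hs : ((1 : PowerSeries (Coeff m)) + ∑ k ∈ Finset.Icc 1 ((m - 1) / 2),
      PowerSeries.C (sqrtCoeff m k) * PowerSeries.X ^ (q m * k)) =
      ((sigma m : Polynomial (Coeff m)) : PowerSeries (Coeff m)) := by
    rw [sigma]
    have := map_sum (Polynomial.coeToPowerSeries.ringHom (R := Coeff m))
      (fun k => Polynomial.C (sqrtCoeff m k) * Polynomial.X ^ (q m * k))
      (Finset.Icc 1 ((m - 1) / 2))
    simp only [Polynomial.coeToPowerSeries.ringHom_apply] at this
    rw [Polynomial.coe_add, Polynomial.coe_one, this]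
    simp
  rw [formalDeriv, derivFactor, hs, ← halfDeg, map_add, map_neg, Polynomial.coeff_add,
    Polynomial.coeff_neg, PowerSeries.coeff_X_pow_mul', Polynomial.coeff_X_pow_mul',
    PowerSeries.coeff_mul, Polynomial.coeff_mul]
  refine congrArg₂ (· + ·) (congrArg Neg.neg ?_) ?_
  · refine Finset.sum_congr rfl fun p hp => ?_
    rw [Finset.HasAntidiagonal.mem_antidiagonal] at hp
    rw [Polynomial.coeff_coe, coeff_formalSolution (show p.2 ≤ n by omega)]
  · split_ifs with h2
    · rw [PowerSeries.coeff_mk, coeff_formalSolution (show k - halfDeg m ≤ n by omega),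
        Polynomial.coeff_add, Polynomial.coeff_C_mul, coeff_eulerD, map_neg]
      ring
    · rfl

/-! ### Coefficients of the reduced equation -/

/-- The factor `x ^ r e ^ (-S)`. -/
def leading (m : ℕ) (a : Fin m → ℂ) (t : ℂ) : ℂ :=
  xpow t (MvPolynomial.eval a (r m)) * Complex.exp (-S m t a)

theorem leading_ne_zero (m : ℕ) (a : Fin m → ℂ) (t : ℂ) : leading m a t ≠ 0 :=
  mul_ne_zero (Complex.exp_ne_zero _) (Complex.exp_ne_zero _)

theorem hasDerivAt_leading {m : ℕ} (hm : 1 ≤ m) (a : Fin m → ℂ) (t : ℂ) :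
    HasDerivAt (leading m a)
      (leading m a t * (MvPolynomial.eval a (r m) - zeta m t * ev m a t (sigma m))) t := by
  have h1 : HasDerivAt (fun s => xpow s (MvPolynomial.eval a (r m)))
      (MvPolynomial.eval a (r m) * xpow t (MvPolynomial.eval a (r m))) t := by
    have := ((hasDerivAt_id t).const_mul (MvPolynomial.eval a (r m))).cexp
    simpa [xpow, mul_comm] using this
  have h2 : HasDerivAt (fun s => Complex.exp (-S m s a))
      (Complex.exp (-S m t a) * -(zeta m t * ev m a t (sigma m))) t :=
    (hasDerivAt_S hm a t).fun_neg.cexp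
  refine (h1.fun_mul h2).congr_deriv ?_
  rw [leading]
  ring

/-- The coefficient of `u'` in the equation for `u = x ^ (-r) e ^ S f`. -/
def damping (m : ℕ) (a : Fin m → ℂ) (t : ℂ) : ℂ :=
  zeta m t * ev m a t (2 * sigma m + Polynomial.X ^ halfDeg m * Polynomial.C (1 - 2 * r m))

theorem damping_eq (m : ℕ) (a : Fin m → ℂ) (t : ℂ) :
    damping m a t =
      2 * (zeta m t * ev m a t (sigma m)) + 1 - 2 * MvPolynomial.eval a (r m) := by
  have h := zeta_mul_xi_pow m t
  simp only [damping, map_add, map_mul, map_pow, ev_X, ev_C, map_sub, map_one, map_ofNat]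
  linear_combination (1 - 2 * MvPolynomial.eval a (r m)) * h

theorem ev_potential_expand (m : ℕ) (a : Fin m → ℂ) (t : ℂ) :
    zeta m t ^ 2 * ev m a t (potential m) =
      (zeta m t * ev m a t (sigma m)) ^ 2 - P m (Complex.exp t) a -
      (2 * MvPolynomial.eval a (r m) - 1) * (zeta m t * ev m a t (sigma m)) -
      ((m : ℂ) / 2 * zeta m t * ev m a t (sigma m) + zeta m t * ev m a t (eulerD m (sigma m))) +
      MvPolynomial.eval a (r m) ^ 2 - MvPolynomial.eval a (r m) := by
  have h := zeta_mul_xi_pow m t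
  rw [P_eq, potential]
  simp only [map_add, map_mul, map_pow, ev_X, ev_C, map_sub, map_ofNat, pow_mul',
    MvPolynomial.eval_C]
  linear_combination (zeta m t * (ev m a t (sigma m) * (1 - (m : ℂ) / 2 - 2 *
    MvPolynomial.eval a (r m)) - ev m a t (eulerD m (sigma m)))
    + (zeta m t * xi m t ^ halfDeg m + 1) *
      (MvPolynomial.eval a (r m) ^ 2 - MvPolynomial.eval a (r m))) * h

/-- A polynomial U satisfies the reduced equation up to the forcing term ζ · `residual`; subtracting
it from an exact solution leaves the same linear equation with that forcing term. -/
theorem ev_residual {m : ℕ} (a : Fin m → ℂ) (t : ℂ) (U : Polynomial (Coeff m)) :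
    ev m a t (eulerD m (eulerD m U)) =
      damping m a t * ev m a t (eulerD m U) -
      zeta m t * ev m a t (Polynomial.X * reducedPotential m) * ev m a t U +
      zeta m t * ev m a t (residual m U) := by
  have h := zeta_mul_xi_pow m t
  rw [damping_eq, residual]
  simp only [map_add, map_mul, map_pow, ev_X, ev_C, map_sub, map_ofNat, map_one]
  linear_combination -(ev m a t (eulerD m (eulerD m U)) +
    (2 * MvPolynomial.eval a (r m) - 1) * ev m a t (eulerD m U)) * h

/-! ### Locally uniform limits of entire functions of several variables -/

/-- Cauchy's one-variable estimate on the complex line through x in direction h, on the circle of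
radius δ/‖h‖. -/
theorem norm_fderiv_le_of_forall_mem_closedBall {E : Type*} [NormedAddCommGroup E]
    [NormedSpace ℂ E] {G : E → ℂ} (hG : Differentiable ℂ G) {x : E} {δ C : ℝ} (hδ : 0 < δ)
    (hC : ∀ y ∈ Metric.closedBall x δ, ‖G y‖ ≤ C) : ‖fderiv ℂ G x‖ ≤ C / δ := by
  have hC0 : 0 ≤ C := (norm_nonneg _).trans (hC x (Metric.mem_closedBall_self hδ.le))
  refine ContinuousLinearMap.opNorm_le_bound _ (by positivity) fun h => ?_
  rcases eq_or_ne h 0 with rfl | hh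
  · simp
  have hn : 0 < ‖h‖ := norm_pos_iff.2 hh
  have hd : Differentiable ℂ fun z : ℂ => G (x + z • h) :=
    hG.comp ((differentiable_const x).add (differentiable_id.smul_const h))
  have h1 := Complex.norm_deriv_le_of_forall_mem_sphere_norm_le (c := 0) (R := δ / ‖h‖) (C := C)
    (f := fun z : ℂ => G (x + z • h)) (by positivity) hd.diffContOnCl (by
      intro z hz
      apply hC
      rw [mem_sphere_zero_iff_norm] at hz
      rw [mem_closedBall_iff_norm, add_sub_cancel_left, norm_smul, hz, div_mul_cancel₀ _ hn.ne'])
  have h2 : deriv (fun z : ℂ => G (x + z • h)) 0 = fderiv ℂ G x h := by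
    have e1 : HasFDerivAt G (fderiv ℂ G x) (x + (0 : ℂ) • h) := by
      simpa using (hG x).hasFDerivAt
    have e2 : HasDerivAt (fun z : ℂ => x + z • h) h 0 := by
      simpa using ((hasDerivAt_id (0 : ℂ)).smul_const h).const_add x
    exact (e1.comp_hasDerivAt (0 : ℂ) e2).deriv
  rw [h2] at h1
  refine h1.trans_eq ?_
  field_simp

/-- A locally uniform limit of entire functions on a proper complex normed space is entire. -/
theorem differentiable_of_tendstoUniformlyOn_isCompact {E : Type*} [NormedAddCommGroup E]
    [NormedSpace ℂ E] [ProperSpace E] {F : ℕ → E → ℂ} {f : E → ℂ}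
    (hF : ∀ n, Differentiable ℂ (F n))
    (h : ∀ K : Set E, IsCompact K → TendstoUniformlyOn F f Filter.atTop K) :
    Differentiable ℂ f := by
  intro x₀
  have hu := (h _ (isCompact_closedBall x₀ 2)).uniformCauchySeqOn
  have hc : UniformCauchySeqOn (fun n => fderiv ℂ (F n)) Filter.atTop (Metric.ball x₀ 1) := by
    rw [Metric.uniformCauchySeqOn_iff] at hu ⊢
    intro ε hε
    obtain ⟨N, hN⟩ := hu (ε / 2) (half_pos hε)
    refine ⟨N, fun n hn k hk x hx => ?_⟩
    -- Unit balls centred in the ball of radius 1 stay in the ball of radius 2, where the sequence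
    -- is uniformly Cauchy; hence the derivatives are uniformly Cauchy too.
    have hd := norm_fderiv_le_of_forall_mem_closedBall (G := fun y => F n y - F k y)
      ((hF n).sub (hF k)) (x := x) (δ := 1) (C := ε / 2) one_pos (by
        intro y hy
        have hy2 : y ∈ Metric.closedBall x₀ 2 := by
          rw [Metric.mem_closedBall] at hy ⊢
          rw [Metric.mem_ball] at hx
          linarith [dist_triangle y x x₀]
        have := hN n hn k hk y hy2
        rw [dist_eq_norm] at this
        exact this.le)
    rw [fderiv_fun_sub (hF n x) (hF k x)] at hd
    rw [dist_eq_norm]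
    linarith
  have hlim : ∀ x ∈ Metric.ball x₀ 1, ∃ g, Filter.Tendsto (fun n => fderiv ℂ (F n) x)
      Filter.atTop (nhds g) := fun x hx => cauchySeq_tendsto_of_complete (hc.cauchySeq hx)
  choose! g hg using hlim
  have ht := (hc.tendstoUniformlyOn_of_tendsto hg).tendstoLocallyUniformlyOn
  refine (hasFDerivAt_of_tendstoLocallyUniformlyOn (f := F) (g := f) Metric.isOpen_ball ht
    (fun n x _ => (hF n x).hasFDerivAt) (fun x hx => ?_)
    (Metric.mem_ball_self one_pos)).differentiableAt
  exact (h {x} isCompact_singleton).tendsto_at rfl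

theorem hasSum_of_eq {f g : ℕ → ℂ} {s : ℂ} (h : ∀ n, f n = g n) (hf : HasSum f s) :
    HasSum g s := funext h ▸ hf

/-! ### Power series with parameters -/

/-- Power series in one variable whose coefficients depend on a parameter, with an infinite radius
of convergence locally uniformly in the parameter. -/
def FastDecay {E : Type*} [TopologicalSpace E] (c : ℕ → E → ℂ) : Prop :=
  ∀ K : Set E, IsCompact K → ∀ ρ : ℝ, 1 ≤ ρ → ∃ M : ℝ, ∀ a ∈ K, ∀ n, ‖c n a‖ * ρ ^ n ≤ M

/-- The sum of a power series whose coefficients depend on a parameter. -/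
def seriesSum {E : Type*} (c : ℕ → E → ℂ) (t : ℂ) (a : E) : ℂ := ∑' n, c n a * t ^ n

/-- The coefficients of the derivative of a power series. -/
def derivCoeff {E : Type*} (c : ℕ → E → ℂ) (n : ℕ) (a : E) : ℂ := ((n : ℂ) + 1) * c (n + 1) a

section FastDecay

variable {E : Type*} [NormedAddCommGroup E]

/-- Using the decay at radius 2(|T| + 1) instead of T leaves a factor 2^(-n) over, which serves as a
summable majorant. -/
theorem FastDecay.exists_bound {c : ℕ → E → ℂ} (hc : FastDecay c) {K : Set E} (hK : IsCompact K)
    (T : ℝ) : ∃ M : ℝ, ∀ a ∈ K, ∀ t : ℂ, ‖t‖ ≤ T → ∀ n, ‖c n a * t ^ n‖ ≤ M * (1 / 2) ^ n := by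
  obtain ⟨M, hM⟩ := hc K hK (2 * (|T| + 1)) (by linarith [abs_nonneg T])
  refine ⟨M, fun a ha t ht n => ?_⟩
  have h1 : ‖t‖ ^ n ≤ (|T| + 1) ^ n :=
    pow_le_pow_left₀ (norm_nonneg _) (by linarith [le_abs_self T]) n
  have h2 := hM a ha n
  rw [mul_pow] at h2
  rw [norm_mul, norm_pow]
  have h3 : ‖c n a‖ * ‖t‖ ^ n ≤ ‖c n a‖ * (|T| + 1) ^ n := by gcongr
  refine h3.trans ?_
  have h4 : (2 : ℝ) ^ n * (1 / 2) ^ n = 1 := by rw [← mul_pow]; norm_num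
  calc ‖c n a‖ * (|T| + 1) ^ n
      = ‖c n a‖ * (2 ^ n * (|T| + 1) ^ n) * (1 / 2) ^ n := by
        linear_combination -(‖c n a‖ * (|T| + 1) ^ n) * h4
    _ ≤ M * (1 / 2) ^ n := by gcongr

theorem FastDecay.summable_norm {c : ℕ → E → ℂ} (hc : FastDecay c) (t : ℂ) (a : E) :
    Summable fun n => ‖c n a * t ^ n‖ := by
  obtain ⟨M, hM⟩ := hc.exists_bound (isCompact_singleton (x := a)) ‖t‖
  exact Summable.of_nonneg_of_le (fun _ => norm_nonneg _) (fun n => hM a rfl t le_rfl n)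
    (summable_geometric_two.mul_left M)

theorem FastDecay.hasSum {c : ℕ → E → ℂ} (hc : FastDecay c) (t : ℂ) (a : E) :
    HasSum (fun n => c n a * t ^ n) (seriesSum c t a) :=
  (hc.summable_norm t a).of_norm.hasSum

/-- The factor n + 1 ≤ 2^(n+1) is absorbed by doubling the radius. -/
theorem FastDecay.derivCoeff {c : ℕ → E → ℂ} (hc : FastDecay c) : FastDecay (derivCoeff c) := by
  intro K hK ρ hρ
  obtain ⟨M, hM⟩ := hc K hK (2 * ρ) (by linarith)
  refine ⟨M, fun a ha n => ?_⟩
  have h := hM a ha (n + 1)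
  have h1 : ((n : ℝ) + 1) ≤ 2 ^ (n + 1) := by exact_mod_cast (n + 1).lt_two_pow_self.le
  have e : ‖(n : ℂ) + 1‖ = (n : ℝ) + 1 := by
    have : ((n : ℂ) + 1) = ((n + 1 : ℕ) : ℂ) := by push_cast; rfl
    rw [this, Complex.norm_natCast]
    push_cast
    rfl
  rw [IrregularSchrodinger.derivCoeff, norm_mul, e]
  refine le_trans ?_ h
  rw [mul_pow]
  calc ((n : ℝ) + 1) * ‖c (n + 1) a‖ * ρ ^ n = ‖c (n + 1) a‖ * (((n : ℝ) + 1) * ρ ^ n) := by ring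
    _ ≤ ‖c (n + 1) a‖ * (2 ^ (n + 1) * ρ ^ (n + 1)) := by
      gcongr
      · omega

theorem FastDecay.differentiable [NormedSpace ℂ E] [ProperSpace E] {c : ℕ → E → ℂ} (hc : FastDecay c)
    (hd : ∀ n, Differentiable ℂ (c n)) :
    Differentiable ℂ fun p : ℂ × E => seriesSum c p.1 p.2 := by
  refine differentiable_of_tendstoUniformlyOn_isCompact
    (F := fun N p => ∑ n ∈ Finset.range N, c n p.2 * p.1 ^ n) (fun N => ?_) fun K hK => ?_
  · refine Differentiable.fun_sum fun n _ => ?_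
    exact ((hd n).comp differentiable_snd).mul (differentiable_fst.pow n)
  · obtain ⟨T, hT⟩ := (hK.image continuous_fst).isBounded.exists_norm_le
    obtain ⟨M, hM⟩ := hc.exists_bound (hK.image continuous_snd) T
    exact tendstoUniformlyOn_tsum_nat (summable_geometric_two.mul_left M) fun n p hp =>
      hM p.2 ⟨p, hp, rfl⟩ p.1 (hT p.1 ⟨p, hp, rfl⟩) n

theorem FastDecay.hasDerivAt {c : ℕ → E → ℂ} (hc : FastDecay c) (t : ℂ) (a : E) :
    HasDerivAt (fun s => seriesSum c s a) (seriesSum (IrregularSchrodinger.derivCoeff c) t a) t := by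
  obtain ⟨M, hM⟩ := hc.exists_bound (isCompact_singleton (x := a)) (‖t‖ + 1)
  have hb : ∀ (n : ℕ), ∀ w ∈ Metric.ball (0 : ℂ) (‖t‖ + 1), ‖c n a * w ^ n‖ ≤ M * (1 / 2) ^ n := by
    intro n w hw
    rw [mem_ball_zero_iff] at hw
    exact hM a rfl w hw.le n
  have hdn : ∀ n : ℕ, DifferentiableOn ℂ (fun w : ℂ => c n a * w ^ n)
      (Metric.ball (0 : ℂ) (‖t‖ + 1)) := fun n =>
    ((differentiable_id.pow n).const_mul (c n a)).differentiableOn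
  have hmem : t ∈ Metric.ball (0 : ℂ) (‖t‖ + 1) := by
    rw [mem_ball_zero_iff]; linarith
  have hu := summable_geometric_two.mul_left M
  have h1 := Complex.hasSum_deriv_of_summable_norm hu hdn Metric.isOpen_ball hb hmem
  have h2 := (Complex.differentiableOn_tsum_of_summable_norm hu hdn Metric.isOpen_ball hb
    ).differentiableAt (Metric.isOpen_ball.mem_nhds hmem)
  have h3 := h2.hasDerivAt
  refine h3.congr_deriv ?_
  refine h1.unique ?_
  rw [← hasSum_nat_add_iff' 1]
  simp only [Finset.range_one, Finset.sum_singleton, pow_zero, mul_one, deriv_const, sub_zero]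
  refine hasSum_of_eq (fun n => ?_) (hc.derivCoeff.hasSum t a)
  rw [deriv_const_mul_field, deriv_pow_field]
  simp [IrregularSchrodinger.derivCoeff]
  ring

end FastDecay

/-! ### Fundamental solutions, entire in t and a -/

/-- The Taylor coefficients at `t = 0` of `P_m(exp t, a)`. -/
def expCoeff (m : ℕ) (j : ℕ) (a : Fin m → ℂ) : ℂ :=
  ((m : ℂ) ^ j + ∑ i : Fin m, a i * ((m - (i.val + 1) : ℕ) : ℂ) ^ j) / (j.factorial : ℂ)

theorem hasSum_expCoeff (m : ℕ) (a : Fin m → ℂ) (t : ℂ) :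
    HasSum (fun j => expCoeff m j a * t ^ j) (P m (Complex.exp t) a) := by
  have key : ∀ k : ℕ, HasSum (fun j => (k : ℂ) ^ j / (j.factorial : ℂ) * t ^ j)
      (Complex.exp t ^ k) := by
    intro k
    have := NormedSpace.expSeries_div_hasSum_exp (𝔸 := ℂ) ((k : ℂ) * t)
    rw [← Complex.exp_eq_exp_ℂ, Complex.exp_nat_mul] at this
    refine hasSum_of_eq (fun j => ?_) this
    rw [mul_pow]
    ring
  have h := (key m).add (hasSum_sum (s := Finset.univ) fun (i : Fin m) _ =>
    (key (m - (i.val + 1))).mul_left (a i))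
  rw [P]
  refine hasSum_of_eq (fun j => ?_) h
  rw [expCoeff, add_div, add_mul, Finset.sum_div, Finset.sum_mul]
  refine congrArg₂ (· + ·) (by ring) (Finset.sum_congr rfl fun i _ => by ring)

theorem differentiable_expCoeff (m j : ℕ) : Differentiable ℂ (expCoeff m j) := by
  unfold expCoeff
  fun_prop

theorem fastDecay_expCoeff (m : ℕ) : FastDecay (expCoeff m) := by
  intro K hK ρ hρ
  obtain ⟨B, hB⟩ := hK.isBounded.exists_norm_le
  refine ⟨(1 + m * |B|) * Real.exp (m * ρ), fun a ha j => ?_⟩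
  have h1 : ‖(m : ℂ) ^ j + ∑ i : Fin m, a i * ((m - (i.val + 1) : ℕ) : ℂ) ^ j‖ ≤
      (1 + m * |B|) * (m : ℝ) ^ j := by
    refine (norm_add_le _ _).trans ?_
    rw [norm_pow, Complex.norm_natCast, add_mul, one_mul]
    gcongr
    refine (norm_sum_le _ _).trans ?_
    refine (Finset.sum_le_card_nsmul _ _ (|B| * (m : ℝ) ^ j) fun i _ => ?_).trans_eq ?_
    · rw [norm_mul, norm_pow, Complex.norm_natCast]
      gcongr
      · exact ((norm_le_pi_norm a i).trans (hB a ha)).trans (le_abs_self B)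
      · exact_mod_cast Nat.sub_le _ _
    · simp
      ring
  have h2 := Real.pow_div_factorial_le_exp (m * ρ) (by positivity) j
  rw [expCoeff, norm_div, Complex.norm_natCast]
  calc _ ≤ (1 + m * |B|) * (m : ℝ) ^ j / j.factorial * ρ ^ j := by gcongr
    _ = (1 + m * |B|) * ((m * ρ) ^ j / j.factorial) := by rw [mul_pow]; ring
    _ ≤ _ := by gcongr

/-- The Taylor coefficients at `t = 0` of the solution with initial values `c₀`, `c₁`. -/
def odeCoeff (m : ℕ) (c₀ c₁ : ℂ) : ℕ → (Fin m → ℂ) → ℂ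
  | 0 => fun _ => c₀
  | 1 => fun _ => c₁
  | n + 2 => fun a => (((n : ℂ) + 1) * odeCoeff m c₀ c₁ (n + 1) a +
      ∑ j : Fin (n + 1), odeCoeff m c₀ c₁ j.val a * expCoeff m (n - j.val) a) /
        (((n : ℂ) + 2) * ((n : ℂ) + 1))
  decreasing_by all_goals omega

theorem odeCoeff_add_two (m : ℕ) (c₀ c₁ : ℂ) (n : ℕ) (a : Fin m → ℂ) :
    odeCoeff m c₀ c₁ (n + 2) a = (((n : ℂ) + 1) * odeCoeff m c₀ c₁ (n + 1) a +
      ∑ j ∈ Finset.range (n + 1), odeCoeff m c₀ c₁ j a * expCoeff m (n - j) a) /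
        (((n : ℂ) + 2) * ((n : ℂ) + 1)) := by
  rw [odeCoeff, Finset.sum_range]

theorem differentiable_odeCoeff (m : ℕ) (c₀ c₁ : ℂ) (n : ℕ) :
    Differentiable ℂ (odeCoeff m c₀ c₁ n) := by
  induction n using Nat.strong_induction_on with
  | _ n ih =>
    match n with
    | 0 => rw [odeCoeff]; fun_prop
    | 1 => rw [odeCoeff]; fun_prop
    | n + 2 =>
      rw [funext (odeCoeff_add_two m c₀ c₁ n)]
      simp only [div_eq_mul_inv]
      refine Differentiable.mul_const (((ih (n + 1) (by omega)).const_mul _).fun_add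
        (Differentiable.fun_sum fun j hj => ?_)) _
      rw [Finset.mem_range] at hj
      exact (ih j (by omega)).mul (differentiable_expCoeff m _)

/-- At any radius ρ the weighted coefficients are bounded by the maximal size of finitely many of
them: the denominator of the recurrence, quadratic in the index, eventually dominates the numerator,
which grows linearly. -/
theorem fastDecay_odeCoeff (m : ℕ) (c₀ c₁ : ℂ) : FastDecay (odeCoeff m c₀ c₁) := by
  intro K hK ρ hρ
  obtain ⟨A, hA⟩ := fastDecay_expCoeff m K hK ρ hρ
  have hb : ∀ n, ∃ B, ∀ a ∈ K, ‖odeCoeff m c₀ c₁ n a‖ ≤ B := fun n =>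
    hK.exists_bound_of_continuousOn (differentiable_odeCoeff m c₀ c₁ n).continuous.continuousOn
  choose B hB using hb
  -- The induction step multiplies M by (ρ + |A| ρ^2)(k + 1) and divides by (k + 2)(k + 1), so it
  -- closes for k ≥ n₀; smaller indices are covered by the sum M.
  obtain ⟨n₀, hn₀⟩ := exists_nat_ge (ρ + |A| * ρ ^ 2)
  set M := ∑ n ∈ Finset.range (n₀ + 2), |B n| * ρ ^ n with hM
  have hM0 : 0 ≤ M := Finset.sum_nonneg fun n _ => by positivity
  refine ⟨M, fun a ha n => ?_⟩
  have hρ0 : 0 < ρ := by linarith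
  induction n using Nat.strong_induction_on with
  | _ n ih =>
    by_cases hn : n < n₀ + 2
    · have h1 : |B n| * ρ ^ n ≤ M :=
        Finset.single_le_sum (f := fun n => |B n| * ρ ^ n) (fun i _ => by positivity)
          (Finset.mem_range.2 hn)
      refine le_trans ?_ h1
      gcongr
      exact (hB n a ha).trans (le_abs_self _)
    · obtain ⟨k, rfl⟩ : ∃ k, n = k + 2 := ⟨n - 2, by omega⟩
      have hk : (n₀ : ℝ) ≤ k := by exact_mod_cast (by omega : n₀ ≤ k)
      have e1 : ‖(k : ℂ) + 1‖ = (k : ℝ) + 1 := by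
        rw [show ((k : ℂ) + 1) = ((k + 1 : ℕ) : ℂ) by push_cast; rfl, Complex.norm_natCast]
        push_cast; rfl
      have e2 : ‖(k : ℂ) + 2‖ = (k : ℝ) + 2 := by
        rw [show ((k : ℂ) + 2) = ((k + 2 : ℕ) : ℂ) by push_cast; rfl, Complex.norm_natCast]
        push_cast; rfl
      have hs : ‖∑ j ∈ Finset.range (k + 1), odeCoeff m c₀ c₁ j a * expCoeff m (k - j) a‖ * ρ ^ k ≤
          (k + 1) * (M * |A|) := by
        refine (mul_le_mul_of_nonneg_right (norm_sum_le _ _) (by positivity)).trans ?_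
        rw [Finset.sum_mul]
        refine (Finset.sum_le_card_nsmul _ _ (M * |A|) fun j hj => ?_).trans_eq ?_
        · rw [Finset.mem_range] at hj
          have h1 := ih j (by omega)
          have h2 := (hA a ha (k - j)).trans (le_abs_self A)
          have h3 : ρ ^ k = ρ ^ j * ρ ^ (k - j) := by rw [← pow_add]; congr 1; omega
          rw [norm_mul, h3]
          calc _ = (‖odeCoeff m c₀ c₁ j a‖ * ρ ^ j) * (‖expCoeff m (k - j) a‖ * ρ ^ (k - j)) := by
                ring
            _ ≤ _ := by gcongr
        · simp
      have h1 := ih (k + 1) (by omega)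
      rw [odeCoeff_add_two, norm_div, norm_mul, e1, e2, div_mul_eq_mul_div,
        div_le_iff₀ (by positivity)]
      calc _ ≤ (((k : ℝ) + 1) * ‖odeCoeff m c₀ c₁ (k + 1) a‖ +
            ‖∑ j ∈ Finset.range (k + 1), odeCoeff m c₀ c₁ j a * expCoeff m (k - j) a‖) *
              ρ ^ (k + 2) := by
            gcongr
            refine (norm_add_le _ _).trans ?_
            rw [norm_mul, e1]
        _ = ((k : ℝ) + 1) * (‖odeCoeff m c₀ c₁ (k + 1) a‖ * ρ ^ (k + 1)) * ρ +
            ‖∑ j ∈ Finset.range (k + 1), odeCoeff m c₀ c₁ j a * expCoeff m (k - j) a‖ * ρ ^ k *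
              ρ ^ 2 := by ring
        _ ≤ ((k : ℝ) + 1) * M * ρ + (k + 1) * (M * |A|) * ρ ^ 2 := by gcongr
        _ = M * ((ρ + |A| * ρ ^ 2) * (k + 1)) := by ring
        _ ≤ M * ((k + 2) * (k + 1)) :=
            mul_le_mul_of_nonneg_left (mul_le_mul_of_nonneg_right (by linarith) (by positivity)) hM0

/-- The solution of the equation with initial values `c₀`, `c₁` at `t = 0`. -/
def entireSol (m : ℕ) (c₀ c₁ : ℂ) : ℂ → (Fin m → ℂ) → ℂ := seriesSum (odeCoeff m c₀ c₁)

/-- The derivative of `entireSol` with respect to `t`. -/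
def entireSolDeriv (m : ℕ) (c₀ c₁ : ℂ) : ℂ → (Fin m → ℂ) → ℂ :=
  seriesSum (derivCoeff (odeCoeff m c₀ c₁))

theorem differentiable_entireSol (m : ℕ) (c₀ c₁ : ℂ) :
    Differentiable ℂ fun p : ℂ × (Fin m → ℂ) => entireSol m c₀ c₁ p.1 p.2 :=
  (fastDecay_odeCoeff m c₀ c₁).differentiable (differentiable_odeCoeff m c₀ c₁)

theorem differentiable_entireSolDeriv (m : ℕ) (c₀ c₁ : ℂ) :
    Differentiable ℂ fun p : ℂ × (Fin m → ℂ) => entireSolDeriv m c₀ c₁ p.1 p.2 :=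
  (fastDecay_odeCoeff m c₀ c₁).derivCoeff.differentiable fun n =>
    (differentiable_odeCoeff m c₀ c₁ (n + 1)).const_mul _

theorem hasDerivAt_entireSol (m : ℕ) (c₀ c₁ : ℂ) (a : Fin m → ℂ) (t : ℂ) :
    HasDerivAt (fun s => entireSol m c₀ c₁ s a) (entireSolDeriv m c₀ c₁ t a) t :=
  (fastDecay_odeCoeff m c₀ c₁).hasDerivAt t a

/-- In the variable t the equation reads f'' = f' + P f; the recurrence is this identity coefficient
by coefficient, with P f expanded as a Cauchy product. -/
theorem hasDerivAt_entireSolDeriv (m : ℕ) (c₀ c₁ : ℂ) (a : Fin m → ℂ) (t : ℂ) :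
    HasDerivAt (fun s => entireSolDeriv m c₀ c₁ s a)
      (entireSolDeriv m c₀ c₁ t a + P m (Complex.exp t) a * entireSol m c₀ c₁ t a) t := by
  have hc := fastDecay_odeCoeff m c₀ c₁
  refine (hc.derivCoeff.hasDerivAt t a).congr_deriv ?_
  have h1 : P m (Complex.exp t) a * entireSol m c₀ c₁ t a =
      ∑' n, ∑ k ∈ Finset.range (n + 1), (odeCoeff m c₀ c₁ k a * t ^ k) *
        (expCoeff m (n - k) a * t ^ (n - k)) := by
    rw [← tsum_mul_tsum_eq_tsum_sum_range_of_summable_norm (hc.summable_norm t a)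
      ((fastDecay_expCoeff m).summable_norm t a), (hasSum_expCoeff m a t).tsum_eq, mul_comm]
    rfl
  have h2 := summable_norm_sum_mul_range_of_summable_norm (hc.summable_norm t a)
      ((fastDecay_expCoeff m).summable_norm t a)
  rw [h1]
  refine (hc.derivCoeff.derivCoeff.hasSum t a).unique ?_
  refine hasSum_of_eq (fun n => ?_) ((hc.derivCoeff.hasSum t a).add h2.of_norm.hasSum)
  have e1 : (n : ℂ) + 1 ≠ 0 := by exact_mod_cast n.succ_ne_zero
  have e2 : (n : ℂ) + 2 ≠ 0 := by exact_mod_cast (n + 1).succ_ne_zero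
  have e3 : ∑ k ∈ Finset.range (n + 1), (odeCoeff m c₀ c₁ k a * t ^ k) *
        (expCoeff m (n - k) a * t ^ (n - k)) =
      (∑ k ∈ Finset.range (n + 1), odeCoeff m c₀ c₁ k a * expCoeff m (n - k) a) * t ^ n := by
    rw [Finset.sum_mul]
    refine Finset.sum_congr rfl fun k hk => ?_
    rw [Finset.mem_range] at hk
    rw [show t ^ n = t ^ k * t ^ (n - k) by rw [← pow_add]; congr 1; omega]
    ring
  rw [e3]
  simp only [derivCoeff, odeCoeff_add_two]
  push_cast
  field_simp
  ring

theorem entireSol_zero (m : ℕ) (c₀ c₁ : ℂ) (a : Fin m → ℂ) : entireSol m c₀ c₁ 0 a = c₀ := by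
  rw [entireSol, seriesSum, tsum_eq_single 0 fun n hn => by simp [hn]]
  simp [odeCoeff]

theorem entireSolDeriv_zero (m : ℕ) (c₀ c₁ : ℂ) (a : Fin m → ℂ) :
    entireSolDeriv m c₀ c₁ 0 a = c₁ := by
  rw [entireSolDeriv, seriesSum, tsum_eq_single 0 fun n hn => by simp [hn]]
  simp [derivCoeff, odeCoeff]

/-- The Wronskian of the two fundamental solutions. -/
theorem wronskian_entireSol (m : ℕ) (a : Fin m → ℂ) (t : ℂ) :
    entireSol m 1 0 t a * entireSolDeriv m 0 1 t a -
      entireSolDeriv m 1 0 t a * entireSol m 0 1 t a = Complex.exp t := by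
  have hd : ∀ s, HasDerivAt (fun s => (entireSol m 1 0 s a * entireSolDeriv m 0 1 s a -
      entireSolDeriv m 1 0 s a * entireSol m 0 1 s a) * Complex.exp (-s)) 0 s := by
    intro s
    have h := (((hasDerivAt_entireSol m 1 0 a s).fun_mul (hasDerivAt_entireSolDeriv m 0 1 a s)).fun_sub
      ((hasDerivAt_entireSolDeriv m 1 0 a s).fun_mul (hasDerivAt_entireSol m 0 1 a s))).fun_mul
      ((hasDerivAt_id s).fun_neg.cexp)
    refine h.congr_deriv ?_
    simp only [id]
    ring
  have hc := is_const_of_deriv_eq_zero (fun s => (hd s).differentiableAt) (fun s => (hd s).deriv) t 0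
  simp only [entireSol_zero, entireSolDeriv_zero, neg_zero, Complex.exp_zero] at hc
  have he : Complex.exp (-t) * Complex.exp t = 1 := by rw [← Complex.exp_add]; simp
  linear_combination Complex.exp t * hc - (entireSol m 1 0 t a * entireSolDeriv m 0 1 t a -
      entireSolDeriv m 1 0 t a * entireSol m 0 1 t a) * he

/-! ### The energy inequality -/

/-- With the integrating factor e^K, the function V e^K + e^(K(β)) H is nondecreasing, because K ≤
K(β). The lower bound on V' thus bounds the value at the left end by the value at the right end. -/
theorem backward_gronwall {V V' K K' H H' : ℝ → ℝ} {α β : ℝ} (hαβ : α ≤ β)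
    (hV : ∀ τ ∈ Set.Icc α β, HasDerivAt V (V' τ) τ)
    (hK : ∀ τ ∈ Set.Icc α β, HasDerivAt K (K' τ) τ)
    (hH : ∀ τ ∈ Set.Icc α β, HasDerivAt H (H' τ) τ)
    (hK0 : ∀ τ ∈ Set.Icc α β, 0 ≤ K' τ) (hH0 : ∀ τ ∈ Set.Icc α β, 0 ≤ H' τ)
    (hineq : ∀ τ ∈ Set.Icc α β, -(K' τ * V τ) - H' τ ≤ V' τ) :
    V α * Real.exp (K α) ≤ Real.exp (K β) * (V β + (H β - H α)) := by
  have hKle : ∀ τ ∈ Set.Icc α β, K τ ≤ K β := by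
    have : MonotoneOn K (Set.Icc α β) := by
      refine monotoneOn_of_deriv_nonneg (convex_Icc _ _)
        (fun τ hτ => (hK τ hτ).continuousAt.continuousWithinAt)
        (fun τ hτ => (hK τ (interior_subset hτ)).differentiableAt.differentiableWithinAt)
        fun τ hτ => ?_
      rw [(hK τ (interior_subset hτ)).deriv]
      exact hK0 τ (interior_subset hτ)
    exact fun τ hτ => this hτ (Set.right_mem_Icc.2 hαβ) hτ.2
  have hd : ∀ τ ∈ Set.Icc α β, HasDerivAt (fun τ => V τ * Real.exp (K τ) + Real.exp (K β) * H τ)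
      (V' τ * Real.exp (K τ) + V τ * (Real.exp (K τ) * K' τ) + Real.exp (K β) * H' τ) τ :=
    fun τ hτ => ((hV τ hτ).fun_mul (hK τ hτ).exp).fun_add ((hH τ hτ).const_mul _)
  have hm : MonotoneOn (fun τ => V τ * Real.exp (K τ) + Real.exp (K β) * H τ) (Set.Icc α β) := by
    refine monotoneOn_of_deriv_nonneg (convex_Icc _ _)
      (fun τ hτ => (hd τ hτ).continuousAt.continuousWithinAt)
      (fun τ hτ => (hd τ (interior_subset hτ)).differentiableAt.differentiableWithinAt)
      fun τ hτ => ?_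
    have hτ := interior_subset hτ
    rw [(hd τ hτ).deriv]
    have h1 := mul_le_mul_of_nonneg_right (hineq τ hτ) (Real.exp_pos (K τ)).le
    have h2 := mul_le_mul_of_nonneg_right (Real.exp_le_exp.2 (hKle τ hτ)) (hH0 τ hτ)
    nlinarith
  have := hm (Set.left_mem_Icc.2 hαβ) (Set.right_mem_Icc.2 hαβ) hαβ
  simp only at this
  nlinarith

theorem norm_xi (m : ℕ) (t : ℂ) : ‖xi m t‖ = Real.exp (-(t.re / q m)) := by
  rw [xi, Complex.norm_exp]
  congr 1
  rw [Complex.neg_re, Complex.div_natCast_re]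

theorem norm_xi_pos (m : ℕ) (t : ℂ) : 0 < ‖xi m t‖ := by
  rw [norm_xi]; exact Real.exp_pos _

theorem norm_xi_le_one (m : ℕ) {t : ℂ} (ht : 0 ≤ t.re) : ‖xi m t‖ ≤ 1 := by
  rw [norm_xi, Real.exp_le_one_iff]
  have : 0 ≤ t.re / q m := by positivity
  linarith

theorem norm_zeta_mul (m : ℕ) (t : ℂ) : ‖zeta m t‖ * ‖xi m t‖ ^ halfDeg m = 1 := by
  rw [← norm_pow, ← norm_mul, zeta_mul_xi_pow, norm_one]

theorem exists_norm_ev_le (m : ℕ) {K : Set (Fin m → ℂ)} (hK : IsCompact K)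
    (p : Polynomial (Coeff m)) :
    ∃ C, 0 ≤ C ∧ ∀ a ∈ K, ∀ t : ℂ, 0 ≤ t.re → ‖ev m a t p‖ ≤ C := by
  have hb : ∀ i : ℕ, ∃ B, ∀ a ∈ K, ‖MvPolynomial.eval a (p.coeff i)‖ ≤ B := fun i =>
    hK.exists_bound_of_continuousOn (MvPolynomial.continuous_eval _).continuousOn
  choose B hB using hb
  refine ⟨∑ i ∈ Finset.range (p.natDegree + 1), |B i|, by positivity, fun a ha t ht => ?_⟩
  have e : ev m a t p = ∑ i ∈ Finset.range (p.natDegree + 1),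
      MvPolynomial.eval a (p.coeff i) * xi m t ^ i := by
    simp [ev, Polynomial.eval₂_eq_sum_range]
  rw [e]
  refine (norm_sum_le _ _).trans (Finset.sum_le_sum fun i _ => ?_)
  rw [norm_mul, norm_pow]
  calc _ ≤ |B i| * 1 := by
        gcongr
        · exact (hB i a ha).trans (le_abs_self _)
        · exact pow_le_one₀ (norm_nonneg _) (norm_xi_le_one m ht)
    _ = |B i| := mul_one _

/-- Arguments with large real part make `x ^ (-1/q)` small. -/
theorem exists_norm_xi_le (m : ℕ) {ε : ℝ} (hε : 0 < ε) :
    ∃ ρ : ℝ, 0 ≤ ρ ∧ ∀ t : ℂ, ρ ≤ t.re → ‖xi m t‖ ≤ ε := by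
  refine ⟨max 0 (-(q m * Real.log ε)), le_max_left _ _, fun t ht => ?_⟩
  rw [norm_xi, ← Real.le_log_iff_exp_le hε]
  have h := (le_max_right _ _).trans ht
  have hq : (0 : ℝ) < q m := by exact_mod_cast q_pos m
  rw [neg_le, le_div_iff₀ hq]
  linarith

/-- The coefficient of `u` in the equation for `u = x ^ (-r) e ^ S f`. -/
def stiffness (m : ℕ) (a : Fin m → ℂ) (t : ℂ) : ℂ :=
  zeta m t * ev m a t (Polynomial.X * reducedPotential m)

/-- The weighted size of the error `u - U` and of its derivative, where `p = du/dt`. -/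
def energy (m : ℕ) (a : Fin m → ℂ) (U : Polynomial (Coeff m)) (u p : ℂ → ℂ) (t : ℂ) : ℝ :=
  ‖u t - ev m a t U‖ ^ 2 +
    Real.exp (-(((halfDeg m - 1 : ℕ) : ℝ) / q m * t.re)) * ‖p t - ev m a t (eulerD m U)‖ ^ 2

theorem energy_weight (m : ℕ) (t : ℂ) :
    Real.exp (-(((halfDeg m - 1 : ℕ) : ℝ) / q m * t.re)) = ‖xi m t‖ ^ (halfDeg m - 1) := by
  rw [norm_xi, ← Real.exp_nat_mul]
  congr 1
  ring

theorem energy_nonneg (m : ℕ) (a : Fin m → ℂ) (U : Polynomial (Coeff m)) (u p : ℂ → ℂ) (t : ℂ) :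
    0 ≤ energy m a U u p t := by unfold energy; positivity

/-- The pointwise algebra of the energy method: v = |ξ|, e and f are the sizes of the errors in u
and u', I₁ and I₂ half the derivatives of their squares. With the weight w = v^(h-1) the damping
contributes c f^2 / v. This large term absorbs the cross terms, the forcing and the derivative of
the weight, leaving only a loss of order v times the energy and v^(2N-1). -/
theorem energy_deriv_lower_bound {c C κ v w e f η I₁ I₂ s : ℝ} {N h : ℕ} (hc : 0 < c) (hC : 0 ≤ C)
    (hv : 0 < v) (hv1 : v ≤ 1) (hκ0 : 0 ≤ κ)
    (hκ : 2 * κ * v ≤ c) (hN : 1 ≤ N) (hh : 1 ≤ h) (hw : w = v ^ (h - 1)) (hs : |s| ≤ 1)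
    (h1 : -(e * f) ≤ I₁)
    (h2 : c * f ^ 2 - C * v * e * f - η * v ^ N * f ≤ v ^ h * I₂) :
    -(2 * (1 + C) ^ 2 / c * v * (e ^ 2 + w * f ^ 2)) - 2 * (1 + C) ^ 2 / c * η ^ 2 * v ^ (2 * N - 1)
      ≤ 2 * I₁ + (-(κ * s) * w * f ^ 2 + w * (2 * I₂)) := by
  have hw0 : 0 ≤ w := by rw [hw]; positivity
  have hw1 : w ≤ 1 := by rw [hw]; exact pow_le_one₀ hv.le hv1
  have hwI : v * w * I₂ = v ^ h * I₂ := by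
    rw [hw, ← pow_succ', Nat.sub_add_cancel hh]
  have e1 : v ^ (2 * N - 1) * v = (v ^ N) ^ 2 := by
    rw [← pow_succ, ← pow_mul]; congr 1; omega
  have hκs : κ * s * w * f ^ 2 ≤ κ * f ^ 2 := by
    have : s * w ≤ 1 := by
      calc s * w ≤ |s| * w := by gcongr; exact le_abs_self s
        _ ≤ 1 * 1 := by gcongr
        _ = 1 := one_mul 1
    nlinarith [mul_nonneg hκ0 (sq_nonneg f)]
  -- Multiplication by v c clears the denominators and turns the weight w into v^h, which cancels
  -- |ζ|.
  rw [← mul_le_mul_iff_of_pos_right (mul_pos hv hc)]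
  have lhs : (-(2 * (1 + C) ^ 2 / c * v * (e ^ 2 + w * f ^ 2)) -
      2 * (1 + C) ^ 2 / c * η ^ 2 * v ^ (2 * N - 1)) * (v * c) =
      -(2 * (1 + C) ^ 2 * v ^ 2 * (e ^ 2 + w * f ^ 2)) -
        2 * (1 + C) ^ 2 * (η * v ^ N) ^ 2 := by
    have : (η * v ^ N) ^ 2 = η ^ 2 * (v ^ (2 * N - 1) * v) := by rw [e1]; ring
    rw [this]
    field_simp
  have rhs : (2 * I₁ + (-(κ * s) * w * f ^ 2 + w * (2 * I₂))) * (v * c) =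
      c * (2 * v * I₁ - v * (κ * s * w * f ^ 2) + 2 * (v * w * I₂)) := by ring
  rw [lhs, rhs, hwI]
  generalize η * v ^ N = n at *
  have b1 : c * (2 * v * (-(e * f)) - v * (κ * f ^ 2) +
      2 * (c * f ^ 2 - C * v * e * f - n * f)) ≤
      c * (2 * v * I₁ - v * (κ * s * w * f ^ 2) + 2 * (v ^ h * I₂)) := by gcongr
  refine le_trans ?_ b1
  have b2 : c * f ^ 2 * (2 * κ * v) ≤ c * f ^ 2 * c := by gcongr
  have b3 : 0 ≤ 2 * (1 + C) ^ 2 * v ^ 2 * (w * f ^ 2) := by positivity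
  have b4 : 0 ≤ n ^ 2 * (2 * C + C ^ 2) := by positivity
  -- Of the available 2c^2 f^2, the cross terms, the forcing and the derivative of the weight each
  -- take at most half of c^2 f^2.
  nlinarith [sq_nonneg (c * f - 2 * (1 + C) * v * e), sq_nonneg (c * f - 2 * n)]

theorem exists_damping_eq {m : ℕ} (hm : 1 ≤ m) :
    ∃ γ : Polynomial (Coeff m), ∀ a t,
      damping m a t = zeta m t * (2 + xi m t * ev m a t γ) := by
  obtain ⟨w, hw⟩ := X_dvd_sigma_sub_one m
  obtain ⟨l, hl⟩ : ∃ l, halfDeg m = l + 1 := ⟨halfDeg m - 1, by have := halfDeg_pos hm; omega⟩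
  have hs : sigma m = 1 + Polynomial.X * w := by rw [← hw]; ring
  refine ⟨2 * w + Polynomial.X ^ l * Polynomial.C (1 - 2 * r m), fun a t => ?_⟩
  rw [damping, hs, hl]
  simp only [map_add, map_mul, map_pow, ev_X, map_one, map_ofNat]
  ring

/-- The differential inequality for `energy` along a line on which `Re S` increases. -/
theorem exists_energy_hasDerivAt {m : ℕ} (hm : 1 ≤ m) {K : Set (Fin m → ℂ)} (hK : IsCompact K)
    {c : ℝ} (hc : 0 < c) :
    ∃ A ρ₀ : ℝ, 0 ≤ A ∧ 0 ≤ ρ₀ ∧ ∀ a ∈ K, ∀ (U : Polynomial (Coeff m)) (N : ℕ) (η : ℝ),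
      1 ≤ N → ∀ (u p : ℂ → ℂ) (d t₀ : ℂ) (τ : ℝ), ‖d‖ = 1 →
      ρ₀ ≤ (t₀ + τ * d).re → c * ‖zeta m (t₀ + τ * d)‖ ≤ (d * zeta m (t₀ + τ * d)).re →
      HasDerivAt u (p (t₀ + τ * d)) (t₀ + τ * d) →
      HasDerivAt p (damping m a (t₀ + τ * d) * p (t₀ + τ * d) -
        stiffness m a (t₀ + τ * d) * u (t₀ + τ * d)) (t₀ + τ * d) →
      ‖ev m a (t₀ + τ * d) (residual m U)‖ ≤ η * ‖xi m (t₀ + τ * d)‖ ^ N →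
      ∃ V', HasDerivAt (fun s : ℝ => energy m a U u p (t₀ + s * d)) V' τ ∧
        -(A * ‖xi m (t₀ + τ * d)‖ * energy m a U u p (t₀ + τ * d)) -
          A * η ^ 2 * ‖xi m (t₀ + τ * d)‖ ^ (2 * N - 1) ≤ V' := by
  obtain ⟨γ, hγ⟩ := exists_damping_eq hm
  obtain ⟨Cγ, hCγ0, hCγ⟩ := exists_norm_ev_le m hK γ
  obtain ⟨C, hC0, hC⟩ := exists_norm_ev_le m hK (reducedPotential m)
  set κ : ℝ := ((halfDeg m - 1 : ℕ) : ℝ) / q m with hκ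
  have hκ0 : 0 ≤ κ := by positivity
  -- The first bound keeps the lower-order part of the damping below c|ζ|, half of its main part
  -- 2c|ζ|; the second makes the derivative of the weight absorbable. Neither depends on U or N.
  obtain ⟨ρ₀, hρ0, hρ⟩ := exists_norm_xi_le m
    (ε := min (c / (Cγ + 1)) (c / (2 * κ + 1))) (by positivity)
  refine ⟨2 * (1 + C) ^ 2 / c, ρ₀, by positivity, hρ0, ?_⟩
  intro a ha U N η hN u p d t₀ τ hd hre hdir hu hp hres
  set z := t₀ + τ * d with hz
  have hz0 : 0 ≤ z.re := hρ0.trans hre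
  have hv := hρ z hre
  have hv1 : ‖xi m z‖ * Cγ ≤ c := by
    have h1 := hv.trans (min_le_left _ _)
    rw [le_div_iff₀ (by positivity)] at h1
    nlinarith [norm_nonneg (xi m z)]
  have hv2 : 2 * κ * ‖xi m z‖ ≤ c := by
    have h1 := hv.trans (min_le_right _ _)
    rw [le_div_iff₀ (by positivity)] at h1
    nlinarith [norm_nonneg (xi m z)]
  have hline : HasDerivAt (fun s : ℝ => t₀ + (s : ℂ) * d) d τ := by
    have h1 : HasDerivAt (fun s : ℝ => (s : ℂ)) 1 τ := Complex.ofRealCLM.hasDerivAt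
    simpa using (h1.mul_const d).const_add t₀
  set E : ℂ := u z - ev m a z U with hE
  set F : ℂ := p z - ev m a z (eulerD m U) with hF
  have hE' : HasDerivAt (fun s : ℝ => u (t₀ + s * d) - ev m a (t₀ + s * d) U) (F * d) τ := by
    refine ((hu.sub (hasDerivAt_ev m a z U)).comp τ hline).congr_deriv ?_
    rw [hF]
  set G : ℂ := damping m a z * F - stiffness m a z * E - zeta m z * ev m a z (residual m U) with hG
  have hF' : HasDerivAt (fun s : ℝ => p (t₀ + s * d) - ev m a (t₀ + s * d) (eulerD m U))
      (G * d) τ := by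
    refine ((hp.sub (hasDerivAt_ev m a z (eulerD m U))).comp τ hline).congr_deriv ?_
    rw [ev_residual, hG, hF, hE, stiffness]
    ring
  have hre' : HasDerivAt (fun s : ℝ => (t₀ + s * d).re) d.re τ :=
    (Complex.reCLM.hasFDerivAt.comp_hasDerivAt τ hline)
  have hw' := ((hre'.const_mul κ).fun_neg).exp
  refine ⟨_, (hE'.norm_sq).fun_add (hw'.fun_mul hF'.norm_sq), ?_⟩
  have hxi := norm_xi_pos m z
  have hzx := norm_zeta_mul m z
  have hwt := energy_weight m z
  have hi1 : -(‖E‖ * ‖F‖) ≤ inner ℝ E (F * d) := by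
    have := neg_le_of_abs_le (abs_real_inner_le_norm E (F * d))
    rwa [norm_mul, hd, mul_one] at this
  have hi2 : ‖zeta m z‖ * (c * ‖F‖ ^ 2 - C * ‖xi m z‖ * ‖E‖ * ‖F‖ - η * ‖xi m z‖ ^ N * ‖F‖) ≤
      inner ℝ F (G * d) := by
    have e1 : G * d = (damping m a z * d) * F - (stiffness m a z * E * d) -
        zeta m z * ev m a z (residual m U) * d := by rw [hG]; ring
    have e2 : inner ℝ F ((damping m a z * d) * F) = (damping m a z * d).re * ‖F‖ ^ 2 := by
      rw [Complex.inner, show damping m a z * d * F * (starRingEnd ℂ) F =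
        (damping m a z * d) * ((starRingEnd ℂ) F * F) by ring, ← Complex.normSq_eq_conj_mul_self,
        Complex.re_mul_ofReal, Complex.normSq_eq_norm_sq]
    have e3 : c * ‖zeta m z‖ ≤ (damping m a z * d).re := by
      have h1 : damping m a z * d = 2 * (d * zeta m z) + d * zeta m z * (xi m z * ev m a z γ) := by
        rw [hγ]; ring
      have h2 : -(‖zeta m z‖ * c) ≤ (d * zeta m z * (xi m z * ev m a z γ)).re := by
        have h3 := neg_le_of_abs_le (Complex.abs_re_le_norm (d * zeta m z * (xi m z * ev m a z γ)))
        refine le_trans (neg_le_neg ?_) h3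
        rw [norm_mul, norm_mul, norm_mul, hd, one_mul]
        gcongr
        refine le_trans ?_ hv1
        gcongr
        exact hCγ a ha z hz0
      rw [h1, Complex.add_re, show (2 * (d * zeta m z)).re = 2 * (d * zeta m z).re by simp]
      linarith
    have e4 : inner ℝ F (stiffness m a z * E * d) ≤ ‖zeta m z‖ * (C * ‖xi m z‖ * ‖E‖ * ‖F‖) := by
      refine (real_inner_le_norm _ _).trans ?_
      rw [norm_mul, norm_mul, hd, mul_one, stiffness, norm_mul, map_mul, norm_mul, ev_X]
      calc _ = ‖zeta m z‖ * (‖ev m a z (reducedPotential m)‖ * ‖xi m z‖ * ‖E‖ * ‖F‖) := by ring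
        _ ≤ _ := by gcongr; exact hC a ha z hz0
    have e5 : inner ℝ F (zeta m z * ev m a z (residual m U) * d) ≤
        ‖zeta m z‖ * (η * ‖xi m z‖ ^ N * ‖F‖) := by
      refine (real_inner_le_norm _ _).trans ?_
      rw [norm_mul, norm_mul, hd, mul_one]
      calc _ = ‖zeta m z‖ * (‖ev m a z (residual m U)‖ * ‖F‖) := by ring
        _ ≤ _ := by gcongr
    rw [e1, inner_sub_right, inner_sub_right, e2]
    have e6 := mul_le_mul_of_nonneg_right e3 (sq_nonneg ‖F‖)
    linarith
  have hi3 : c * ‖F‖ ^ 2 - C * ‖xi m z‖ * ‖E‖ * ‖F‖ - η * ‖xi m z‖ ^ N * ‖F‖ ≤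
      ‖xi m z‖ ^ halfDeg m * inner ℝ F (G * d) := by
    have := mul_le_mul_of_nonneg_left hi2 (pow_nonneg hxi.le (halfDeg m))
    rw [← mul_assoc, mul_comm (_ ^ _) ‖zeta m z‖, hzx, one_mul] at this
    exact this
  have hmain := energy_deriv_lower_bound (s := d.re) hc hC0 hxi
    (norm_xi_le_one m hz0) hκ0 hv2 hN (halfDeg_pos hm) hwt
    (by rw [← hd]; exact Complex.abs_re_le_norm d) hi1 hi3
  refine hmain.trans_eq ?_
  simp only [← hz, ← hE, ← hF, ← hκ]
  ring

/-! ### Exact solutions in reduced form -/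

/-- The pair `u`, `p` satisfies at `z` the equation for `u = x ^ (-r) e ^ S f` and `p = du/dt`. -/
def ReducedAt (m : ℕ) (a : Fin m → ℂ) (u p : ℂ → ℂ) (z : ℂ) : Prop :=
  HasDerivAt u (p z) z ∧
    HasDerivAt p (damping m a z * p z - stiffness m a z * u z) z

/-- The logarithmic derivative of `x ^ r e ^ (-S)` with respect to `t = ln x`. -/
def logDeriv (m : ℕ) (a : Fin m → ℂ) (t : ℂ) : ℂ :=
  MvPolynomial.eval a (r m) - zeta m t * ev m a t (sigma m)

/-- The quotient `f / (x ^ r e ^ (-S))`. -/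
def reduced (m : ℕ) (a : Fin m → ℂ) (f : ℂ → ℂ) (t : ℂ) : ℂ := f t / leading m a t

/-- The derivative of `f / (x ^ r e ^ (-S))`, where `g = df/dt`. -/
def reducedDeriv (m : ℕ) (a : Fin m → ℂ) (f g : ℂ → ℂ) (t : ℂ) : ℂ :=
  g t / leading m a t - logDeriv m a t * (f t / leading m a t)

theorem hasDerivAt_logDeriv {m : ℕ} (a : Fin m → ℂ) (t : ℂ) :
    HasDerivAt (logDeriv m a) (-((m : ℂ) / 2 * zeta m t * ev m a t (sigma m) +
      zeta m t * ev m a t (eulerD m (sigma m)))) t :=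
  (((hasDerivAt_zeta m t).fun_mul (hasDerivAt_ev m a t (sigma m))).const_sub _)

theorem hasDerivAt_reduced {m : ℕ} (hm : 1 ≤ m) (a : Fin m → ℂ) {f g : ℂ → ℂ} {z : ℂ}
    (hf : HasDerivAt f (g z) z) :
    HasDerivAt (reduced m a f) (reducedDeriv m a f g z) z := by
  have h0 := leading_ne_zero m a z
  refine (hf.fun_div (hasDerivAt_leading hm a z) h0).congr_deriv ?_
  rw [reducedDeriv, logDeriv]
  field_simp

theorem reducedAt_of_solution {m : ℕ} (hm : 1 ≤ m) (a : Fin m → ℂ) {f g : ℂ → ℂ} {z : ℂ}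
    (hf : HasDerivAt f (g z) z)
    (hg : HasDerivAt g (g z + P m (Complex.exp z) a * f z) z) :
    ReducedAt m a (reduced m a f) (reducedDeriv m a f g) z := by
  refine ⟨hasDerivAt_reduced hm a hf, ?_⟩
  have h0 := leading_ne_zero m a z
  have h := (hg.fun_div (hasDerivAt_leading hm a z) h0).fun_sub
    ((hasDerivAt_logDeriv a z).fun_mul (hasDerivAt_reduced hm a hf))
  refine h.congr_deriv ?_
  rw [damping_eq, stiffness, ← ev_potential hm, ev_potential_expand, ← logDeriv]
  have e : zeta m z * ev m a z (sigma m) = MvPolynomial.eval a (r m) - logDeriv m a z := by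
    rw [logDeriv]; ring
  rw [mul_assoc ((m : ℂ) / 2), e, reducedDeriv, reduced]
  field_simp
  ring

/-! ### Backward energy estimates on the axis and on bounded segments -/

/-- The constant does not depend on the far end T, because |ξ| = e^(-t/q) is integrable at infinity.
This allows T to tend to infinity. -/
theorem energy_along_ray {m : ℕ} (hm : 1 ≤ m) {K : Set (Fin m → ℂ)} (hK : IsCompact K) :
    ∃ A ρ₀ : ℝ, 0 ≤ A ∧ 0 ≤ ρ₀ ∧ ∀ a ∈ K, ∀ (U : Polynomial (Coeff m)) (N : ℕ) (η : ℝ),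
      1 ≤ N → ∀ (u p : ℂ → ℂ) (t T : ℝ), ρ₀ ≤ t → t ≤ T →
      (∀ s ∈ Set.Icc t T, ReducedAt m a u p (s : ℂ)) →
      (∀ s ∈ Set.Icc t T, ‖ev m a (s : ℂ) (residual m U)‖ ≤ η * ‖xi m (s : ℂ)‖ ^ N) →
      energy m a U u p t ≤ A * (energy m a U u p T + η ^ 2 * ‖xi m (t : ℂ)‖ ^ (2 * N - 1)) := by
  obtain ⟨A, ρ₀, hA, hρ, h⟩ := exists_energy_hasDerivAt hm hK one_pos
  have hq : (0 : ℝ) < q m := by exact_mod_cast q_pos m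
  refine ⟨Real.exp (A * q m) * (1 + A * q m), ρ₀, by positivity, hρ, ?_⟩
  intro a ha U N η hN u p t T ht htT hsol hres
  have key : ∀ s ∈ Set.Icc t T, ∃ V',
      HasDerivAt (fun s : ℝ => energy m a U u p (s : ℂ)) V' s ∧
      -(A * ‖xi m (s : ℂ)‖ * energy m a U u p (s : ℂ)) -
          A * η ^ 2 * ‖xi m (s : ℂ)‖ ^ (2 * N - 1) ≤ V' := by
    intro s hs
    have hz : (0 : ℂ) + (s : ℂ) * 1 = s := by simp
    have := h a ha U N η hN u p 1 0 s (by simp) (by rw [hz]; simpa using ht.trans hs.1)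
      (by
        rw [hz, one_mul, one_mul, zeta, show (m : ℂ) / 2 * (s : ℂ) = ((m / 2 * s : ℝ) : ℂ) by
          push_cast; rfl, ← Complex.ofReal_exp, Complex.norm_real, Complex.ofReal_re,
          Real.norm_of_nonneg (Real.exp_pos _).le])
      (by rw [hz]; exact (hsol s hs).1) (by rw [hz]; exact (hsol s hs).2)
      (by rw [hz]; exact hres s hs)
    simpa only [zero_add, mul_one] using this
  choose! V' hV' hineq using key
  have hv : ∀ s : ℝ, ‖xi m (s : ℂ)‖ = Real.exp (-(s / q m)) := fun s => by rw [norm_xi]; simp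
  have hvd : ∀ (k : ℕ) (s : ℝ), HasDerivAt (fun s : ℝ => Real.exp (-(s / q m)) ^ k)
      (-(k / q m) * Real.exp (-(s / q m)) ^ k) s := by
    intro k s
    have h1 := (((hasDerivAt_id s).div_const (q m : ℝ)).fun_neg.const_mul (k : ℝ)).exp
    simp only [id, Real.exp_nat_mul] at h1
    refine h1.congr_deriv ?_
    ring
  have hN0 : (0 : ℝ) < (2 * N - 1 : ℕ) := by exact_mod_cast (by omega : 0 < 2 * N - 1)
  have hN1 : (1 : ℝ) ≤ (2 * N - 1 : ℕ) := by exact_mod_cast (by omega : 1 ≤ 2 * N - 1)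
  -- K and H are the explicit antiderivatives of A|ξ| and A η^2 |ξ|^(2N-1). The former stays between
  -- -Aq and 0.
  have hg := backward_gronwall (V := fun s : ℝ => energy m a U u p (s : ℂ)) (V' := V')
    (K := fun s => -(A * q m) * Real.exp (-(s / q m)) ^ 1)
    (K' := fun s => A * Real.exp (-(s / q m)))
    (H := fun s => -(A * η ^ 2 * q m / (2 * N - 1 : ℕ)) * Real.exp (-(s / q m)) ^ (2 * N - 1))
    (H' := fun s => A * η ^ 2 * Real.exp (-(s / q m)) ^ (2 * N - 1)) htT hV'
    (fun s _ => by
      refine ((hvd 1 s).const_mul _).congr_deriv ?_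
      push_cast
      field_simp)
    (fun s _ => by
      refine ((hvd (2 * N - 1) s).const_mul _).congr_deriv ?_
      field_simp)
    (fun s _ => by positivity) (fun s _ => by positivity)
    (fun s hs => by simpa only [hv] using hineq s hs)
  simp only [pow_one] at hg
  have ht0 : 0 ≤ t := hρ.trans ht
  have hv1 : Real.exp (-(t / q m)) ≤ 1 := by
    rw [Real.exp_le_one_iff]
    have : 0 ≤ t / q m := by positivity
    linarith
  have hb : A * η ^ 2 * q m / (2 * N - 1 : ℕ) ≤ A * η ^ 2 * q m := div_le_self (by positivity) hN1
  have hET := energy_nonneg m a U u p T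
  have hEt := energy_nonneg m a U u p t
  rw [hv]
  set v := Real.exp (-(t / q m)) with hvdef
  set w := Real.exp (-(T / q m)) with hwdef
  have hw0 : 0 < w := Real.exp_pos _
  have hv0 : 0 < v := Real.exp_pos _
  have e1 : energy m a U u p t =
      energy m a U u p t * Real.exp (-(A * q m) * v) * Real.exp (A * q m * v) := by
    rw [mul_assoc, ← Real.exp_add]; simp
  calc energy m a U u p t
      ≤ Real.exp (-(A * q m) * w) * (energy m a U u p T +
        (-(A * η ^ 2 * q m / (2 * N - 1 : ℕ)) * w ^ (2 * N - 1) -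
          -(A * η ^ 2 * q m / (2 * N - 1 : ℕ)) * v ^ (2 * N - 1))) * Real.exp (A * q m * v) := by
        rw [e1]; gcongr
    _ ≤ 1 * (energy m a U u p T + A * η ^ 2 * q m * v ^ (2 * N - 1)) * Real.exp (A * q m * 1) := by
        have h1 : Real.exp (-(A * q m) * w) ≤ 1 := by
          rw [Real.exp_le_one_iff]
          have : 0 ≤ A * q m * w := by positivity
          linarith
        have h2 : 0 ≤ A * η ^ 2 * q m / (2 * N - 1 : ℕ) * w ^ (2 * N - 1) := by positivity
        have h3 : A * η ^ 2 * q m / (2 * N - 1 : ℕ) * v ^ (2 * N - 1) ≤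
            A * η ^ 2 * q m * v ^ (2 * N - 1) := by gcongr
        refine mul_le_mul ?_ ?_ (Real.exp_pos _).le (by positivity)
        · refine le_trans (mul_le_mul_of_nonneg_left (?_ : _ ≤ energy m a U u p T +
            A * η ^ 2 * q m * v ^ (2 * N - 1)) (Real.exp_pos _).le) (by gcongr)
          linarith
        · gcongr
    _ ≤ Real.exp (A * q m) * (1 + A * q m) *
        (energy m a U u p T + η ^ 2 * v ^ (2 * N - 1)) := by
        rw [one_mul, mul_one, mul_comm _ (Real.exp _), mul_assoc (Real.exp _)]
        gcongr
        have : 0 ≤ A * q m * energy m a U u p T := by positivity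
        have : 0 ≤ η ^ 2 * v ^ (2 * N - 1) := by positivity
        nlinarith

/-- Here d may point to the left; the margin B keeps the segment in Re ≥ ρ₀, and |ξ| ≤ 1 with l ≤ B
bounds the loss by e^(AB). -/
theorem energy_along_segment {m : ℕ} (hm : 1 ≤ m) {K : Set (Fin m → ℂ)} (hK : IsCompact K)
    {c B : ℝ} (hc : 0 < c) (hB : 0 ≤ B) {N : ℕ} (hN : 1 ≤ N) :
    ∃ A ρ₀ : ℝ, 0 ≤ A ∧ 0 ≤ ρ₀ ∧ ∀ a ∈ K, ∀ (U : Polynomial (Coeff m)) (η : ℝ)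
      (u p : ℂ → ℂ) (t d : ℂ) (l : ℝ), ‖d‖ = 1 → ρ₀ + B ≤ t.re → 0 ≤ l → l ≤ B →
      (∀ s ∈ Set.Icc 0 l, c * ‖zeta m (t + s * d)‖ ≤ (d * zeta m (t + s * d)).re) →
      (∀ s ∈ Set.Icc 0 l, ReducedAt m a u p (t + s * d)) →
      (∀ s ∈ Set.Icc 0 l, ‖ev m a (t + s * d) (residual m U)‖ ≤ η * ‖xi m (t + s * d)‖ ^ N) →
      energy m a U u p t ≤
        A * (energy m a U u p (t + l * d) + η ^ 2 * ‖xi m t‖ ^ (2 * N - 1)) := by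
  obtain ⟨A, ρ₀, hA, hρ, h⟩ := exists_energy_hasDerivAt hm hK hc
  have hq : (0 : ℝ) < q m := by exact_mod_cast q_pos m
  -- The largest factor by which |ξ| can grow over a displacement of length B.
  set b := Real.exp (B / q m) with hb
  have hb0 : 0 < b := Real.exp_pos _
  refine ⟨Real.exp (A * B) * (1 + A * B * b ^ (2 * N - 1)), ρ₀, by positivity, hρ, ?_⟩
  intro a ha U η u p t d l hd ht hl hlB hdir hsol hres
  have hre : ∀ s ∈ Set.Icc 0 l, t.re - B ≤ (t + s * d).re := by
    intro s hs
    rw [Complex.add_re, Complex.re_ofReal_mul]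
    have h1 : |d.re| ≤ 1 := by rw [← hd]; exact Complex.abs_re_le_norm d
    have h2 := neg_le_of_abs_le h1
    have h3 := hs.1
    have h4 := hs.2
    nlinarith
  have key : ∀ s ∈ Set.Icc 0 l, ∃ V',
      HasDerivAt (fun s : ℝ => energy m a U u p (t + s * d)) V' s ∧
      -(A * ‖xi m (t + s * d)‖ * energy m a U u p (t + s * d)) -
          A * η ^ 2 * ‖xi m (t + s * d)‖ ^ (2 * N - 1) ≤ V' := fun s hs =>
    h a ha U N η hN u p d t s hd (by linarith [hre s hs]) (hdir s hs) (hsol s hs).1 (hsol s hs).2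
      (hres s hs)
  choose! V' hV' hineq using key
  have hg := backward_gronwall (V := fun s : ℝ => energy m a U u p (t + s * d)) (V' := V')
    (K := fun s => A * s) (K' := fun _ => A)
    (H := fun s => A * η ^ 2 * (b * ‖xi m t‖) ^ (2 * N - 1) * s)
    (H' := fun _ => A * η ^ 2 * (b * ‖xi m t‖) ^ (2 * N - 1)) hl hV'
    (fun s _ => by simpa using (hasDerivAt_id s).const_mul A)
    (fun s _ => by
      simpa using (hasDerivAt_id s).const_mul (A * η ^ 2 * (b * ‖xi m t‖) ^ (2 * N - 1)))
    (fun s _ => hA) (fun s _ => by positivity)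
    (fun s hs => by
      refine le_trans ?_ (hineq s hs)
      have h1 : ‖xi m (t + s * d)‖ ≤ 1 := norm_xi_le_one m (by linarith [hre s hs])
      have h2 : ‖xi m (t + s * d)‖ ≤ b * ‖xi m t‖ := by
        rw [norm_xi, norm_xi, hb, ← Real.exp_add, Real.exp_le_exp]
        have := hre s hs
        rw [← sub_nonneg]
        have e : B / q m + -(t.re / q m) - -((t + s * d).re / q m) =
          ((t + s * d).re - (t.re - B)) / q m := by ring
        rw [e]
        exact div_nonneg (by linarith) hq.le
      have h3 := energy_nonneg m a U u p (t + s * d)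
      have h4 : A * ‖xi m (t + s * d)‖ * energy m a U u p (t + s * d) ≤
          A * 1 * energy m a U u p (t + s * d) := by gcongr
      have h5 : A * η ^ 2 * ‖xi m (t + s * d)‖ ^ (2 * N - 1) ≤
          A * η ^ 2 * (b * ‖xi m t‖) ^ (2 * N - 1) := by gcongr
      linarith)
  simp only [Complex.ofReal_zero, zero_mul, add_zero, mul_zero, Real.exp_zero, mul_one,
    sub_zero] at hg
  have hEl := energy_nonneg m a U u p (t + l * d)
  have hxi := norm_xi_pos m t
  calc energy m a U u p t
      ≤ Real.exp (A * l) * (energy m a U u p (t + l * d) +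
        A * η ^ 2 * (b * ‖xi m t‖) ^ (2 * N - 1) * l) := hg
    _ ≤ Real.exp (A * B) * (energy m a U u p (t + l * d) +
        A * η ^ 2 * (b * ‖xi m t‖) ^ (2 * N - 1) * B) := by gcongr
    _ ≤ _ := by
        rw [mul_assoc (Real.exp _), mul_pow]
        gcongr
        have h1 : 0 ≤ A * B * b ^ (2 * N - 1) * energy m a U u p (t + l * d) := by positivity
        have h2 : 0 ≤ η ^ 2 * ‖xi m t‖ ^ (2 * N - 1) := by positivity
        nlinarith

/-! ### Construction of the recessive solution -/

@[fun_prop]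
theorem differentiable_mvPolynomial_eval {m : ℕ} (p : MvPolynomial (Fin m) ℂ) :
    Differentiable ℂ fun a : Fin m → ℂ => MvPolynomial.eval a p := fun a =>
  (AnalyticOnNhd.eval_mvPolynomial p a (Set.mem_univ a)).differentiableAt

theorem differentiable_leading (m : ℕ) (t : ℂ) : Differentiable ℂ fun a => leading m a t := by
  unfold leading xpow S
  fun_prop

theorem differentiable_logDeriv (m : ℕ) (t : ℂ) : Differentiable ℂ fun a => logDeriv m a t := by
  unfold logDeriv sigma
  simp only [map_add, map_one, map_sum, map_mul, map_pow, ev_C, ev_X]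
  fun_prop

/-- Linear combinations of the fundamental solutions. -/
def comb (m : ℕ) (A B : ℂ) (a : Fin m → ℂ) (t : ℂ) : ℂ :=
  A * entireSol m 1 0 t a + B * entireSol m 0 1 t a

/-- The derivative of `comb` with respect to `t`. -/
def combDeriv (m : ℕ) (A B : ℂ) (a : Fin m → ℂ) (t : ℂ) : ℂ :=
  A * entireSolDeriv m 1 0 t a + B * entireSolDeriv m 0 1 t a

theorem hasDerivAt_comb (m : ℕ) (A B : ℂ) (a : Fin m → ℂ) (t : ℂ) :
    HasDerivAt (comb m A B a) (combDeriv m A B a t) t :=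
  ((hasDerivAt_entireSol m 1 0 a t).const_mul A).fun_add
    ((hasDerivAt_entireSol m 0 1 a t).const_mul B)

theorem hasDerivAt_combDeriv (m : ℕ) (A B : ℂ) (a : Fin m → ℂ) (t : ℂ) :
    HasDerivAt (combDeriv m A B a)
      (combDeriv m A B a t + P m (Complex.exp t) a * comb m A B a t) t := by
  refine (((hasDerivAt_entireSolDeriv m 1 0 a t).const_mul A).fun_add
    ((hasDerivAt_entireSolDeriv m 0 1 a t).const_mul B)).congr_deriv ?_
  rw [combDeriv, comb]
  ring

/-- The function `f / (x ^ r e ^ (-S))` for a linear combination `f` of fundamental solutions. -/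
def combReduced (m : ℕ) (A B : ℂ) (a : Fin m → ℂ) : ℂ → ℂ := reduced m a (comb m A B a)

/-- The derivative of `combReduced` with respect to `t`. -/
def combReducedDeriv (m : ℕ) (A B : ℂ) (a : Fin m → ℂ) : ℂ → ℂ :=
  reducedDeriv m a (comb m A B a) (combDeriv m A B a)

theorem reducedAt_comb {m : ℕ} (hm : 1 ≤ m) (A B : ℂ) (a : Fin m → ℂ) (t : ℂ) :
    ReducedAt m a (combReduced m A B a) (combReducedDeriv m A B a) t :=
  reducedAt_of_solution hm a (hasDerivAt_comb m A B a t) (hasDerivAt_combDeriv m A B a t)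

theorem combReduced_sub (m : ℕ) (A B A' B' : ℂ) (a : Fin m → ℂ) (t : ℂ) :
    combReduced m (A - A') (B - B') a t = combReduced m A B a t - combReduced m A' B' a t := by
  simp only [combReduced, reduced, comb]
  ring

theorem combReducedDeriv_sub (m : ℕ) (A B A' B' : ℂ) (a : Fin m → ℂ) (t : ℂ) :
    combReducedDeriv m (A - A') (B - B') a t =
      combReducedDeriv m A B a t - combReducedDeriv m A' B' a t := by
  simp only [combReducedDeriv, reducedDeriv, comb, combDeriv]
  ring

/-- The first coefficient of the combination with value `1` and derivative `0` of
`f / (x ^ r e ^ (-S))` at `T`. -/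
def startA (m : ℕ) (T : ℂ) (a : Fin m → ℂ) : ℂ :=
  Complex.exp (-T) * leading m a T *
    (entireSolDeriv m 0 1 T a - logDeriv m a T * entireSol m 0 1 T a)

/-- The second coefficient of the combination with value `1` and derivative `0` of
`f / (x ^ r e ^ (-S))` at `T`. -/
def startB (m : ℕ) (T : ℂ) (a : Fin m → ℂ) : ℂ :=
  Complex.exp (-T) * leading m a T *
    (logDeriv m a T * entireSol m 1 0 T a - entireSolDeriv m 1 0 T a)

theorem comb_eq (m : ℕ) (A B : ℂ) (a : Fin m → ℂ) (t : ℂ) :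
    comb m A B a t = leading m a t * combReduced m A B a t := by
  rw [combReduced, reduced, mul_div_cancel₀ _ (leading_ne_zero m a t)]

theorem combDeriv_eq (m : ℕ) (A B : ℂ) (a : Fin m → ℂ) (t : ℂ) :
    combDeriv m A B a t = leading m a t *
      (logDeriv m a t * combReduced m A B a t + combReducedDeriv m A B a t) := by
  have := leading_ne_zero m a t
  rw [combReducedDeriv, reducedDeriv, combReduced, reduced]
  field_simp
  ring

theorem exp_neg_mul_exp (t : ℂ) : Complex.exp (-t) * Complex.exp t = 1 := by
  rw [← Complex.exp_add]; simp

theorem comb_start (m : ℕ) (T : ℂ) (a : Fin m → ℂ) :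
    comb m (startA m T a) (startB m T a) a T = leading m a T := by
  rw [comb, startA, startB]
  linear_combination Complex.exp (-T) * leading m a T * wronskian_entireSol m a T +
    leading m a T * exp_neg_mul_exp T

theorem combDeriv_start (m : ℕ) (T : ℂ) (a : Fin m → ℂ) :
    combDeriv m (startA m T a) (startB m T a) a T = leading m a T * logDeriv m a T := by
  rw [combDeriv, startA, startB]
  linear_combination Complex.exp (-T) * leading m a T * logDeriv m a T *
    wronskian_entireSol m a T + leading m a T * logDeriv m a T * exp_neg_mul_exp T

theorem combReduced_start (m : ℕ) (T : ℂ) (a : Fin m → ℂ) :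
    combReduced m (startA m T a) (startB m T a) a T = 1 := by
  rw [combReduced, reduced, comb_start, div_self (leading_ne_zero m a T)]

theorem combReducedDeriv_start (m : ℕ) (T : ℂ) (a : Fin m → ℂ) :
    combReducedDeriv m (startA m T a) (startB m T a) a T = 0 := by
  have := leading_ne_zero m a T
  rw [combReducedDeriv, reducedDeriv, comb_start, combDeriv_start]
  field_simp
  ring

/-- Cramer's rule: the Wronskian of the basis is e^t, so the coefficients are recovered from the
reduced value and derivative without any denominator depending on a. -/
theorem coeff_eq (m : ℕ) (A B : ℂ) (a : Fin m → ℂ) (t : ℂ) :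
    A = Complex.exp (-t) * leading m a t *
        ((entireSolDeriv m 0 1 t a - logDeriv m a t * entireSol m 0 1 t a) *
          combReduced m A B a t - entireSol m 0 1 t a * combReducedDeriv m A B a t) ∧
    B = Complex.exp (-t) * leading m a t *
        ((logDeriv m a t * entireSol m 1 0 t a - entireSolDeriv m 1 0 t a) *
          combReduced m A B a t + entireSol m 1 0 t a * combReducedDeriv m A B a t) := by
  have h1 := comb_eq m A B a t
  have h2 := combDeriv_eq m A B a t
  have h3 := wronskian_entireSol m a t
  have h4 := exp_neg_mul_exp t
  have e1 : Complex.exp (-t) * (comb m A B a t * entireSolDeriv m 0 1 t a -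
      combDeriv m A B a t * entireSol m 0 1 t a) = A := by
    rw [comb, combDeriv]
    linear_combination A * Complex.exp (-t) * h3 + A * h4
  have e2 : Complex.exp (-t) * (combDeriv m A B a t * entireSol m 1 0 t a -
      comb m A B a t * entireSolDeriv m 1 0 t a) = B := by
    rw [comb, combDeriv]
    linear_combination B * Complex.exp (-t) * h3 + B * h4
  constructor
  · rw [h1, h2] at e1
    rw [← sub_eq_zero]
    linear_combination -e1
  · rw [h1, h2] at e2
    rw [← sub_eq_zero]
    linear_combination -e2

theorem energy_lower (m : ℕ) (a : Fin m → ℂ) (u p : ℂ → ℂ) (t : ℂ) :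
    ‖u t‖ ^ 2 ≤ energy m a 0 u p t ∧
      ‖xi m t‖ ^ (halfDeg m - 1) * ‖p t‖ ^ 2 ≤ energy m a 0 u p t := by
  have h0 : eulerD m 0 = 0 := by simp [eulerD]
  rw [energy, energy_weight, h0, map_zero, sub_zero, sub_zero]
  have h1 : 0 ≤ ‖xi m t‖ ^ (halfDeg m - 1) * ‖p t‖ ^ 2 := by positivity
  have h2 : 0 ≤ ‖u t‖ ^ 2 := by positivity
  constructor <;> linarith

theorem residual_zero (m : ℕ) : residual m 0 = 0 := by
  simp [residual, eulerD]

/-- The values of the coefficients of a combination are controlled by its energy at a point. -/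
theorem exists_coeff_le (m : ℕ) {K : Set (Fin m → ℂ)} (hK : IsCompact K) (t : ℂ) :
    ∃ C, 0 ≤ C ∧ ∀ a ∈ K, ∀ A B : ℂ,
      ‖A‖ ^ 2 ≤ C * energy m a 0 (combReduced m A B a) (combReducedDeriv m A B a) t ∧
      ‖B‖ ^ 2 ≤ C * energy m a 0 (combReduced m A B a) (combReducedDeriv m A B a) t := by
  have hy : ∀ c₀ c₁ : ℂ, Differentiable ℂ fun a => entireSol m c₀ c₁ t a := fun c₀ c₁ =>
    (differentiable_entireSol m c₀ c₁).comp ((differentiable_const t).prodMk differentiable_id)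
  have hz : ∀ c₀ c₁ : ℂ, Differentiable ℂ fun a => entireSolDeriv m c₀ c₁ t a := fun c₀ c₁ =>
    (differentiable_entireSolDeriv m c₀ c₁).comp
      ((differentiable_const t).prodMk differentiable_id)
  have hL := differentiable_leading m t
  have hl := differentiable_logDeriv m t
  have bd : ∀ g : (Fin m → ℂ) → ℂ, Differentiable ℂ g → ∃ C, 0 ≤ C ∧ ∀ a ∈ K, ‖g a‖ ≤ C := by
    intro g hg
    obtain ⟨C, hC⟩ := hK.exists_bound_of_continuousOn hg.continuous.continuousOn
    exact ⟨|C|, abs_nonneg _, fun a ha => (hC a ha).trans (le_abs_self C)⟩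
  obtain ⟨C₁, h1, H1⟩ := bd (fun a => Complex.exp (-t) * leading m a t *
    (entireSolDeriv m 0 1 t a - logDeriv m a t * entireSol m 0 1 t a))
    ((hL.const_mul _).fun_mul ((hz 0 1).fun_sub (hl.fun_mul (hy 0 1))))
  obtain ⟨C₂, h2, H2⟩ := bd (fun a => Complex.exp (-t) * leading m a t * entireSol m 0 1 t a)
    ((hL.const_mul _).fun_mul (hy 0 1))
  obtain ⟨C₃, h3, H3⟩ := bd (fun a => Complex.exp (-t) * leading m a t *
    (logDeriv m a t * entireSol m 1 0 t a - entireSolDeriv m 1 0 t a))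
    ((hL.const_mul _).fun_mul ((hl.fun_mul (hy 1 0)).fun_sub (hz 1 0)))
  obtain ⟨C₄, h4, H4⟩ := bd (fun a => Complex.exp (-t) * leading m a t * entireSol m 1 0 t a)
    ((hL.const_mul _).fun_mul (hy 1 0))
  have hx := norm_xi_pos m t
  set x := ‖xi m t‖ ^ (halfDeg m - 1) with hxdef
  have hx0 : 0 < x := by positivity
  set D := C₁ + C₂ + C₃ + C₄ with hD
  have gen : ∀ (z w U Q : ℂ) (E : ℝ), ‖z‖ ≤ D → ‖w‖ ≤ D → ‖U‖ ^ 2 ≤ E → x * ‖Q‖ ^ 2 ≤ E →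
      (‖z‖ * ‖U‖ + ‖w‖ * ‖Q‖) ^ 2 ≤ 2 * D ^ 2 * (1 + 1 / x) * E := by
    intro z w U Q E hz hw hU hQ
    have e1 : ‖Q‖ ^ 2 ≤ 1 / x * E := by
      rw [one_div, ← div_eq_inv_mul, le_div_iff₀ hx0]; linarith
    have e2 : (‖z‖ * ‖U‖ + ‖w‖ * ‖Q‖) ^ 2 ≤ (D * ‖U‖ + D * ‖Q‖) ^ 2 := by gcongr
    refine e2.trans ?_
    nlinarith [sq_nonneg (‖U‖ - ‖Q‖), sq_nonneg D, mul_le_mul_of_nonneg_left e1 (sq_nonneg D),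
      mul_le_mul_of_nonneg_left hU (sq_nonneg D), mul_nonneg (sq_nonneg D) (sq_nonneg (‖U‖ - ‖Q‖))]
  refine ⟨2 * D ^ 2 * (1 + 1 / x), by positivity, fun a ha A B => ?_⟩
  obtain ⟨e1, e2⟩ := coeff_eq m A B a t
  obtain ⟨l1, l2⟩ := energy_lower m a (combReduced m A B a) (combReducedDeriv m A B a) t
  constructor
  · refine le_trans ?_ (gen _ _ _ _ _ ((H1 a ha).trans (by linarith)) ((H2 a ha).trans (by linarith))
      l1 l2)
    gcongr
    rw [← norm_mul, ← norm_mul]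
    refine le_trans (le_of_eq ?_) (norm_sub_le _ _)
    conv_lhs => rw [e1]
    congr 1
    ring
  · refine le_trans ?_ (gen _ _ _ _ _ ((H3 a ha).trans (by linarith)) ((H4 a ha).trans (by linarith))
      l1 l2)
    gcongr
    rw [← norm_mul, ← norm_mul]
    refine le_trans (le_of_eq ?_) (norm_add_le _ _)
    conv_lhs => rw [e2]
    congr 1
    ring

/-- Bounds for the solutions which agree with `x ^ r e ^ (-S)` at a remote point `n` of the positive
real axis, and for the differences of their coefficients. -/
theorem exists_start_bounds {m : ℕ} (hm : 1 ≤ m) {K : Set (Fin m → ℂ)} (hK : IsCompact K) :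
    ∃ (n₀ : ℕ) (C : ℝ), 0 ≤ C ∧ ∀ a ∈ K,
      (∀ (t : ℝ) (n : ℕ), (n₀ : ℝ) ≤ t → t ≤ n →
        energy m a 1 (combReduced m (startA m n a) (startB m n a) a)
          (combReducedDeriv m (startA m n a) (startB m n a) a) t ≤ C * ‖xi m (t : ℂ)‖) ∧
      ∀ n k : ℕ, n₀ ≤ n → n ≤ k →
        ‖startA m k a - startA m n a‖ ^ 2 ≤ C * ‖xi m (n : ℂ)‖ ∧
        ‖startB m k a - startB m n a‖ ^ 2 ≤ C * ‖xi m (n : ℂ)‖ := by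
  obtain ⟨A, ρ₀, hA, hρ, hray⟩ := energy_along_ray hm hK
  obtain ⟨η, hη0, hη⟩ := exists_norm_ev_le m hK (reducedPotential m)
  obtain ⟨n₀, hn₀⟩ := exists_nat_ge ρ₀
  obtain ⟨D, hD0, hD⟩ := exists_coeff_le m hK (n₀ : ℂ)
  have hD1 : eulerD m 1 = 0 := by simp [eulerD]
  have hres : residual m 1 = Polynomial.X * reducedPotential m := by
    have h0 : eulerD m 0 = 0 := by simp [eulerD]
    rw [residual, hD1, h0]
    ring
  have hfirst : ∀ a ∈ K, ∀ (t : ℝ) (n : ℕ), (n₀ : ℝ) ≤ t → t ≤ n →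
      energy m a 1 (combReduced m (startA m n a) (startB m n a) a)
        (combReducedDeriv m (startA m n a) (startB m n a) a) t ≤ A * η ^ 2 * ‖xi m (t : ℂ)‖ := by
    intro a ha t n ht htn
    have h := hray a ha 1 1 η le_rfl (combReduced m (startA m n a) (startB m n a) a)
      (combReducedDeriv m (startA m n a) (startB m n a) a) t n (hn₀.trans ht) htn
      (fun s _ => reducedAt_comb hm _ _ a s) (fun s hs => by
        rw [hres, map_mul, norm_mul, ev_X, pow_one, mul_comm]
        gcongr
        refine hη a ha _ ?_
        rw [Complex.ofReal_re]
        linarith [hs.1])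
    -- The starting values 1 and 0 agree exactly with the truncation U = 1 at t = n, so only the
    -- forcing term contributes.
    have h0 : energy m a 1 (combReduced m (startA m n a) (startB m n a) a)
        (combReducedDeriv m (startA m n a) (startB m n a) a) (n : ℂ) = 0 := by
      rw [energy, combReduced_start, combReducedDeriv_start, hD1]
      simp
    rw [Complex.ofReal_natCast, h0, zero_add, show 2 * 1 - 1 = 1 from rfl, pow_one] at h
    linarith
  refine ⟨n₀, max (A * η ^ 2) (D * (A * (A * η ^ 2))), by positivity, fun a ha => ⟨?_, ?_⟩⟩
  · intro t n ht htn
    refine (hfirst a ha t n ht htn).trans ?_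
    gcongr
    exact le_max_left _ _
  · intro n k hn hnk
    have hn' : (n₀ : ℝ) ≤ n := by exact_mod_cast hn
    have h1 := hfirst a ha n k hn' (by exact_mod_cast hnk)
    have h2 := hray a ha 0 1 0 le_rfl
      (combReduced m (startA m k a - startA m n a) (startB m k a - startB m n a) a)
      (combReducedDeriv m (startA m k a - startA m n a) (startB m k a - startB m n a) a)
      n₀ n hn₀ hn' (fun s _ => reducedAt_comb hm _ _ a s)
      (fun s _ => by simp [residual_zero])
    -- At t = n the n-th solution equals 1 with derivative 0, so the energy of the difference is the
    -- error of the k-th solution against U = 1. The homogeneous estimate carries it down to the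
    -- fixed point n₀, where it controls the coefficients.
    have e : energy m a 0
        (combReduced m (startA m k a - startA m n a) (startB m k a - startB m n a) a)
        (combReducedDeriv m (startA m k a - startA m n a) (startB m k a - startB m n a) a) (n : ℂ) =
        energy m a 1 (combReduced m (startA m k a) (startB m k a) a)
          (combReducedDeriv m (startA m k a) (startB m k a) a) (n : ℂ) := by
      have h0 : eulerD m 0 = 0 := by simp [eulerD]
      simp only [energy, combReduced_sub, combReducedDeriv_sub, combReduced_start,
        combReducedDeriv_start, h0, hD1, map_zero, map_one, sub_zero]
    simp only [Complex.ofReal_natCast] at h1 h2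
    rw [e] at h2
    have h3 : energy m a 0
        (combReduced m (startA m k a - startA m n a) (startB m k a - startB m n a) a)
        (combReducedDeriv m (startA m k a - startA m n a) (startB m k a - startB m n a) a) (n₀ : ℂ) ≤
        A * (A * η ^ 2 * ‖xi m (n : ℂ)‖) := by
      refine h2.trans ?_
      gcongr
      simpa using h1
    have hle : D * (A * (A * η ^ 2 * ‖xi m (n : ℂ)‖)) ≤
        max (A * η ^ 2) (D * (A * (A * η ^ 2))) * ‖xi m (n : ℂ)‖ := by
      refine le_trans (le_of_eq ?_) (mul_le_mul_of_nonneg_right (le_max_right _ _) (norm_nonneg _))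
      ring
    obtain ⟨d1, d2⟩ := hD a ha (startA m k a - startA m n a) (startB m k a - startB m n a)
    exact ⟨d1.trans ((mul_le_mul_of_nonneg_left h3 hD0).trans hle),
      d2.trans ((mul_le_mul_of_nonneg_left h3 hD0).trans hle)⟩

theorem tendsto_norm_xi (m : ℕ) :
    Filter.Tendsto (fun t : ℝ => ‖xi m (t : ℂ)‖) Filter.atTop (nhds 0) := by
  have hq : (0 : ℝ) < q m := by exact_mod_cast q_pos m
  simp only [norm_xi, Complex.ofReal_re]
  exact Real.tendsto_exp_neg_atTop_nhds_zero.comp (Filter.tendsto_id.atTop_div_const hq)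

/-- A sequence of entire functions which is Cauchy locally uniformly, with squared distances bounded
by a null sequence, has an entire limit. -/
theorem exists_entire_limit {m : ℕ} {F : ℕ → (Fin m → ℂ) → ℂ} (hF : ∀ n, Differentiable ℂ (F n))
    (h : ∀ K : Set (Fin m → ℂ), IsCompact K → ∃ (n₀ : ℕ) (C : ℝ), ∀ a ∈ K, ∀ n k : ℕ, n₀ ≤ n →
      n ≤ k → ‖F k a - F n a‖ ^ 2 ≤ C * ‖xi m (n : ℂ)‖) :
    ∃ f : (Fin m → ℂ) → ℂ, Differentiable ℂ f ∧
      ∀ a, Filter.Tendsto (fun n => F n a) Filter.atTop (nhds (f a)) := by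
  have hc : ∀ K : Set (Fin m → ℂ), IsCompact K → UniformCauchySeqOn F Filter.atTop K := by
    intro K hK
    obtain ⟨n₀, C, hC⟩ := h K hK
    rw [Metric.uniformCauchySeqOn_iff]
    intro ε hε
    have hlim : Filter.Tendsto (fun n : ℕ => C * ‖xi m (n : ℂ)‖) Filter.atTop (nhds 0) := by
      have := ((tendsto_norm_xi m).comp tendsto_natCast_atTop_atTop).const_mul C
      simpa using this
    obtain ⟨n₁, hn₁⟩ := Filter.eventually_atTop.1 (hlim.eventually_lt_const
      (show (0 : ℝ) < (ε / 2) ^ 2 by positivity))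
    have hlt : ∀ k ≥ max n₀ n₁, ∀ a ∈ K, ‖F k a - F (max n₀ n₁) a‖ < ε / 2 := by
      intro k hk a ha
      have h1 := (hC a ha (max n₀ n₁) k (le_max_left _ _) hk).trans_lt (hn₁ _ (le_max_right _ _))
      exact lt_of_pow_lt_pow_left₀ 2 (by positivity) h1
    refine ⟨max n₀ n₁, fun k hk l hl a ha => ?_⟩
    have h1 := hlt k hk a ha
    have h2 := hlt l hl a ha
    have h3 := dist_triangle_right (F k a) (F l a) (F (max n₀ n₁) a)
    rw [dist_eq_norm (F k a) (F (max n₀ n₁) a), dist_eq_norm (F l a) (F (max n₀ n₁) a)] at h3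
    linarith
  have hlim : ∀ a, ∃ y, Filter.Tendsto (fun n => F n a) Filter.atTop (nhds y) := fun a =>
    cauchySeq_tendsto_of_complete ((hc {a} isCompact_singleton).cauchySeq rfl)
  choose f hf using hlim
  exact ⟨f, differentiable_of_tendstoUniformlyOn_isCompact hF fun K hK =>
    (hc K hK).tendstoUniformlyOn_of_tendsto fun a _ => hf a, hf⟩

/-- The recessive solution: its quotient by `x ^ r e ^ (-S)` tends to `1` on the positive axis. -/
theorem exists_recessive {m : ℕ} (hm : 1 ≤ m) :
    ∃ α β : (Fin m → ℂ) → ℂ, Differentiable ℂ α ∧ Differentiable ℂ β ∧ ∀ a,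
      Filter.Tendsto (fun t : ℝ => energy m a 1 (combReduced m (α a) (β a) a)
        (combReducedDeriv m (α a) (β a) a) (t : ℂ)) Filter.atTop (nhds 0) := by
  have hy : ∀ (t c₀ c₁ : ℂ), Differentiable ℂ fun a => entireSol m c₀ c₁ t a := fun t c₀ c₁ =>
    (differentiable_entireSol m c₀ c₁).comp ((differentiable_const t).prodMk differentiable_id)
  have hz : ∀ (t c₀ c₁ : ℂ), Differentiable ℂ fun a => entireSolDeriv m c₀ c₁ t a := fun t c₀ c₁ =>
    (differentiable_entireSolDeriv m c₀ c₁).comp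
      ((differentiable_const t).prodMk differentiable_id)
  obtain ⟨α, hα, hαl⟩ := exists_entire_limit (m := m) (F := fun n a => startA m (n : ℂ) a)
    (fun n => ((differentiable_leading m n).const_mul _).fun_mul
      ((hz n 0 1).fun_sub ((differentiable_logDeriv m n).fun_mul (hy n 0 1))))
    (fun K hK => by
      obtain ⟨n₀, C, -, h⟩ := exists_start_bounds hm hK
      exact ⟨n₀, C, fun a ha n k hn hk => ((h a ha).2 n k hn hk).1⟩)
  obtain ⟨β, hβ, hβl⟩ := exists_entire_limit (m := m) (F := fun n a => startB m (n : ℂ) a)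
    (fun n => ((differentiable_leading m n).const_mul _).fun_mul
      (((differentiable_logDeriv m n).fun_mul (hy n 1 0)).fun_sub (hz n 1 0)))
    (fun K hK => by
      obtain ⟨n₀, C, -, h⟩ := exists_start_bounds hm hK
      exact ⟨n₀, C, fun a ha n k hn hk => ((h a ha).2 n k hn hk).2⟩)
  refine ⟨α, β, hα, hβ, fun a => ?_⟩
  obtain ⟨n₀, C, -, h⟩ := exists_start_bounds hm (isCompact_singleton (x := a))
  have hb : ∀ t : ℝ, (n₀ : ℝ) ≤ t → energy m a 1 (combReduced m (α a) (β a) a)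
      (combReducedDeriv m (α a) (β a) a) (t : ℂ) ≤ C * ‖xi m (t : ℂ)‖ := by
    intro t ht
    -- At fixed t the energy is continuous in the two coefficients, so the bound uniform in n
    -- survives the limit.
    have hcont : Continuous fun p : ℂ × ℂ => energy m a 1 (combReduced m p.1 p.2 a)
        (combReducedDeriv m p.1 p.2 a) (t : ℂ) := by
      unfold energy combReduced combReducedDeriv reduced reducedDeriv comb combDeriv
      fun_prop (disch := exact leading_ne_zero _ _ _)
    have hl := (hcont.tendsto (α a, β a)).comp ((hαl a).prodMk_nhds (hβl a))
    refine le_of_tendsto hl ?_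
    obtain ⟨n₁, hn₁⟩ := exists_nat_ge t
    filter_upwards [Filter.eventually_ge_atTop n₁] with n hn
    exact (h a rfl).1 t n ht (hn₁.trans (by exact_mod_cast hn))
  refine squeeze_zero' (Filter.Eventually.of_forall fun t => energy_nonneg _ _ _ _ _ _)
    ((Filter.eventually_ge_atTop (n₀ : ℝ)).mono hb) ?_
  simpa using (tendsto_norm_xi m).const_mul C

/-! ### The expansion on the positive axis -/

theorem exists_norm_residual_le {m : ℕ} (hm : 1 ≤ m) {K : Set (Fin m → ℂ)} (hK : IsCompact K)
    (N : ℕ) : ∃ η, 0 ≤ η ∧ ∀ a ∈ K, ∀ t : ℂ, 0 ≤ t.re →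
      ‖ev m a t (residual m (formalSum m N))‖ ≤ η * ‖xi m t‖ ^ (N + 1) := by
  obtain ⟨w, hw⟩ := X_pow_dvd_residual_formalSum hm N
  obtain ⟨η, hη0, hη⟩ := exists_norm_ev_le m hK w
  refine ⟨η, hη0, fun a ha t ht => ?_⟩
  rw [hw, map_mul, map_pow, ev_X, norm_mul, norm_pow, mul_comm]
  gcongr
  exact hη a ha t ht

theorem tendsto_norm_ev_X_mul (m : ℕ) (a : Fin m → ℂ) (p : Polynomial (Coeff m)) :
    Filter.Tendsto (fun t : ℝ => ‖ev m a (t : ℂ) (Polynomial.X * p)‖) Filter.atTop (nhds 0) := by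
  obtain ⟨C, hC0, hC⟩ := exists_norm_ev_le m (isCompact_singleton (x := a)) p
  have hl : Filter.Tendsto (fun t : ℝ => ‖xi m (t : ℂ)‖ * C) Filter.atTop (nhds 0) := by
    simpa using (tendsto_norm_xi m).mul_const C
  refine squeeze_zero' (Filter.Eventually.of_forall fun t => norm_nonneg _) ?_ hl
  filter_upwards [Filter.eventually_ge_atTop 0] with t ht
  rw [map_mul, norm_mul, ev_X]
  gcongr
  exact hC a rfl t (by simpa using ht)

theorem energy_le_add (m : ℕ) (a : Fin m → ℂ) (U : Polynomial (Coeff m)) (u p : ℂ → ℂ) {t : ℂ}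
    (ht : 0 ≤ t.re) : energy m a U u p t ≤
      2 * energy m a 1 u p t + 2 * (‖ev m a t (U - 1)‖ ^ 2 + ‖ev m a t (eulerD m U)‖ ^ 2) := by
  have sq_le : ∀ x y : ℂ, ‖x - y‖ ^ 2 ≤ 2 * ‖x‖ ^ 2 + 2 * ‖y‖ ^ 2 := by
    intro x y
    have h1 := norm_sub_le x y
    have h2 : ‖x - y‖ ^ 2 ≤ (‖x‖ + ‖y‖) ^ 2 := by gcongr
    nlinarith [sq_nonneg (‖x‖ - ‖y‖)]
  rw [energy, energy, energy_weight, eulerD_one, map_zero, sub_zero, map_one]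
  have h1 := sq_le (u t - 1) (ev m a t (U - 1))
  have h2 := sq_le (p t) (ev m a t (eulerD m U))
  have e1 : u t - 1 - ev m a t (U - 1) = u t - ev m a t U := by
    rw [map_sub, map_one]; ring
  rw [e1] at h1
  have hw0 : 0 ≤ ‖xi m t‖ ^ (halfDeg m - 1) := by positivity
  have hw1 : ‖xi m t‖ ^ (halfDeg m - 1) ≤ 1 := pow_le_one₀ (norm_nonneg _) (norm_xi_le_one m ht)
  have h3 := mul_le_mul_of_nonneg_left h2 hw0
  have h4 := mul_le_mul_of_nonneg_right hw1 (sq_nonneg ‖ev m a t (eulerD m U)‖)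
  nlinarith

theorem X_dvd_eulerD (m : ℕ) (U : Polynomial (Coeff m)) : Polynomial.X ∣ eulerD m U := by
  rw [eulerD, mul_assoc, mul_left_comm]
  exact dvd_mul_right _ _

theorem X_dvd_formalSum_sub_one (m N : ℕ) : Polynomial.X ∣ formalSum m N - 1 := by
  rw [Polynomial.X_dvd_iff, Polynomial.coeff_sub, coeff_formalSum, if_pos (Nat.zero_le N)]
  simp [formalSum]

/-- The formal solution approximates the recessive solution on the positive axis. -/
theorem exists_energy_le_on_axis {m : ℕ} (hm : 1 ≤ m) {K : Set (Fin m → ℂ)} (hK : IsCompact K)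
    {u p : (Fin m → ℂ) → ℂ → ℂ} (hsol : ∀ a t, ReducedAt m a (u a) (p a) t)
    (hlim : ∀ a, Filter.Tendsto (fun t : ℝ => energy m a 1 (u a) (p a) (t : ℂ))
      Filter.atTop (nhds 0)) (N : ℕ) :
    ∃ C ρ₀ : ℝ, 0 ≤ C ∧ ∀ a ∈ K, ∀ t : ℝ, ρ₀ ≤ t →
      energy m a (formalSum m N) (u a) (p a) (t : ℂ) ≤ C * ‖xi m (t : ℂ)‖ ^ (2 * N + 1) := by
  obtain ⟨A, ρ₀, hA, hρ, hray⟩ := energy_along_ray hm hK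
  obtain ⟨η, hη0, hη⟩ := exists_norm_residual_le hm hK N
  refine ⟨A * η ^ 2, ρ₀, by positivity, fun a ha t ht => ?_⟩
  obtain ⟨w₁, hw₁⟩ := X_dvd_formalSum_sub_one m N
  obtain ⟨w₂, hw₂⟩ := X_dvd_eulerD m (formalSum m N)
  -- U - 1 and the derivative of U are divisible by ξ, so replacing 1 by U does not affect
  -- convergence to zero. In the ray estimate the end T can then go to infinity for each a, with a
  -- constant uniform on K.
  have hz : Filter.Tendsto (fun T : ℝ => energy m a (formalSum m N) (u a) (p a) (T : ℂ))
      Filter.atTop (nhds 0) := by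
    have h1 := ((hlim a).const_mul 2).add ((((tendsto_norm_ev_X_mul m a w₁).pow 2).add
      ((tendsto_norm_ev_X_mul m a w₂).pow 2)).const_mul 2)
    rw [← hw₁, ← hw₂] at h1
    norm_num at h1
    refine squeeze_zero' (Filter.Eventually.of_forall fun T => energy_nonneg _ _ _ _ _ _) ?_ h1
    filter_upwards [Filter.eventually_ge_atTop 0] with T hT
    have := energy_le_add m a (formalSum m N) (u a) (p a) (t := (T : ℂ)) (by simpa using hT)
    simpa using this
  have hz2 := ((hz.add_const (η ^ 2 * ‖xi m (t : ℂ)‖ ^ (2 * (N + 1) - 1))).const_mul A)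
  rw [zero_add, ← mul_assoc, show 2 * (N + 1) - 1 = 2 * N + 1 by omega] at hz2
  refine ge_of_tendsto hz2 ?_
  filter_upwards [Filter.eventually_ge_atTop t] with T hT
  exact hray a ha (formalSum m N) (N + 1) η (by omega) (u a) (p a) t T ht hT
    (fun s _ => hsol a s) (fun s hs => hη a ha s (by
      rw [Complex.ofReal_re]; linarith [hs.1]))

/-! ### Transport of the expansion to the sector -/

/-- Transport of the approximation from the sector `|m arg x / 2| ≤ θ₀` to `|m arg x / 2| ≤ θ₁`
along segments on which `Re S` increases. -/
theorem exists_energy_le_step {m : ℕ} (hm : 1 ≤ m) {K : Set (Fin m → ℂ)} (hK : IsCompact K)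
    {u p : (Fin m → ℂ) → ℂ → ℂ} (hsol : ∀ a t, ReducedAt m a (u a) (p a) t) (N : ℕ)
    {c B θ₀ θ₁ : ℝ} (hc : 0 < c) (hB : 0 ≤ B)
    (hθ₀ : ∃ C ρ₀ : ℝ, 0 ≤ C ∧ ∀ a ∈ K, ∀ t : ℂ, ρ₀ ≤ t.re → |(m / 2 : ℝ) * t.im| ≤ θ₀ →
      energy m a (formalSum m N) (u a) (p a) t ≤ C * ‖xi m t‖ ^ (2 * N + 1))
    (hpath : ∀ y : ℝ, |(m / 2 : ℝ) * y| ≤ θ₁ → ∃ ω l : ℝ, 0 ≤ l ∧ l ≤ B ∧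
      |(m / 2 : ℝ) * (y + l * Real.sin ω)| ≤ θ₀ ∧
      ∀ s ∈ Set.Icc 0 l, c ≤ Real.cos (ω + (m / 2 : ℝ) * (y + s * Real.sin ω))) :
    ∃ C ρ₀ : ℝ, 0 ≤ C ∧ ∀ a ∈ K, ∀ t : ℂ, ρ₀ ≤ t.re → |(m / 2 : ℝ) * t.im| ≤ θ₁ →
      energy m a (formalSum m N) (u a) (p a) t ≤ C * ‖xi m t‖ ^ (2 * N + 1) := by
  obtain ⟨C, ρ, hC, hCρ⟩ := hθ₀
  obtain ⟨η, hη0, hη⟩ := exists_norm_residual_le hm hK N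
  obtain ⟨A, ρ', hA, hρ', hseg⟩ := energy_along_segment hm hK hc hB (N := N + 1) (by omega)
  have hq : (0 : ℝ) < q m := by exact_mod_cast q_pos m
  set b := Real.exp (B / q m) with hb
  have hb0 : 0 < b := Real.exp_pos _
  refine ⟨A * (C * b ^ (2 * N + 1) + η ^ 2), max ρ ρ' + B, by positivity, fun a ha t ht hθ => ?_⟩
  obtain ⟨ω, l, hl0, hlB, hend, hcos⟩ := hpath t.im hθ
  set d : ℂ := Complex.exp (ω * Complex.I) with hd
  have hdre : d.re = Real.cos ω := by rw [hd, Complex.exp_ofReal_mul_I_re]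
  have hdim : d.im = Real.sin ω := by rw [hd, Complex.exp_ofReal_mul_I_im]
  have him : ∀ s : ℝ, (t + s * d).im = t.im + s * Real.sin ω := by
    intro s
    rw [Complex.add_im, Complex.im_ofReal_mul, hdim]
  have hre : ∀ s ∈ Set.Icc 0 l, t.re - B ≤ (t + s * d).re := by
    intro s hs
    rw [Complex.add_re, Complex.re_ofReal_mul, hdre]
    have h2 := Real.neg_one_le_cos ω
    nlinarith [hs.1, hs.2]
  have ht1 : ρ + B ≤ t.re := by linarith [le_max_left ρ ρ']
  have ht2 : ρ' + B ≤ t.re := by linarith [le_max_right ρ ρ']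
  have h := hseg a ha (formalSum m N) η (u a) (p a) t d l (Complex.norm_exp_ofReal_mul_I ω)
    ht2 hl0 hlB (by
      intro s hs
      -- In polar form Re(dζ) = |ζ| cos(ω + arg ζ), which turns the cosine condition on the path
      -- into the direction condition of the segment estimate.
      have e : d * zeta m (t + s * d) = Complex.exp (((m / 2 : ℝ) * (t + s * d).re : ℝ) +
          ((ω + (m / 2 : ℝ) * (t + s * d).im : ℝ) : ℂ) * Complex.I) := by
        rw [hd, zeta, ← Complex.exp_add, ← hd]
        congr 1
        conv_lhs => rw [← Complex.re_add_im (t + s * d)]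
        push_cast
        ring
      have e2 : ‖zeta m (t + s * d)‖ = Real.exp ((m / 2 : ℝ) * (t + s * d).re) := by
        rw [zeta, Complex.norm_exp]
        congr 1
        rw [show (m : ℂ) / 2 = ((m / 2 : ℝ) : ℂ) by push_cast; rfl, Complex.re_ofReal_mul]
      rw [e, e2, Complex.exp_add, ← Complex.ofReal_exp, Complex.re_ofReal_mul,
        Complex.exp_ofReal_mul_I_re, mul_comm, him]
      exact mul_le_mul_of_nonneg_left (hcos s hs) (Real.exp_pos _).le)
    (fun s _ => hsol a _) (fun s hs => hη a ha _ (by linarith [hre s hs]))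
  have hlm : l ∈ Set.Icc 0 l := Set.right_mem_Icc.2 hl0
  have h1 := hCρ a ha (t + l * d) (by linarith [hre l hlm]) (by rw [him]; exact hend)
  have h2 : ‖xi m (t + l * d)‖ ≤ b * ‖xi m t‖ := by
    rw [norm_xi, norm_xi, hb, ← Real.exp_add, Real.exp_le_exp, ← sub_nonneg]
    have e : B / q m + -(t.re / q m) - -((t + l * d).re / q m) =
      ((t + l * d).re - (t.re - B)) / q m := by ring
    rw [e]
    exact div_nonneg (by linarith [hre l hlm]) hq.le
  refine h.trans ?_
  rw [show 2 * (N + 1) - 1 = 2 * N + 1 by omega, mul_assoc A, add_mul]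
  gcongr
  calc _ ≤ C * ‖xi m (t + l * d)‖ ^ (2 * N + 1) := h1
    _ ≤ C * (b * ‖xi m t‖) ^ (2 * N + 1) := by gcongr
    _ = _ := by rw [mul_pow]; ring

theorem cos_le_cos_of_abs_le {x y : ℝ} (h : |x| ≤ y) (hy : y ≤ Real.pi) :
    Real.cos y ≤ Real.cos x := by
  rw [← Real.cos_abs x]
  exact Real.cos_le_cos_of_nonneg_of_le_pi (abs_nonneg x) hy h

/-- The conditions are invariant under the reflection y ↦ -y, ω ↦ -ω. -/
theorem exists_path_of_nonneg {k c B θ₀ θ₁ : ℝ}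
    (h : ∀ y : ℝ, 0 ≤ y → k * y ≤ θ₁ → ∃ ω l : ℝ, 0 ≤ l ∧ l ≤ B ∧
      |k * (y + l * Real.sin ω)| ≤ θ₀ ∧
      ∀ s ∈ Set.Icc 0 l, c ≤ Real.cos (ω + k * (y + s * Real.sin ω)))
    (y : ℝ) (hy : |k * y| ≤ θ₁) : ∃ ω l : ℝ, 0 ≤ l ∧ l ≤ B ∧
      |k * (y + l * Real.sin ω)| ≤ θ₀ ∧
      ∀ s ∈ Set.Icc 0 l, c ≤ Real.cos (ω + k * (y + s * Real.sin ω)) := by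
  rcases le_total 0 y with h0 | h0
  · exact h y h0 ((le_abs_self _).trans hy)
  · obtain ⟨ω, l, hl, hlB, h1, h2⟩ := h (-y) (by linarith)
      (by rw [mul_neg]; exact (neg_le_abs _).trans hy)
    refine ⟨-ω, l, hl, hlB, ?_, fun s hs => ?_⟩
    · rw [Real.sin_neg, ← abs_neg]
      convert h1 using 2
      ring
    · rw [Real.sin_neg, ← Real.cos_neg]
      convert h2 s hs using 2
      ring

/-- In the direction -π/4 the angle ω + arg ζ runs from at most π/4 down to -π/4, so the cosine
stays bounded below. -/
theorem exists_path_to_axis {k : ℝ} (hk : 0 < k) (y : ℝ) (hy0 : 0 ≤ y)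
    (hy : k * y ≤ Real.pi / 2) : ∃ ω l : ℝ, 0 ≤ l ∧
      l ≤ Real.pi / 2 / k / Real.sin (Real.pi / 4) ∧ |k * (y + l * Real.sin ω)| ≤ 0 ∧
      ∀ s ∈ Set.Icc 0 l, Real.cos (Real.pi / 4) ≤
        Real.cos (ω + k * (y + s * Real.sin ω)) := by
  have hπ := Real.pi_pos
  have hs : 0 < Real.sin (Real.pi / 4) := Real.sin_pos_of_pos_of_lt_pi (by linarith) (by linarith)
  refine ⟨-(Real.pi / 4), y / Real.sin (Real.pi / 4), by positivity, ?_, ?_, fun s hs' => ?_⟩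
  · gcongr
    rw [le_div_iff₀ hk]
    linarith
  · rw [Real.sin_neg, mul_neg, div_mul_cancel₀ _ hs.ne']
    simp
  · have h1 : s * Real.sin (Real.pi / 4) ≤ y := by
      rw [← le_div_iff₀ hs]; exact hs'.2
    have h2 : 0 ≤ s * Real.sin (Real.pi / 4) := mul_nonneg hs'.1 hs.le
    refine cos_le_cos_of_abs_le ?_ (by linarith)
    rw [Real.sin_neg, abs_le]
    constructor <;> nlinarith

/-- A straight segment can lower arg ζ by less than π, so a second one is needed beyond π/2. The
direction π + δ points down and almost straight back towards the origin in |x|. As arg ζ approaches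
3π/2 the admissible downward directions shrink to this one, and at 3π/2 none is left. -/
theorem exists_path_to_right_half {k δ : ℝ} (hk : 0 < k) (hδ : 0 < δ) (hδ1 : δ ≤ Real.pi / 2)
    (y : ℝ) (hy0 : 0 ≤ y) (hy : k * y ≤ 3 * Real.pi / 2 - 2 * δ) : ∃ ω l : ℝ, 0 ≤ l ∧
      l ≤ 3 * Real.pi / 2 / k / Real.sin δ ∧ |k * (y + l * Real.sin ω)| ≤ Real.pi / 2 ∧
      ∀ s ∈ Set.Icc 0 l, Real.cos (Real.pi / 2 - δ / 2) ≤
        Real.cos (ω + k * (y + s * Real.sin ω)) := by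
  have hπ := Real.pi_pos
  have hs : 0 < Real.sin δ := Real.sin_pos_of_pos_of_lt_pi hδ (by linarith)
  rcases le_total (k * y) (Real.pi / 2) with h | h
  · refine ⟨-(k * y), 0, le_rfl, by positivity, ?_, fun s hs' => ?_⟩
    · rw [zero_mul, add_zero, abs_of_nonneg (by positivity)]
      exact h
    · rw [Set.Icc_self, Set.mem_singleton_iff] at hs'
      rw [hs', zero_mul, add_zero, neg_add_cancel, Real.cos_zero]
      exact Real.cos_le_one _
  · have hsin : Real.sin (Real.pi + δ) = -Real.sin δ := by
      rw [add_comm, Real.sin_add_pi]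
    -- The segment ends slightly inside |arg ζ| ≤ π/2, as far as the bound cos(π/2 - δ/2) permits.
    set y₁ := (Real.pi / 2 - δ / 2) / k with hy₁
    have hky₁ : k * y₁ = Real.pi / 2 - δ / 2 := by rw [hy₁]; field_simp
    have hyy : 0 ≤ y - y₁ := by
      by_contra hn
      push Not at hn
      nlinarith
    refine ⟨Real.pi + δ, (y - y₁) / Real.sin δ, by positivity, ?_, ?_, fun s hs' => ?_⟩
    · gcongr
      rw [le_div_iff₀ hk]
      nlinarith
    · rw [hsin, mul_neg, div_mul_cancel₀ _ hs.ne', neg_sub, add_sub_cancel, hky₁,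
        abs_of_nonneg (by linarith)]
      linarith
    · have h1 : s * Real.sin δ ≤ y - y₁ := by
        rw [← le_div_iff₀ hs]; exact hs'.2
      have h2 : 0 ≤ s * Real.sin δ := mul_nonneg hs'.1 hs.le
      -- Modulo 2π, ω + arg ζ lies between -π/2 + δ/2 and π/2 - δ.
      rw [← Real.cos_sub_two_pi (Real.pi + δ + _)]
      refine cos_le_cos_of_abs_le ?_ (by linarith)
      have h3 := mul_le_mul_of_nonneg_left h1 hk.le
      have h4 := mul_nonneg hk.le h2
      rw [hsin, abs_le]
      constructor <;> nlinarith

/-- The formal solution approximates the recessive solution in strict sub-sectors of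
`|arg x| < 3π/m`. -/
theorem exists_energy_le_on_sector {m : ℕ} (hm : 1 ≤ m) {K : Set (Fin m → ℂ)} (hK : IsCompact K)
    {u p : (Fin m → ℂ) → ℂ → ℂ} (hsol : ∀ a t, ReducedAt m a (u a) (p a) t)
    (hlim : ∀ a, Filter.Tendsto (fun t : ℝ => energy m a 1 (u a) (p a) (t : ℂ))
      Filter.atTop (nhds 0)) (N : ℕ) {θ : ℝ} (hθ : θ < 3 * Real.pi / 2) :
    ∃ C ρ₀ : ℝ, 0 ≤ C ∧ ∀ a ∈ K, ∀ t : ℂ, ρ₀ ≤ t.re → |(m / 2 : ℝ) * t.im| ≤ θ →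
      energy m a (formalSum m N) (u a) (p a) t ≤ C * ‖xi m t‖ ^ (2 * N + 1) := by
  have hπ := Real.pi_pos
  have hm0 : (0 : ℝ) < m := by exact_mod_cast hm
  have hk : (0 : ℝ) < m / 2 := by positivity
  have h0 : ∃ C ρ₀ : ℝ, 0 ≤ C ∧ ∀ a ∈ K, ∀ t : ℂ, ρ₀ ≤ t.re → |(m / 2 : ℝ) * t.im| ≤ 0 →
      energy m a (formalSum m N) (u a) (p a) t ≤ C * ‖xi m t‖ ^ (2 * N + 1) := by
    obtain ⟨C, ρ₀, hC, h⟩ := exists_energy_le_on_axis hm hK hsol hlim N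
    refine ⟨C, ρ₀, hC, fun a ha t ht h0 => ?_⟩
    have him : t.im = 0 := by
      have := abs_nonpos_iff.1 h0
      rcases mul_eq_zero.1 this with h | h
      · exact absurd h hk.ne'
      · exact h
    have e : ((t.re : ℝ) : ℂ) = t := by apply Complex.ext <;> simp [him]
    rw [← e]
    exact h a ha t.re ht
  have hs : 0 < Real.sin (Real.pi / 4) := Real.sin_pos_of_pos_of_lt_pi (by linarith) (by linarith)
  have h1 := exists_energy_le_step hm hK hsol N
    (Real.cos_pos_of_mem_Ioo ⟨by linarith, by linarith⟩ : 0 < Real.cos (Real.pi / 4))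
    (by positivity) h0
    (exists_path_of_nonneg (exists_path_to_axis hk))
  -- The first entry gives θ ≤ 3π/2 - 2δ, the range of the second segment.
  set δ := min ((3 * Real.pi / 2 - θ) / 2) (Real.pi / 2) with hδ
  have hδ0 : 0 < δ := lt_min (by linarith) (by linarith)
  have hδ1 : δ ≤ Real.pi / 2 := min_le_right _ _
  have hδ2 : δ ≤ (3 * Real.pi / 2 - θ) / 2 := min_le_left _ _
  have hs2 : 0 < Real.sin δ := Real.sin_pos_of_pos_of_lt_pi hδ0 (by linarith)
  obtain ⟨C, ρ₀, hC, h2⟩ := exists_energy_le_step hm hK hsol N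
    (Real.cos_pos_of_mem_Ioo ⟨by linarith, by linarith⟩ : 0 < Real.cos (Real.pi / 2 - δ / 2))
    (by positivity) h1
    (exists_path_of_nonneg (exists_path_to_right_half hk hδ0 hδ1))
  exact ⟨C, ρ₀, hC, fun a ha t ht hθt => h2 a ha t ht (by linarith)⟩

/-- The bounds for the error and its derivative in strict sub-sectors of `|arg x| < 3π/m`. -/
theorem exists_error_le_on_sector {m : ℕ} (hm : 1 ≤ m) {K : Set (Fin m → ℂ)} (hK : IsCompact K)
    {u p : (Fin m → ℂ) → ℂ → ℂ} (hsol : ∀ a t, ReducedAt m a (u a) (p a) t)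
    (hlim : ∀ a, Filter.Tendsto (fun t : ℝ => energy m a 1 (u a) (p a) (t : ℂ))
      Filter.atTop (nhds 0)) (N : ℕ) {α β : ℝ} (hα : -(3 * Real.pi / m) < α)
    (hβ : β < 3 * Real.pi / m) :
    ∃ C ρ₀ : ℝ, 0 ≤ C ∧ 0 ≤ ρ₀ ∧ ∀ a ∈ K, ∀ t : ℂ, α ≤ t.im → t.im ≤ β → ρ₀ ≤ t.re →
      ‖u a t - ev m a t (formalSum m N)‖ ≤ C * ‖xi m t‖ ^ N ∧
      ‖xi m t ^ halfDeg m * (p a t - ev m a t (eulerD m (formalSum m N)))‖ ≤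
        C * ‖xi m t‖ ^ N := by
  have hm0 : (0 : ℝ) < m := by exact_mod_cast hm
  have hθ : (m / 2 : ℝ) * max (-α) β < 3 * Real.pi / 2 := by
    have h1 : max (-α) β < 3 * Real.pi / m := max_lt (by linarith) hβ
    rw [lt_div_iff₀ hm0] at h1
    linarith
  obtain ⟨C, ρ₀, hC, h⟩ := exists_energy_le_on_sector hm hK hsol hlim N hθ
  refine ⟨Real.sqrt C, max ρ₀ 0, Real.sqrt_nonneg C, le_max_right _ _,
    fun a ha t ht1 ht2 ht => ?_⟩
  have hE := h a ha t ((le_max_left _ _).trans ht) (by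
    rw [abs_mul, abs_of_pos (by positivity : (0 : ℝ) < m / 2)]
    gcongr
    exact abs_le'.2 ⟨ht2.trans (le_max_right _ _), (neg_le_neg ht1).trans (le_max_left _ _)⟩)
  have ht0 : 0 ≤ t.re := (le_max_right _ _).trans ht
  have hx0 := norm_xi_pos m t
  have hx1 := norm_xi_le_one m ht0
  have hb : C * ‖xi m t‖ ^ (2 * N + 1) ≤ (Real.sqrt C * ‖xi m t‖ ^ N) ^ 2 := by
    rw [mul_pow, Real.sq_sqrt hC, ← pow_mul, mul_comm N 2]
    exact mul_le_mul_of_nonneg_left (pow_le_pow_of_le_one hx0.le hx1 (by omega)) hC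
  have hE2 := hE.trans hb
  rw [energy, energy_weight] at hE2
  have h1 : 0 ≤ ‖u a t - ev m a t (formalSum m N)‖ ^ 2 := by positivity
  have h2 : 0 ≤ ‖xi m t‖ ^ (halfDeg m - 1) *
    ‖p a t - ev m a t (eulerD m (formalSum m N))‖ ^ 2 := by positivity
  constructor
  · refine le_of_sq_le_sq ?_ (by positivity)
    linarith
  · refine le_of_sq_le_sq ?_ (by positivity)
    rw [norm_mul, norm_pow, mul_pow, ← pow_mul]
    -- The factor ξ^h on the derivative error, which comes from the normalization by x^(m/2), is
    -- more than the weight of the energy requires.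
    have h3 : ‖xi m t‖ ^ (halfDeg m * 2) ≤ ‖xi m t‖ ^ (halfDeg m - 1) :=
      pow_le_pow_of_le_one hx0.le hx1 (by omega)
    have h4 := mul_le_mul_of_nonneg_right h3
      (sq_nonneg ‖p a t - ev m a t (eulerD m (formalSum m N))‖)
    linarith

/-! ### From error bounds to asymptotic expansions -/

theorem norm_exp_rpow (m : ℕ) (t : ℂ) (N : ℕ) :
    ‖Complex.exp t‖ ^ (-((N : ℝ) / (q m : ℝ))) = ‖xi m t‖ ^ N := by
  rw [Complex.norm_exp, norm_xi, ← Real.exp_mul, ← Real.exp_nat_mul]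
  congr 1
  ring

/-- A polynomial differs from the partial sum of a series with the same coefficients below `N` by
terms of order at least `N`. -/
theorem exists_norm_ev_sub_sum_le (m : ℕ) {K : Set (Fin m → ℂ)} (hK : IsCompact K) (N : ℕ)
    (W : Polynomial (Coeff m)) (ψ : PowerSeries (Coeff m))
    (h : ∀ n < N, W.coeff n = PowerSeries.coeff n ψ) :
    ∃ C, 0 ≤ C ∧ ∀ a ∈ K, ∀ t : ℂ, 0 ≤ t.re →
      ‖ev m a t W - ∑ n ∈ Finset.range N, MvPolynomial.eval a (PowerSeries.coeff n ψ) *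
        xpow t (-((n : ℂ) / (q m : ℂ)))‖ ≤ C * ‖xi m t‖ ^ N := by
  have hd : Polynomial.X ^ N ∣ W - ∑ n ∈ Finset.range N,
      Polynomial.C (PowerSeries.coeff n ψ) * Polynomial.X ^ n := by
    rw [Polynomial.X_pow_dvd_iff]
    intro d hd
    rw [Polynomial.coeff_sub, Polynomial.finsetSum_coeff, h d hd]
    simp only [Polynomial.coeff_C_mul_X_pow]
    simp [hd]
  obtain ⟨w, hw⟩ := hd
  obtain ⟨C, hC0, hC⟩ := exists_norm_ev_le m hK w
  refine ⟨C, hC0, fun a ha t ht => ?_⟩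
  have e : ev m a t W - ∑ n ∈ Finset.range N, MvPolynomial.eval a (PowerSeries.coeff n ψ) *
        xpow t (-((n : ℂ) / (q m : ℂ))) = xi m t ^ N * ev m a t w := by
    have := congrArg (ev m a t) hw
    simp only [map_sub, map_sum, map_mul, map_pow, ev_C, ev_X] at this
    rw [← this]
    simp only [xi_pow]
  rw [e, norm_mul, norm_pow, mul_comm]
  gcongr
  exact hC a ha t ht

/-- An approximation by polynomials in `x ^ (-1/q)` yields an asymptotic expansion. -/
theorem hasExpansion_of_bound {m : ℕ} {f : ℂ → (Fin m → ℂ) → ℂ} {ρ : MvPolynomial (Fin m) ℂ}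
    {ψ : PowerSeries (Coeff m)} (W : ℕ → Polynomial (Coeff m))
    (hW : ∀ N, ∀ n < N, (W N).coeff n = PowerSeries.coeff n ψ)
    (h : ∀ K : Set (Fin m → ℂ), IsCompact K → ∀ α β : ℝ, -(3 * Real.pi / m) < α →
      β < 3 * Real.pi / m → ∀ N : ℕ, ∃ C ρ₀ : ℝ, 0 ≤ ρ₀ ∧ ∀ a ∈ K, ∀ t : ℂ, α ≤ t.im → t.im ≤ β →
        ρ₀ ≤ t.re → ‖f t a / (xpow t (MvPolynomial.eval a ρ) * Complex.exp (-S m t a)) -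
          ev m a t (W N)‖ ≤ C * ‖xi m t‖ ^ N) :
    HasExpansion m f ρ ψ := by
  intro K hK α β hα hβ N
  obtain ⟨C, ρ₀, hρ, hC⟩ := h K hK α β hα hβ N
  obtain ⟨D, hD0, hD⟩ := exists_norm_ev_sub_sum_le m hK N (W N) ψ (hW N)
  refine ⟨C + D, Real.exp ρ₀, fun a ha t ht1 ht2 ht => ?_⟩
  rw [Complex.norm_exp, Real.exp_le_exp] at ht
  rw [norm_exp_rpow, add_mul]
  exact (norm_sub_le_norm_sub_add_norm_sub _ (ev m a t (W N)) _).trans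
    (add_le_add (hC a ha t ht1 ht2 ht) (hD a ha t (hρ.trans ht)))

/-! ### Uniqueness -/

theorem ReducedAt.sub {m : ℕ} {a : Fin m → ℂ} {u p u' p' : ℂ → ℂ} {z : ℂ}
    (h : ReducedAt m a u p z) (h' : ReducedAt m a u' p' z) :
    ReducedAt m a (fun t => u t - u' t) (fun t => p t - p' t) z := by
  refine ⟨h.1.fun_sub h'.1, (h.2.fun_sub h'.2).congr_deriv ?_⟩
  ring

/-- A solution of the equation for `x ^ (-r) e ^ S f` which tends to zero at infinity in a
neighbourhood of the positive axis vanishes near infinity on the axis. -/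
theorem eq_zero_of_tendsto_zero {m : ℕ} (hm : 1 ≤ m) (a : Fin m → ℂ) {w pw : ℂ → ℂ} {ε : ℝ}
    (hε : 0 < ε) (hsol : ∀ t : ℂ, |t.im| ≤ ε → ReducedAt m a w pw t)
    (hw : ∀ κ : ℝ, 0 < κ → ∃ ρ : ℝ, ∀ t : ℂ, |t.im| ≤ ε → ρ ≤ t.re → ‖w t‖ ≤ κ) :
    ∃ ρ : ℝ, ∀ t : ℝ, ρ ≤ t → w (t : ℂ) = 0 := by
  obtain ⟨A, ρ₀, hA, hρ, hray⟩ := energy_along_ray hm (isCompact_singleton (x := a))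
  have h0 : eulerD m 0 = 0 := by simp [eulerD]
  have hwlim : Filter.Tendsto (fun t : ℝ => ‖w (t : ℂ)‖) Filter.atTop (nhds 0) := by
    rw [Metric.tendsto_atTop]
    intro κ hκ
    obtain ⟨ρ, h⟩ := hw (κ / 2) (half_pos hκ)
    refine ⟨ρ, fun t ht => ?_⟩
    have := h t (by simpa using hε.le) (by simpa using ht)
    rw [dist_zero_right, norm_norm]
    linarith
  have hplim : Filter.Tendsto (fun t : ℝ => ‖pw (t : ℂ)‖) Filter.atTop (nhds 0) := by
    rw [Metric.tendsto_atTop]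
    intro κ hκ
    -- Cauchy's estimate on the disc of radius ε costs the factor 1/ε; the disc must also lie to the
    -- right of ρ, hence the shift to ρ + ε.
    obtain ⟨ρ, h⟩ := hw (κ / 2 * ε) (by positivity)
    refine ⟨ρ + ε, fun t ht => ?_⟩
    have hball : ∀ z ∈ Metric.closedBall (t : ℂ) ε, |z.im| ≤ ε ∧ ρ ≤ z.re := by
      intro z hz
      rw [mem_closedBall_iff_norm] at hz
      have h1 := (Complex.abs_im_le_norm (z - t)).trans hz
      have h2 := (Complex.abs_re_le_norm (z - t)).trans hz
      rw [Complex.sub_im, Complex.ofReal_im, sub_zero] at h1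
      rw [Complex.sub_re, Complex.ofReal_re] at h2
      exact ⟨h1, by linarith [neg_le_of_abs_le h2]⟩
    have hd : DifferentiableOn ℂ w (Metric.closedBall (t : ℂ) ε) := fun z hz =>
      (hsol z (hball z hz).1).1.differentiableAt.differentiableWithinAt
    have h3 := Complex.norm_deriv_le_of_forall_mem_sphere_norm_le (c := (t : ℂ)) (R := ε)
      (C := κ / 2 * ε) (f := w) hε
      (DifferentiableOn.diffContOnCl_ball (U := Metric.closedBall (t : ℂ) ε) hd le_rfl)
      (fun z hz => by
        have := hball z (Metric.sphere_subset_closedBall hz)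
        exact h z this.1 this.2)
    rw [(hsol t (by simpa using hε.le)).1.deriv, mul_div_cancel_right₀ _ hε.ne'] at h3
    rw [dist_zero_right, norm_norm]
    linarith
  have hElim : Filter.Tendsto (fun t : ℝ => energy m a 0 w pw (t : ℂ)) Filter.atTop (nhds 0) := by
    have h1 := (hwlim.pow 2).add (hplim.pow 2)
    norm_num at h1
    refine squeeze_zero' (Filter.Eventually.of_forall fun t => energy_nonneg _ _ _ _ _ _) ?_ h1
    filter_upwards [Filter.eventually_ge_atTop 0] with t ht
    have hx : ‖xi m (t : ℂ)‖ ^ (halfDeg m - 1) ≤ 1 :=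
      pow_le_one₀ (norm_nonneg _) (norm_xi_le_one m (by simpa using ht))
    rw [energy, energy_weight, h0, map_zero, sub_zero, sub_zero]
    have := mul_le_mul_of_nonneg_right hx (sq_nonneg ‖pw (t : ℂ)‖)
    linarith
  refine ⟨ρ₀, fun t ht => ?_⟩
  have hle : energy m a 0 w pw (t : ℂ) ≤ 0 := by
    have h1 := hElim.const_mul A
    rw [mul_zero] at h1
    refine ge_of_tendsto h1 ?_
    filter_upwards [Filter.eventually_ge_atTop t] with T hT
    -- With U = 0 and η = 0 there is no forcing, so the energy at t is at most a constant times the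
    -- energy at T, which tends to zero.
    have := hray a rfl 0 1 0 le_rfl w pw t T ht hT
      (fun s _ => hsol s (by simpa using hε.le)) (fun s _ => by simp [residual_zero])
    simpa using this
  have h2 := (energy_lower m a w pw t).1.trans hle
  have h3 : ‖w (t : ℂ)‖ ^ 2 = 0 := le_antisymm h2 (sq_nonneg _)
  simpa using h3

/-- Only the case N = 1 at a single a enters, so uniqueness uses just the leading term and holds for
solutions with a priori different series. -/
theorem HasExpansion.tendsto_one {m : ℕ} {f : ℂ → (Fin m → ℂ) → ℂ}
    {φ : PowerSeries (Coeff m)} (h : HasExpansion m f (r m) φ)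
    (hφ : PowerSeries.constantCoeff φ = 1) (a : Fin m → ℂ) {ε : ℝ} (hε : ε < 3 * Real.pi / m) :
    ∀ κ : ℝ, 0 < κ → ∃ ρ : ℝ, ∀ t : ℂ, |t.im| ≤ ε → ρ ≤ t.re →
      ‖reduced m a (fun s => f s a) t - 1‖ ≤ κ := by
  intro κ hκ
  obtain ⟨C, R, hC⟩ := h {a} isCompact_singleton (-ε) ε (by linarith) hε 1
  obtain ⟨ρ, hρ0, hρ⟩ := exists_norm_xi_le m (ε := κ / (|C| + 1)) (by positivity)
  refine ⟨max ρ (Real.log (max R 1)), fun t ht1 ht2 => ?_⟩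
  have hR : R ≤ ‖Complex.exp t‖ := by
    rw [Complex.norm_exp]
    refine (le_max_left R 1).trans ?_
    rw [← Real.log_le_iff_le_exp (by positivity)]
    exact (le_max_right _ _).trans ht2
  have h1 := hC a rfl t (abs_le.1 ht1).1 (abs_le.1 ht1).2 hR
  rw [norm_exp_rpow, pow_one, Finset.sum_range_one, PowerSeries.coeff_zero_eq_constantCoeff_apply,
    hφ] at h1
  have e : xpow t (-(((0 : ℕ) : ℂ) / (q m : ℂ))) = 1 := by simp [xpow]
  rw [e, map_one, mul_one] at h1
  have h2 := hρ t ((le_max_left _ _).trans ht2)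
  rw [le_div_iff₀ (by positivity)] at h2
  refine h1.trans ?_
  have h3 : C * ‖xi m t‖ ≤ |C| * ‖xi m t‖ := by gcongr; exact le_abs_self C
  nlinarith [norm_nonneg (xi m t)]

theorem isPreconnected_sector (m : ℕ) : IsPreconnected (sector m) := by
  have e : sector m = Complex.imCLM ⁻¹' Set.Ioo (-(3 * Real.pi / m)) (3 * Real.pi / m) := by
    ext t
    simp [sector, abs_lt]
  rw [e]
  exact ((convex_Ioo _ _).linear_preimage (Complex.imCLM : ℂ →ₗ[ℝ] ℝ)).isPreconnected

theorem hasDerivAt_deriv_of_solvesOn {m : ℕ} {a : Fin m → ℂ} {f : ℂ → ℂ} {U : Set ℂ}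
    (hf : AnalyticOnNhd ℂ f U) (h : SolvesOn m a f U) {t : ℂ} (ht : t ∈ U) :
    HasDerivAt (deriv f) (deriv f t + P m (Complex.exp t) a * f t) t := by
  have h1 := (hf t ht).deriv.differentiableAt.hasDerivAt
  have h2 : HasDerivAt (dx f)
      (Complex.exp (-t) * (-1) * deriv f t + Complex.exp (-t) * deriv (deriv f) t) t :=
    ((hasDerivAt_id t).fun_neg.cexp).fun_mul h1
  have h3 := h t ht
  rw [dx, h2.deriv] at h3
  refine h1.congr_deriv ?_
  have h0 := Complex.exp_ne_zero t
  rw [Complex.exp_neg] at h3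
  field_simp at h3
  linear_combination h3

theorem dx_eq {f g : ℂ → ℂ} (h : ∀ t, HasDerivAt f (g t) t) :
    dx f = fun t => Complex.exp (-t) * g t := by
  ext t
  rw [dx, (h t).deriv]

theorem solvesOn_of_hasDerivAt {m : ℕ} {a : Fin m → ℂ} {f g : ℂ → ℂ}
    (hf : ∀ t, HasDerivAt f (g t) t)
    (hg : ∀ t, HasDerivAt g (g t + P m (Complex.exp t) a * f t) t) :
    SolvesOn m a f Set.univ := by
  intro t _
  have h2 : HasDerivAt (fun t => Complex.exp (-t) * g t) (Complex.exp (-t) * (-1) * g t +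
      Complex.exp (-t) * (g t + P m (Complex.exp t) a * f t)) t :=
    ((hasDerivAt_id t).fun_neg.cexp).fun_mul (hg t)
  rw [dx_eq hf, dx, h2.deriv]
  have h0 := Complex.exp_ne_zero t
  rw [Complex.exp_neg]
  field_simp
  ring

/-- A normalized solution agrees with any entire solution whose quotient by `x ^ r e ^ (-S)`
tends to `1` near the positive axis. -/
theorem IsNormalizedSolution.eq_on_sector {m : ℕ} (hm : 1 ≤ m) {Ψ : ℂ → (Fin m → ℂ) → ℂ}
    {ψ : PowerSeries (Coeff m)} (h : IsNormalizedSolution m Ψ ψ) (a : Fin m → ℂ) {f g : ℂ → ℂ}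
    (hf : ∀ t, HasDerivAt f (g t) t)
    (hg : ∀ t, HasDerivAt g (g t + P m (Complex.exp t) a * f t) t)
    (hlim : ∀ ε : ℝ, ε < 3 * Real.pi / m → ∀ κ : ℝ, 0 < κ → ∃ ρ : ℝ, ∀ t : ℂ, |t.im| ≤ ε →
      ρ ≤ t.re → ‖reduced m a f t - 1‖ ≤ κ) :
    Set.EqOn (fun t => Ψ t a) f (sector m) := by
  have hm0 : (0 : ℝ) < m := by exact_mod_cast hm
  have hπ := Real.pi_pos
  set ε : ℝ := 3 * Real.pi / m / 2 with hε
  have hpos : 0 < 3 * Real.pi / m := by positivity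
  have hε0 : 0 < ε := by positivity
  have hε1 : ε < 3 * Real.pi / m := by linarith
  have hsec : ∀ t : ℂ, |t.im| ≤ ε → t ∈ sector m := fun t ht => ht.trans_lt hε1
  obtain ⟨ρ, hρ⟩ := eq_zero_of_tendsto_zero hm a
    (w := fun t => reduced m a (fun s => Ψ s a) t - reduced m a f t)
    (pw := fun t => reducedDeriv m a (fun s => Ψ s a) (deriv fun s => Ψ s a) t -
      reducedDeriv m a f g t) hε0
    (fun t ht => (reducedAt_of_solution hm a
        ((h.analytic a t (hsec t ht)).differentiableAt.hasDerivAt)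
        (hasDerivAt_deriv_of_solvesOn (h.analytic a) (h.solves a) (hsec t ht))).sub
      (reducedAt_of_solution hm a (hf t) (hg t)))
    (by
      intro κ hκ
      obtain ⟨ρ₁, h₁⟩ := h.expansion.tendsto_one h.constantCoeff a hε1 (κ / 2) (half_pos hκ)
      obtain ⟨ρ₂, h₂⟩ := hlim ε hε1 (κ / 2) (half_pos hκ)
      refine ⟨max ρ₁ ρ₂, fun t ht1 ht2 => ?_⟩
      have e1 := h₁ t ht1 ((le_max_left _ _).trans ht2)
      have e2 := h₂ t ht1 ((le_max_right _ _).trans ht2)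
      rw [norm_sub_rev] at e2
      exact (norm_sub_le_norm_sub_add_norm_sub _ 1 _).trans (by linarith))
  have heq : ∀ t : ℝ, ρ ≤ t → Ψ t a = f t := by
    intro t ht
    have h1 := sub_eq_zero.1 (hρ t ht)
    simp only [reduced] at h1
    exact (div_left_inj' (leading_ne_zero m a t)).1 h1
  have hfa : AnalyticOnNhd ℂ f (sector m) := fun t _ =>
    (Differentiable.analyticAt (fun s => (hf s).differentiableAt) t)
  refine (h.analytic a).eqOn_of_preconnected_of_frequently_eq hfa (isPreconnected_sector m)
    (z₀ := (ρ : ℂ)) (hsec _ (by simpa using hε0.le)) ?_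
  -- The real points to the right of ρ accumulate at ρ, which is what the identity theorem requires.
  have ht : Filter.Tendsto (fun s : ℝ => (s : ℂ)) (nhdsWithin ρ (Set.Ioi ρ))
      (nhdsWithin (ρ : ℂ) {(ρ : ℂ)}ᶜ) := by
    refine tendsto_nhdsWithin_iff.2 ⟨(Complex.continuous_ofReal.tendsto ρ).mono_left
      nhdsWithin_le_nhds, ?_⟩
    filter_upwards [self_mem_nhdsWithin] with s hs
    have : s ≠ ρ := ne_of_gt hs
    simpa using this
  refine ht.frequently (Filter.Eventually.frequently ?_)
  filter_upwards [self_mem_nhdsWithin] with s hs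
  exact heq s (le_of_lt hs)

/-! ### The differentiated expansion -/

theorem xpow_add (t α β : ℂ) : xpow t (α + β) = xpow t α * xpow t β := by
  rw [xpow, add_mul, Complex.exp_add]; rfl

theorem dx_div_leading (m : ℕ) (A B : ℂ) (a : Fin m → ℂ) (t : ℂ) :
    dx (comb m A B a) t /
        (xpow t (MvPolynomial.eval a (r m) + (m : ℂ) / 2 - 1) * Complex.exp (-S m t a)) =
      xi m t ^ halfDeg m *
        (logDeriv m a t * combReduced m A B a t + combReducedDeriv m A B a t) := by
  have e : xpow t (MvPolynomial.eval a (r m) + (m : ℂ) / 2 - 1) * Complex.exp (-S m t a) =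
      leading m a t * zeta m t * Complex.exp (-t) := by
    rw [sub_eq_add_neg, xpow_add, xpow_add, leading, zeta]
    simp only [xpow, neg_mul, one_mul]
    ring
  have h := zeta_mul_xi_pow m t
  have hL := leading_ne_zero m a t
  have hz : zeta m t ≠ 0 := Complex.exp_ne_zero _
  have he := Complex.exp_ne_zero (-t)
  rw [dx, (hasDerivAt_comb m A B a t).deriv, combDeriv_eq, e]
  rw [div_eq_iff (mul_ne_zero (mul_ne_zero hL hz) he)]
  linear_combination -(leading m a t * Complex.exp (-t) *
    (logDeriv m a t * combReduced m A B a t + combReducedDeriv m A B a t)) * h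

/-- The error of the normalized derivative is a bounded multiple of the error in u plus ξ^h times
the error in u', precisely the two quantities bounded by `exists_error_le_on_sector`. -/
theorem derivative_error_eq (m : ℕ) (a : Fin m → ℂ) (u p t : ℂ) (U : Polynomial (Coeff m)) :
    xi m t ^ halfDeg m * (logDeriv m a t * u + p) - ev m a t (derivFactor m U) =
      ev m a t (Polynomial.X ^ halfDeg m * Polynomial.C (r m) - sigma m) * (u - ev m a t U) +
      xi m t ^ halfDeg m * (p - ev m a t (eulerD m U)) := by
  have h := zeta_mul_xi_pow m t
  rw [derivFactor, logDeriv]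
  simp only [map_add, map_sub, map_neg, map_mul, map_pow, ev_X, ev_C]
  linear_combination -(ev m a t (sigma m) * u) * h

theorem hasExpansion_dx {m : ℕ} (hm : 1 ≤ m) {α β : (Fin m → ℂ) → ℂ}
    (hlim : ∀ a, Filter.Tendsto (fun t : ℝ => energy m a 1 (combReduced m (α a) (β a) a)
        (combReducedDeriv m (α a) (β a) a) (t : ℂ)) Filter.atTop (nhds 0)) :
    HasExpansion m (fun t a => dx (comb m (α a) (β a) a) t)
      (r m + MvPolynomial.C ((m : ℂ) / 2 - 1)) (formalDeriv m (formalSolution m)) := by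
  refine hasExpansion_of_bound (fun N => derivFactor m (formalSum m N))
    (fun N n hn => coeff_derivFactor_formalSum hn.le) fun K hK A B hA hB N => ?_
  obtain ⟨C, ρ₀, hC, hρ, h⟩ := exists_error_le_on_sector hm hK
    (u := fun a => combReduced m (α a) (β a) a) (p := fun a => combReducedDeriv m (α a) (β a) a)
    (fun a t => reducedAt_comb hm _ _ a t) hlim N hA hB
  obtain ⟨D, hD0, hD⟩ := exists_norm_ev_le m hK
    (Polynomial.X ^ halfDeg m * Polynomial.C (r m) - sigma m)
  refine ⟨D * C + C, ρ₀, hρ, fun a ha t ht1 ht2 ht => ?_⟩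
  obtain ⟨h1, h2⟩ := h a ha t ht1 ht2 ht
  rw [map_add, MvPolynomial.eval_C, ← add_sub_assoc, dx_div_leading, derivative_error_eq, add_mul,
    mul_assoc]
  refine (norm_add_le _ _).trans (add_le_add ?_ h2)
  rw [norm_mul]
  exact mul_le_mul (hD a ha t (hρ.trans ht)) h1 (norm_nonneg _) hD0

theorem hasExpansion_comb {m : ℕ} (hm : 1 ≤ m) {α β : (Fin m → ℂ) → ℂ}
    (hlim : ∀ a, Filter.Tendsto (fun t : ℝ => energy m a 1 (combReduced m (α a) (β a) a)
        (combReducedDeriv m (α a) (β a) a) (t : ℂ)) Filter.atTop (nhds 0)) :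
    HasExpansion m (fun t a => comb m (α a) (β a) a t) (r m) (formalSolution m) := by
  refine hasExpansion_of_bound (formalSum m)
    (fun N n hn => (coeff_formalSolution hn.le).symm ▸ by rw [coeff_formalSum, if_pos hn.le])
    fun K hK A B hA hB N => ?_
  obtain ⟨C, ρ₀, hC, hρ, h⟩ := exists_error_le_on_sector hm hK
    (u := fun a => combReduced m (α a) (β a) a) (p := fun a => combReducedDeriv m (α a) (β a) a)
    (fun a t => reducedAt_comb hm _ _ a t) hlim N hA hB
  exact ⟨C, ρ₀, hρ, fun a ha t ht1 ht2 ht => (h a ha t ht1 ht2 ht).1⟩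

theorem constantCoeff_formalDeriv {m : ℕ} (hm : 1 ≤ m) :
    PowerSeries.coeff 0 (formalDeriv m (formalSolution m)) = -1 := by
  have hp := halfDeg_pos hm
  rw [← coeff_derivFactor_formalSum (le_refl 0), derivFactor, formalSum, mul_one,
    Polynomial.coeff_add, Polynomial.coeff_neg, sigma_coeff_zero, Polynomial.coeff_X_pow_mul',
    if_neg (by omega), add_zero]

theorem HasExpansion.leading_term {m : ℕ} {f : ℂ → (Fin m → ℂ) → ℂ}
    {ρ : MvPolynomial (Fin m) ℂ} {ψ : PowerSeries (Coeff m)} (h : HasExpansion m f ρ ψ)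
    {K : Set (Fin m → ℂ)} (hK : IsCompact K) {α β : ℝ} (hα : -(3 * Real.pi / m) < α)
    (hβ : β < 3 * Real.pi / m) {ε : ℝ} (hε : 0 < ε) :
    ∃ R : ℝ, ∀ a ∈ K, ∀ t : ℂ, α ≤ t.im → t.im ≤ β → R ≤ ‖Complex.exp t‖ →
      ‖f t a / (xpow t (MvPolynomial.eval a ρ) * Complex.exp (-S m t a)) -
        MvPolynomial.eval a (PowerSeries.coeff 0 ψ)‖ ≤ ε := by
  obtain ⟨C, R, hC⟩ := h K hK α β hα hβ 1
  obtain ⟨ρ₀, hρ0, hρ⟩ := exists_norm_xi_le m (ε := ε / (|C| + 1)) (by positivity)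
  refine ⟨max R (Real.exp ρ₀), fun a ha t ht1 ht2 ht => ?_⟩
  have h1 := hC a ha t ht1 ht2 ((le_max_left _ _).trans ht)
  have e : xpow t (-(((0 : ℕ) : ℂ) / (q m : ℂ))) = 1 := by simp [xpow]
  rw [norm_exp_rpow, pow_one, Finset.sum_range_one, e, mul_one] at h1
  have hre : ρ₀ ≤ t.re := by
    rw [← Real.exp_le_exp, ← Complex.norm_exp]
    exact (le_max_right _ _).trans ht
  have h2 := hρ t hre
  rw [le_div_iff₀ (by positivity)] at h2
  refine h1.trans ?_
  have h3 : C * ‖xi m t‖ ≤ |C| * ‖xi m t‖ := by gcongr; exact le_abs_self C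
  nlinarith [norm_nonneg (xi m t)]

end

end IrregularSchrodinger

/-! ### The main theorem -/

theorem theorem2p1 (m : ℕ) (hm : 1 ≤ m) :
    ∃ (Φ₀ : ℂ → (Fin m → ℂ) → ℂ) (φ₀ : PowerSeries (MvPolynomial (Fin m) ℂ)),
      -- existence, with the asymptotic expansion
      IrregularSchrodinger.IsNormalizedSolution m Φ₀ φ₀ ∧
      -- uniqueness
      (∀ (Ψ : ℂ → (Fin m → ℂ) → ℂ) (ψ : PowerSeries (MvPolynomial (Fin m) ℂ)),
        IrregularSchrodinger.IsNormalizedSolution m Ψ ψ →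
          ∀ t ∈ IrregularSchrodinger.sector m, ∀ a, Ψ t a = Φ₀ t a) ∧
      -- holomorphic in (x, a) on the whole universal covering times ℂ ^ m, still a solution
      Differentiable ℂ (fun p : ℂ × (Fin m → ℂ) => Φ₀ p.1 p.2) ∧
      (∀ a, IrregularSchrodinger.SolvesOn m a (fun t => Φ₀ t a) Set.univ) ∧
      -- the expansion can be differentiated with respect to x
      IrregularSchrodinger.HasExpansion m
        (fun t a => IrregularSchrodinger.dx (fun s => Φ₀ s a) t)
        (IrregularSchrodinger.r m + MvPolynomial.C ((m : ℂ) / 2 - 1))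
        (IrregularSchrodinger.formalDeriv m φ₀) ∧
      -- leading term of the derivative
      (∀ K : Set (Fin m → ℂ), IsCompact K →
        ∀ α β : ℝ, -(3 * Real.pi / m) < α → β < 3 * Real.pi / m →
        ∀ ε : ℝ, 0 < ε → ∃ R : ℝ, ∀ a ∈ K, ∀ t : ℂ, α ≤ t.im → t.im ≤ β →
          R ≤ ‖Complex.exp t‖ →
          ‖IrregularSchrodinger.dx (fun s => Φ₀ s a) t /
              (IrregularSchrodinger.xpow t
                  (MvPolynomial.eval a (IrregularSchrodinger.r m) + (m : ℂ) / 2 - 1) *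
                Complex.exp (-IrregularSchrodinger.S m t a)) - (-1)‖ ≤ ε) := by
  obtain ⟨α, β, hα, hβ, hlim⟩ := IrregularSchrodinger.exists_recessive hm
  have hexp := IrregularSchrodinger.hasExpansion_comb hm hlim
  have hdexp := IrregularSchrodinger.hasExpansion_dx hm hlim
  have hsol : ∀ a, IrregularSchrodinger.SolvesOn m a
      (IrregularSchrodinger.comb m (α a) (β a) a) Set.univ := fun a =>
    IrregularSchrodinger.solvesOn_of_hasDerivAt
      (IrregularSchrodinger.hasDerivAt_comb m (α a) (β a) a)
      (IrregularSchrodinger.hasDerivAt_combDeriv m (α a) (β a) a)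
  refine ⟨fun t a => IrregularSchrodinger.comb m (α a) (β a) a t,
    IrregularSchrodinger.formalSolution m, ⟨fun a t _ => ?_, fun a t _ => hsol a t (Set.mem_univ t),
      IrregularSchrodinger.constantCoeff_formalSolution m, hexp⟩, ?_, ?_, hsol, hdexp, ?_⟩
  · exact Differentiable.analyticAt
      (fun s => (IrregularSchrodinger.hasDerivAt_comb m (α a) (β a) a s).differentiableAt) t
  · intro Ψ ψ hΨ t ht a
    exact hΨ.eq_on_sector hm a (IrregularSchrodinger.hasDerivAt_comb m (α a) (β a) a)
      (IrregularSchrodinger.hasDerivAt_combDeriv m (α a) (β a) a)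
      (fun ε hε => hexp.tendsto_one (IrregularSchrodinger.constantCoeff_formalSolution m) a hε) ht
  · exact ((hα.comp differentiable_snd).mul (IrregularSchrodinger.differentiable_entireSol m 1 0)).add
      ((hβ.comp differentiable_snd).mul (IrregularSchrodinger.differentiable_entireSol m 0 1))
  · intro K hK A B hA hB ε hε
    obtain ⟨R, hR⟩ := hdexp.leading_term hK hA hB hε
    refine ⟨R, fun a ha t ht1 ht2 ht => ?_⟩
    have h := hR a ha t ht1 ht2 ht
    rwa [IrregularSchrodinger.constantCoeff_formalDeriv hm, map_neg, map_one, map_add,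
      MvPolynomial.eval_C, ← add_sub_assoc] at h
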